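/- **Setting.** Let $G$ be a finite group, $Y=\bigoplus_{g\in G}Y_g$ a finite-dimensional Yetter–Drinfeld module over $\mathbb C G$ (so $g\triangleright Y_h=Y_{ghg^{-1}}$), $R$ a commutative $\mathbb C$-algebra and $\mu\colon G\times G\to R^\times$ a normalised $2$-cocycle: $\mu(g,h)\mu(gh,k)=\mu(g,hk)\mu(h,k)$, $\mu(1,g)=\mu(g,1)=1$. Put $\chi(g,k)=\mu(g,k)\,\mu(gkg^{-1},g)^{-1}$. For a graded $R$-module with $G$-action $\triangleright$, write $g\triangleright_\chi x=\chi(g,k)(g\triangleright x)$ for $x$ of degree $k$, extended linearly. Let $R\text{-}\mathcal{YD}(G)$ be the category of $G$-graded $RG$-modules $X=\bigoplus_g X_g$ with every $X_g$ free over $R$ and $g\triangleright X_h=X_{ghg^{-1}}$; its braiding is $\Psi(x\otimes y)=(g\triangleright y)\otimes x$ for $x\in X_g$. An algebra in this category is an $R$-algebra whose product and unit respect both the grading and the action. For an $R$-module $V$ with braiding $\Psi$, let $\mathcal B(V,\Psi)=T(V)/\bigoplus_n\ker [n]!_\Psi$, where $[n]_\Psi=\mathrm{id}+\Psi_{n-1,n}+\Psi_{n-1,n}\Psi_{n-2,n-1}+\dots+\Psi_{n-1,n}\cdots\Psi_{1,2}$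 and $[n]!_\Psi=([1]_\Psi\otimes\mathrm{id}^{\otimes(n-1)})([2]_\Psi\otimes\mathrm{id}^{\otimes(n-2)})\cdots[n]_\Psi$ on $V^{\otimes n}$; $\mathcal B(X)=\mathcal B(X,\Psi)$ for a Yetter–Drinfeld module $X$ with braiding $\Psi$. The dual $Y^*$ is a Yetter–Drinfeld module with the contragredient action and $(Y^*)_g=(Y_{g^{-1}})^*$; let $\Psi^*$ be its braiding, and $\tau$ the transposition. Let $\beta(f\otimes v)=\langle f,v^{(0)}\rangle v^{(1)}\in\mathbb C G$, where $v\mapsto v^{(0)}\otimes v^{(1)}$ is the coaction ($v\mapsto v\otimes g$ for $v\in Y_g$). For ideals $I^-\subset T(Y)$, $I^+\subset T(Y^*)$ let $A_\beta(I^-,I^+)$ be the quotient of $T(Y\oplus Y^*)\rtimes G$ by $I^-$, $I^+$ and the relations $fv-vf=\beta(f\otimes v)$, $f\in Y^*$, $v\in Y$. The braided Heisenberg double $\mathcal H_Y$ is the minimal double $A_\beta(I^-_\beta,I^+_\beta)$, where $I_\beta^-$ (resp. $I_\beta^+$) is the largest $\mathbb N$-graded $G$-invariant ideal of $T(Y)$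 (resp. $T(Y^*)$), contained in positive degrees, with $[Y^*,I_\beta^-]\subset I_\beta^-\cdot\mathbb C G$ (resp. $[I_\beta^+,Y]\subset\mathbb C G\cdot I_\beta^+$) in $A_\beta(0,0)$. It is $G$-graded, with $v\in Y_g$ of degree $g$, $g\in G$ of degree $g$ and $f\in Y^*$ of degree $1$, and $G$ acts on it by $g\triangleright x=gxg^{-1}$. The extension $(\widetilde{\mathcal H_Y})_\mu$ is the $R$-module $R\otimes_{\mathbb C}\mathcal H_Y$ with the extended grading and the product $a\star b=\mu(g,h)ab$ for $a$ of degree $g$ and $b$ of degree $h$. Let $RG_\mu$ be the twisted group algebra ($g\star h=\mu(g,h)gh$), $\widetilde Y_\mu=R\otimes_{\mathbb C}Y$ with the extended grading and the action $\triangleright_\chi$, and $\widetilde Y^*=R\otimes_{\mathbb C}Y^*$ the extension of scalars of $Y^*$. **Theorem (cocycle extension of a braided Heisenberg double).** 1. With the grading above and the action $\triangleright_\chi$, $(\widetilde{\mathcal H_Y})_\mu$ is an algebra in the category $R\text{-}\mathcal{YD}(G)$. 2. The identity maps on $Y$, $G$ and $Y^*$ extend to injective $R$-algebra homomorphisms of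 $A_{-1}=\mathcal B(\widetilde Y_\mu)$, $A_0=RG_\mu$ and $A_1=\mathcal B(\widetilde Y^*,\tau\Psi^*\tau)$ into $(\widetilde{\mathcal H_Y})_\mu$, and multiplication $a\otimes x\otimes b\mapsto a\star x\star b$ is an isomorphism of $R$-modules $$\mathcal B(\widetilde Y_\mu)\otimes_R RG_\mu\otimes_R\mathcal B(\widetilde Y^*,\tau\Psi^*\tau)\;\cong\;(\widetilde{\mathcal H_Y})_\mu .$$ 3. $A_{-1}A_0$ and $A_0A_1$ are subalgebras of $(\widetilde{\mathcal H_Y})_\mu$. 4. For $g\in G$, $v\in Y$, $f\in Y^*$ one has $$g\star v=(g\triangleright_\chi v)\star g,\qquad g\star f=(g\triangleright f)\star g,\qquad f\star v-v\star f=\langle f,v^{(0)}\rangle v^{(1)},$$ where $\triangleright$ is the original action of $G$ on $Y^*$. 5. The algebras $A_{-1},A_0,A_1$ and the relations in 4 describe $(\widetilde{\mathcal H_Y})_\mu$ completely: for every $R$-algebra $B$ and all $R$-algebra homomorphisms $A_i\to B$, $i=-1,0,1$, such that the images of $v$, $g$, $f$ satisfy the relations in 4, there is a unique $R$-algebra homomorphism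 $(\widetilde{\mathcal H_Y})_\mu\to B$ extending all three. -/

import Mathlib

open scoped TensorProduct

namespace BraidedDoubles

noncomputable section

/-! ### Group-graded modules -/

/-- A `G`-graded `R`-module `V = ⨁ g, V_g`. -/
structure GradedMod (R G V : Type*) [CommRing R] [DecidableEq G] [AddCommGroup V]
    [Module R V] where
  comp : G → Submodule R V
  isInternal : DirectSum.IsInternal comp

section GradedMod

variable {R G V : Type*} [CommRing R] [DecidableEq G] [AddCommGroup V] [Module R V]

/-- The projection `V → V_g` of a graded module, as an endomorphism of `V`. -/
def GradedMod.proj (𝒱 : GradedMod R G V) (g : G) : V →ₗ[R] V :=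
  (𝒱.comp g).subtype ∘ₗ DirectSum.component R G (fun g => 𝒱.comp g) g ∘ₗ
    (LinearEquiv.ofBijective (DirectSum.coeLinearMap 𝒱.comp) 𝒱.isInternal).symm.toLinearMap

theorem GradedMod.proj_mem (𝒱 : GradedMod R G V) (g : G) (v : V) : 𝒱.proj g v ∈ 𝒱.comp g :=
  Subtype.property _

theorem GradedMod.proj_of_mem (𝒱 : GradedMod R G V) {g : G} {v : V} (hv : v ∈ 𝒱.comp g) :
    𝒱.proj g v = v := by
  have := 𝒱.isInternal.ofBijective_coeLinearMap_of_mem hv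
  simpa [GradedMod.proj, DirectSum.component] using! congrArg Subtype.val this

theorem GradedMod.proj_of_mem_ne (𝒱 : GradedMod R G V) {g h : G} (hne : g ≠ h) {v : V}
    (hv : v ∈ 𝒱.comp g) : 𝒱.proj h v = 0 := by
  have := 𝒱.isInternal.ofBijective_coeLinearMap_of_mem_ne hne hv
  simpa [GradedMod.proj, DirectSum.component] using! congrArg Subtype.val this

theorem GradedMod.induction (𝒱 : GradedMod R G V) {P : V → Prop}
    (hom : ∀ g, ∀ v ∈ 𝒱.comp g, P v) (add : ∀ v w, P v → P w → P (v + w)) (zero : P 0)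
    (v : V) : P v := by
  have hv : v ∈ ⨆ g, 𝒱.comp g := by
    rw [𝒱.isInternal.submodule_iSup_eq_top]; trivial
  exact Submodule.iSup_induction _ (motive := P) hv hom zero add

theorem GradedMod.ext_hom {W : Type*} [AddCommGroup W] [Module R W] (𝒱 : GradedMod R G V)
    {a b : V →ₗ[R] W} (h : ∀ g, ∀ v ∈ 𝒱.comp g, a v = b v) : a = b := by
  ext v
  refine 𝒱.induction (P := fun v => a v = b v) h (fun v w hv hw => ?_) (by simp) v
  rw [map_add, map_add, hv, hw]

theorem GradedMod.sum_proj [Fintype G] (𝒱 : GradedMod R G V) (v : V) :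
    ∑ g, 𝒱.proj g v = v := by
  have : (∑ g, 𝒱.proj g) = LinearMap.id := by
    refine 𝒱.ext_hom fun g v hv => ?_
    rw [LinearMap.sum_apply, Finset.sum_eq_single g]
    · exact 𝒱.proj_of_mem hv
    · exact fun h _ hne => 𝒱.proj_of_mem_ne hne.symm hv
    · simp
  simpa using congrArg (fun a => a v) this

/-- Submodules that span `V` and are separated by endomorphisms form a direct sum. -/
theorem isInternal_of_separating (C : G → Submodule R V) (c : G → V →ₗ[R] V)
    (same : ∀ g, ∀ v ∈ C g, c g v = v) (ne : ∀ g h, g ≠ h → ∀ v ∈ C g, c h v = 0)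
    (top : ⨆ g, C g = ⊤) : DirectSum.IsInternal C := by
  refine DirectSum.isInternal_submodule_of_iSupIndep_of_iSup_eq_top ?_ top
  rw [iSupIndep_def]
  intro g
  rw [Submodule.disjoint_def]
  intro v hv hv'
  rw [← same g v hv]
  have hle : (⨆ h, ⨆ (_ : h ≠ g), C h) ≤ LinearMap.ker (c g) :=
    iSup_le fun h => iSup_le fun hne w hw => ne h g hne w hw
  exact hle hv'

/-- Extension of scalars of a graded module: `R ⊗ V = ⨁ g, R ⊗ V_g`. -/
def GradedMod.baseChange {k : Type*} [CommRing k] {V : Type*} [AddCommGroup V] [Module k V]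
    (𝒱 : GradedMod k G V) (R : Type*) [CommRing R] [Algebra k R] : GradedMod R G (R ⊗[k] V) where
  comp g := (𝒱.comp g).baseChange R
  isInternal := DirectSum.IsInternal.baseChange _ 𝒱.isInternal

end GradedMod

/-! ### Normalised 2-cocycles -/

/-- A normalised 2-cocycle on `G` with values in the abelian group `Γ` (trivial action). -/
structure Cocycle (G Γ : Type*) [Group G] [CommGroup Γ] where
  toFun : G → G → Γ
  cocycle : ∀ g h k, toFun g h * toFun (g * h) k = toFun g (h * k) * toFun h k
  one_left : ∀ g, toFun 1 g = 1
  one_right : ∀ g, toFun g 1 = 1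

instance {G Γ : Type*} [Group G] [CommGroup Γ] : CoeFun (Cocycle G Γ) fun _ => G → G → Γ :=
  ⟨Cocycle.toFun⟩

/-- `χ_μ(g, k) = μ(g, k) μ(g k g⁻¹, g)⁻¹`. -/
def Cocycle.chi {G Γ : Type*} [Group G] [CommGroup Γ] (μ : Cocycle G Γ) (g k : G) : Γ :=
  μ g k * (μ (g * k * g⁻¹) g)⁻¹

theorem Cocycle.chi_one {G Γ : Type*} [Group G] [CommGroup Γ] (μ : Cocycle G Γ) (k : G) :
    μ.chi 1 k = 1 := by
  simp [Cocycle.chi, μ.one_left, μ.one_right]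

theorem Cocycle.chi_mul {G Γ : Type*} [Group G] [CommGroup Γ] (μ : Cocycle G Γ) (g h k : G) :
    μ.chi (g * h) k = μ.chi g (h * k * h⁻¹) * μ.chi h k := by
  have e1 := μ.cocycle g h k
  have e2 := μ.cocycle g (h * k * h⁻¹) h
  have e3 := μ.cocycle (g * (h * k * h⁻¹) * g⁻¹) g h
  have a1 : g * h * k * (g * h)⁻¹ = g * (h * k * h⁻¹) * g⁻¹ := by group
  have a2 : h * k * h⁻¹ * h = h * k := by group
  have a3 : g * (h * k * h⁻¹) * g⁻¹ * g = g * (h * k * h⁻¹) := by group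
  rw [a2] at e2
  rw [a3] at e3
  simp only [Cocycle.chi, a1]
  generalize μ g (h * k * h⁻¹) = a at *
  generalize μ (g * (h * k * h⁻¹) * g⁻¹) g = b at *
  generalize μ (g * (h * k * h⁻¹)) h = c at *
  generalize μ (g * (h * k * h⁻¹) * g⁻¹) (g * h) = d at *
  generalize μ g h = e at *
  generalize μ (g * h) k = f at *
  generalize μ g (h * k) = p at *
  generalize μ h k = q at *
  generalize μ (h * k * h⁻¹) h = r at *
  -- e f = p q, a c = p r, b c = d e
  rw [← div_eq_mul_inv, ← div_eq_mul_inv, ← div_eq_mul_inv, div_mul_div_comm,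
    div_eq_div_iff_mul_eq_mul]
  have h1 : (f * (b * r)) * (e * c) = (a * q * d) * (e * c) := by
    calc (f * (b * r)) * (e * c) = (e * f) * (b * c) * r := by
          simp only [mul_comm, mul_left_comm]
      _ = (p * q) * (d * e) * r := by rw [e1, e3]
      _ = (p * r) * (q * d * e) := by simp only [mul_comm, mul_left_comm]
      _ = (a * c) * (q * d * e) := by rw [e2]
      _ = (a * q * d) * (e * c) := by simp only [mul_comm, mul_left_comm]
  exact mul_right_cancel h1

/-! ### Yetter-Drinfeld modules -/

/-- An object of the category of `R`-free Yetter-Drinfeld modules over `G`: a `G`-graded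
`RG`-module with free homogeneous components, such that `g ▷ V_h = V_{g h g⁻¹}`
(one inclusion, for all `g` and `h`, gives the equality). -/
structure YDMod (R G V : Type*) [CommRing R] [Group G] [DecidableEq G] [AddCommGroup V]
    [Module R V] extends GradedMod R G V where
  free : ∀ g, Module.Free R (comp g)
  act : Representation R G V
  act_mem : ∀ g h v, v ∈ comp h → act g v ∈ comp (g * h * g⁻¹)

section YDMod

variable {R G V : Type*} [CommRing R] [Group G] [DecidableEq G] [AddCommGroup V] [Module R V]

/-- The braiding `Ψ(y ⊗ z) = (g ▷ z) ⊗ y` for `y ∈ V_g`, extended linearly. -/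
def YDMod.braiding [Fintype G] (𝒱 : YDMod R G V) : V ⊗[R] V →ₗ[R] V ⊗[R] V :=
  ∑ g, TensorProduct.map (𝒱.act g) (𝒱.proj g) ∘ₗ (TensorProduct.comm R V V).toLinearMap

/-- The action `g ▷_χ v = χ(g, k) (g ▷ v)` for `v ∈ V_k`, extended linearly. -/
def YDMod.twistAct [Fintype G] (𝒱 : YDMod R G V) (μ : Cocycle G Rˣ) (g : G) : V →ₗ[R] V :=
  ∑ k, (μ.chi g k : R) • (𝒱.act g ∘ₗ 𝒱.proj k)

theorem YDMod.twistAct_of_mem [Fintype G] (𝒱 : YDMod R G V) (μ : Cocycle G Rˣ) (g : G) {k : G}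
    {v : V} (hv : v ∈ 𝒱.comp k) : 𝒱.twistAct μ g v = (μ.chi g k : R) • 𝒱.act g v := by
  rw [YDMod.twistAct, LinearMap.sum_apply, Finset.sum_eq_single k]
  · simp [𝒱.proj_of_mem hv]
  · intro h _ hne
    simp [𝒱.proj_of_mem_ne hne.symm hv]
  · simp

/-- The same graded module with the action `▷` replaced by `▷_χ`. -/
def YDMod.twist [Fintype G] (𝒱 : YDMod R G V) (μ : Cocycle G Rˣ) : YDMod R G V where
  toGradedMod := 𝒱.toGradedMod
  free := 𝒱.free
  act :=
    { toFun := 𝒱.twistAct μ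
      map_one' := by
        refine 𝒱.ext_hom fun k v hv => ?_
        simp [𝒱.twistAct_of_mem μ 1 hv, μ.chi_one]
      map_mul' := fun g h => by
        refine 𝒱.ext_hom fun k v hv => ?_
        rw [Module.End.mul_apply, 𝒱.twistAct_of_mem μ (g * h) hv, 𝒱.twistAct_of_mem μ h hv,
          map_smul, 𝒱.twistAct_of_mem μ g (𝒱.act_mem h k v hv), smul_smul, μ.chi_mul, map_mul,
          Module.End.mul_apply, Units.val_mul, mul_comm] }
  act_mem := fun g h v hv => by
    change 𝒱.twistAct μ g v ∈ _
    rw [𝒱.twistAct_of_mem μ g hv]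
    exact Submodule.smul_mem _ _ (𝒱.act_mem g h v hv)

/-- Extension of scalars of a Yetter-Drinfeld module. -/
def YDMod.baseChange {k V : Type*} [CommRing k] [AddCommGroup V] [Module k V] (𝒱 : YDMod k G V)
    (R : Type*) [CommRing R] [Algebra k R] : YDMod R G (R ⊗[k] V) where
  toGradedMod := 𝒱.toGradedMod.baseChange R
  free := fun g => by
    have := 𝒱.free g
    exact Module.Free.of_equiv (LinearEquiv.ofBijective ((𝒱.comp g).toBaseChange R)
      (DirectSum.IsInternal.toBaseChange_bijective _ 𝒱.isInternal g))
  act :=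
    { toFun := fun g => (𝒱.act g).baseChange R
      map_one' := by ext; simp
      map_mul' := fun g h => by ext; simp }
  act_mem := fun g h v hv => by
    change v ∈ (𝒱.comp h).baseChange R at hv
    change (𝒱.act g).baseChange R v ∈ (𝒱.comp _).baseChange R
    have hle : (𝒱.comp h).baseChange R ≤
        ((𝒱.comp (g * h * g⁻¹)).baseChange R).comap ((𝒱.act g).baseChange R) := by
      rw [Submodule.baseChange_eq_span, Submodule.span_le]
      rintro _ ⟨x, hx, rfl⟩
      have := Submodule.tmul_mem_baseChange_of_mem (1 : R) (𝒱.act_mem g h x hx)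
      simpa using this
    exact hle hv

/-- `(V*)_g = (V_{g⁻¹})*`: the functionals vanishing on `V_h` for all `h ≠ g⁻¹`. -/
def GradedMod.dualComp {k V : Type*} [Field k] [AddCommGroup V] [Module k V]
    (𝒱 : GradedMod k G V) (g : G) : Submodule k (Module.Dual k V) where
  carrier := {f | ∀ h, h ≠ g⁻¹ → ∀ v ∈ 𝒱.comp h, f v = 0}
  add_mem' := fun {a b} ha hb h hh v hv => by simp [ha h hh v hv, hb h hh v hv]
  zero_mem' := fun h hh v hv => by simp
  smul_mem' := fun c a ha h hh v hv => by simp [ha h hh v hv]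

/-- The dual Yetter-Drinfeld module over a field, with the contragredient action and the
grading `(V*)_g = (V_{g⁻¹})*`. -/
def YDMod.dual {k V : Type*} [Field k] [AddCommGroup V] [Module k V] [Fintype G]
    (𝒱 : YDMod k G V) : YDMod k G (Module.Dual k V) where
  comp g := 𝒱.dualComp g
  isInternal := by
    refine isInternal_of_separating _ (fun g => (𝒱.proj g⁻¹).dualMap) ?_ ?_ ?_
    · intro g f hf
      refine 𝒱.ext_hom fun h v hv => ?_
      by_cases hh : h = g⁻¹
      · subst hh
        simp [𝒱.proj_of_mem hv]
      · simp [𝒱.proj_of_mem_ne hh hv, hf h hh v hv]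
    · intro g h hgh f hf
      ext v
      simpa using hf h⁻¹ (by simpa using hgh.symm) _ (𝒱.proj_mem _ v)
    · rw [eq_top_iff]
      intro f _
      have : f = ∑ g : G, (𝒱.proj g).dualMap f := by
        ext v
        conv_lhs => rw [← 𝒱.sum_proj v]
        simp
      rw [this]
      refine Submodule.sum_mem _ fun g _ => Submodule.mem_iSup_of_mem g⁻¹ ?_
      intro h hh v hv
      rw [inv_inv] at hh
      simp [𝒱.proj_of_mem_ne hh hv]
  free := fun g => Module.Free.of_divisionRing k (𝒱.dualComp g)
  act := 𝒱.act.dual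
  act_mem := fun g h f hf k hk v hv => by
    rw [Representation.dual_apply]
    refine hf (g⁻¹ * k * g) (fun hh => hk ?_) _ ?_
    · rw [← inv_inj] at hh
      rw [← inv_inj]
      simp only [mul_inv_rev, inv_inv] at hh ⊢
      rw [← hh]; group
    · simpa using 𝒱.act_mem g⁻¹ k v hv

end YDMod

/-! ### Group-graded algebras and their cocycle twists -/

/-- A `G`-graded `R`-algebra. -/
structure GradedAlg (R G A : Type*) [CommRing R] [Group G] [DecidableEq G] [Ring A]
    [Algebra R A] extends GradedMod R G A where
  one_mem : (1 : A) ∈ comp 1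
  mul_mem : ∀ g h a b, a ∈ comp g → b ∈ comp h → a * b ∈ comp (g * h)

/-- An algebra in the category of Yetter-Drinfeld modules: the unit and the multiplication are
morphisms, i.e. they preserve the grading and commute with the action of `G`. -/
structure IsYDAlgebra {R G A : Type*} [CommRing R] [Group G] [DecidableEq G] [Ring A]
    [Algebra R A] (𝒜 : YDMod R G A) : Prop where
  one_mem : (1 : A) ∈ 𝒜.comp 1
  mul_mem : ∀ g h a b, a ∈ 𝒜.comp g → b ∈ 𝒜.comp h → a * b ∈ 𝒜.comp (g * h)
  act_one : ∀ g, 𝒜.act g 1 = 1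
  act_mul : ∀ g a b, 𝒜.act g (a * b) = 𝒜.act g a * 𝒜.act g b

/-- Extension of scalars of a graded algebra. -/
def GradedAlg.baseChange {k G A : Type*} [CommRing k] [Group G] [DecidableEq G] [Ring A]
    [Algebra k A] (𝒜 : GradedAlg k G A) (R : Type*) [CommRing R] [Algebra k R] :
    GradedAlg R G (R ⊗[k] A) where
  toGradedMod := 𝒜.toGradedMod.baseChange R
  one_mem := Submodule.tmul_mem_baseChange_of_mem (1 : R) 𝒜.one_mem
  mul_mem := fun g h a b ha hb => by
    change a ∈ (𝒜.comp g).baseChange R at ha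
    change b ∈ (𝒜.comp h).baseChange R at hb
    change a * b ∈ (𝒜.comp (g * h)).baseChange R
    rw [Submodule.baseChange_eq_span] at ha hb
    induction ha, hb using Submodule.span_induction₂ with
    | mem_mem x y hx hy =>
      obtain ⟨x, hx, rfl⟩ := hx
      obtain ⟨y, hy, rfl⟩ := hy
      have := Submodule.tmul_mem_baseChange_of_mem (1 : R) (𝒜.mul_mem g h x y hx hy)
      simpa using this
    | zero_left y hy => simp
    | zero_right x hx => simp
    | add_left x y z _ _ _ h1 h2 => rw [add_mul]; exact Submodule.add_mem _ h1 h2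
    | add_right x y z _ _ _ h1 h2 => rw [mul_add]; exact Submodule.add_mem _ h1 h2
    | smul_left r x y _ _ h1 => rw [smul_mul_assoc]; exact Submodule.smul_mem _ _ h1
    | smul_right r x y _ _ h1 => rw [mul_smul_comm]; exact Submodule.smul_mem _ _ h1

section Twist

variable {R G A : Type*} [CommRing R] [Group G] [DecidableEq G] [Fintype G] [Ring A]
  [Algebra R A]

/-- The product `a ⋆ b = μ(g, h) a b` for `a ∈ A_g`, `b ∈ A_h`, extended bilinearly. -/
def GradedAlg.starMul (𝒜 : GradedAlg R G A) (μ : Cocycle G Rˣ) : A →ₗ[R] A →ₗ[R] A :=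
  ∑ g, ∑ h, (μ g h : R) • (LinearMap.mul R A).compl₁₂ (𝒜.proj g) (𝒜.proj h)

theorem GradedAlg.starMul_of_mem (𝒜 : GradedAlg R G A) (μ : Cocycle G Rˣ) {g h : G} {a b : A}
    (ha : a ∈ 𝒜.comp g) (hb : b ∈ 𝒜.comp h) : 𝒜.starMul μ a b = (μ g h : R) • (a * b) := by
  simp only [GradedAlg.starMul, LinearMap.sum_apply]
  rw [Finset.sum_eq_single g, Finset.sum_eq_single h]
  · simp [𝒜.proj_of_mem ha, 𝒜.proj_of_mem hb]
  · intro k _ hne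
    simp [𝒜.proj_of_mem_ne hne.symm hb]
  · simp
  · intro k _ hne
    simp [𝒜.proj_of_mem_ne hne.symm ha]
  · simp

theorem GradedAlg.starMul_mem (𝒜 : GradedAlg R G A) (μ : Cocycle G Rˣ) {g h : G} {a b : A}
    (ha : a ∈ 𝒜.comp g) (hb : b ∈ 𝒜.comp h) : 𝒜.starMul μ a b ∈ 𝒜.comp (g * h) := by
  rw [𝒜.starMul_of_mem μ ha hb]
  exact Submodule.smul_mem _ _ (𝒜.mul_mem g h a b ha hb)

theorem GradedAlg.starMul_assoc (𝒜 : GradedAlg R G A) (μ : Cocycle G Rˣ) (a b c : A) :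
    𝒜.starMul μ (𝒜.starMul μ a b) c = 𝒜.starMul μ a (𝒜.starMul μ b c) := by
  induction a using 𝒜.induction with
  | zero => simp
  | add x y hx hy => simp [hx, hy]
  | hom g a ha =>
    induction b using 𝒜.induction with
    | zero => simp
    | add x y hx hy => simp [hx, hy]
    | hom h b hb =>
      induction c using 𝒜.induction with
      | zero => simp
      | add x y hx hy => simp [hx, hy]
      | hom k c hc =>
        rw [𝒜.starMul_of_mem μ (𝒜.starMul_mem μ ha hb) hc, 𝒜.starMul_of_mem μ ha hb,
          𝒜.starMul_of_mem μ ha (𝒜.starMul_mem μ hb hc), 𝒜.starMul_of_mem μ hb hc,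
          smul_mul_assoc, mul_smul_comm, smul_smul, smul_smul, mul_assoc a b c]
        congr 1
        rw [mul_comm, ← Units.val_mul, ← Units.val_mul, μ.cocycle]

theorem GradedAlg.one_starMul (𝒜 : GradedAlg R G A) (μ : Cocycle G Rˣ) (a : A) :
    𝒜.starMul μ 1 a = a := by
  induction a using 𝒜.induction with
  | zero => simp
  | add x y hx hy => simp [hx, hy]
  | hom g a ha => simp [𝒜.starMul_of_mem μ 𝒜.one_mem ha, μ.one_left]

theorem GradedAlg.starMul_one (𝒜 : GradedAlg R G A) (μ : Cocycle G Rˣ) (a : A) :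
    𝒜.starMul μ a 1 = a := by
  induction a using 𝒜.induction with
  | zero => simp
  | add x y hx hy => simp [hx, hy]
  | hom g a ha => simp [𝒜.starMul_of_mem μ ha 𝒜.one_mem, μ.one_right]

/-- The cocycle twist `A_μ = (A, ⋆)` of a graded algebra: the same module and the product `⋆`. -/
def CocycleTwist (_𝒜 : GradedAlg R G A) (_μ : Cocycle G Rˣ) : Type _ := A

instance (𝒜 : GradedAlg R G A) (μ : Cocycle G Rˣ) : AddCommGroup (CocycleTwist 𝒜 μ) :=
  inferInstanceAs (AddCommGroup A)

instance (𝒜 : GradedAlg R G A) (μ : Cocycle G Rˣ) : Module R (CocycleTwist 𝒜 μ) :=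
  inferInstanceAs (Module R A)

/-- The identity map `A → A_μ`. -/
def CocycleTwist.of (𝒜 : GradedAlg R G A) (μ : Cocycle G Rˣ) : A ≃ₗ[R] CocycleTwist 𝒜 μ :=
  LinearEquiv.refl R A

instance (𝒜 : GradedAlg R G A) (μ : Cocycle G Rˣ) : Ring (CocycleTwist 𝒜 μ) :=
  { (inferInstance : AddCommGroup (CocycleTwist 𝒜 μ)) with
    mul := fun a b => 𝒜.starMul μ a b
    one := (1 : A)
    mul_assoc := 𝒜.starMul_assoc μ
    one_mul := 𝒜.one_starMul μ
    mul_one := 𝒜.starMul_one μ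
    zero_mul := fun a => (𝒜.starMul μ).map_zero₂ a
    mul_zero := fun a => (𝒜.starMul μ a).map_zero
    left_distrib := fun a b c => (𝒜.starMul μ a).map_add b c
    right_distrib := fun a b c => (𝒜.starMul μ).map_add₂ a b c }

instance (𝒜 : GradedAlg R G A) (μ : Cocycle G Rˣ) : Algebra R (CocycleTwist 𝒜 μ) :=
  Algebra.ofModule (fun r a b => (𝒜.starMul μ).map_smul₂ r a b)
    (fun r a b => (𝒜.starMul μ a).map_smul r b)

end Twist

/-- The group algebra `RG` graded by `(RG)_g = R g`. -/
def groupAlgGrading (R G : Type*) [CommRing R] [Group G] [DecidableEq G] :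
    GradedAlg R G (MonoidAlgebra R G) where
  comp g := LinearMap.range (MonoidAlgebra.lsingle (R := R) (S := R) g)
  isInternal := by
    refine isInternal_of_separating _ (fun g => MonoidAlgebra.lsingle (R := R) (S := R) g ∘ₗ
      Finsupp.lapply g ∘ₗ (MonoidAlgebra.coeffLinearEquiv R).toLinearMap) ?_ ?_ ?_
    · rintro g _ ⟨r, rfl⟩
      simp [MonoidAlgebra.coeffLinearEquiv]
    · rintro g h hgh _ ⟨r, rfl⟩
      simp [MonoidAlgebra.coeffLinearEquiv, hgh]
    · rw [eq_top_iff]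
      intro x _
      induction x using MonoidAlgebra.induction_linear with
      | zero => exact Submodule.zero_mem _
      | add x y hx hy => exact Submodule.add_mem _ (hx trivial) (hy trivial)
      | single g r => exact Submodule.mem_iSup_of_mem g ⟨r, rfl⟩
  one_mem := ⟨1, rfl⟩
  mul_mem := by
    rintro g h _ _ ⟨r, rfl⟩ ⟨s, rfl⟩
    exact ⟨r * s, by simp⟩

/-- The twisted group algebra `RG_μ`, with `g ⋆ h = μ(g, h) gh`. -/
abbrev TwistedGroupAlgebra (R G : Type*) [CommRing R] [Group G] [DecidableEq G] [Fintype G]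
    (μ : Cocycle G Rˣ) : Type _ :=
  CocycleTwist (groupAlgGrading R G) μ

/-- The basis element `g` of `RG_μ`. -/
def TwistedGroupAlgebra.of (R : Type*) {G : Type*} [CommRing R] [Group G] [DecidableEq G]
    [Fintype G] (μ : Cocycle G Rˣ) (g : G) : TwistedGroupAlgebra R G μ :=
  CocycleTwist.of (groupAlgGrading R G) μ (MonoidAlgebra.single g 1)

/-! ### Nichols algebras -/

section Nichols

variable {R V : Type*} [CommRing R] [AddCommGroup V] [Module R V]

/-- The canonical isomorphism `V^{⊗n} ⊗ V ≅ V^{⊗(n+1)}`. -/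
def tensorSnoc (R V : Type*) [CommRing R] [AddCommGroup V] [Module R V] (n : ℕ) :
    (⨂[R]^n V) ⊗[R] V ≃ₗ[R] ⨂[R]^(n + 1) V :=
  TensorProduct.congr (LinearEquiv.refl R _)
      (PiTensorProduct.subsingletonEquiv (R := R) (s := fun _ : Fin 1 => V) 0).symm ≪≫ₗ
    TensorPower.mulEquiv

/-- `T ⊗ id_V` as an endomorphism of `V^{⊗(n+1)}`, for an endomorphism `T` of `V^{⊗n}`. -/
def tensorId {n : ℕ} (T : (⨂[R]^n V) →ₗ[R] ⨂[R]^n V) :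
    (⨂[R]^(n + 1) V) →ₗ[R] ⨂[R]^(n + 1) V :=
  (tensorSnoc R V n).conj (T.rTensor V)

/-- `Ψ_{n+1,n+2} = id^{⊗n} ⊗ Ψ` as an endomorphism of `V^{⊗(n+2)}`. -/
def lastBraid (Ψ : V ⊗[R] V →ₗ[R] V ⊗[R] V) (n : ℕ) :
    (⨂[R]^(n + 2) V) →ₗ[R] ⨂[R]^(n + 2) V :=
  ((TensorProduct.assoc R (⨂[R]^n V) V V).symm ≪≫ₗ
    (tensorSnoc R V n).rTensor V ≪≫ₗ tensorSnoc R V (n + 1)).conj (Ψ.lTensor (⨂[R]^n V))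

/-- The braided integer
`[n]_Ψ = id + Ψ_{n-1,n} + Ψ_{n-1,n} Ψ_{n-2,n-1} + ⋯ + Ψ_{n-1,n} ⋯ Ψ_{1,2}`, in the form
`[1]_Ψ = id`, `[n]_Ψ = id + Ψ_{n-1,n} ([n-1]_Ψ ⊗ id)`. -/
def braidedInt (Ψ : V ⊗[R] V →ₗ[R] V ⊗[R] V) : (n : ℕ) → (⨂[R]^n V) →ₗ[R] ⨂[R]^n V
  | 0 => 0
  | 1 => LinearMap.id
  | n + 2 => LinearMap.id + lastBraid Ψ n ∘ₗ tensorId (braidedInt Ψ (n + 1))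

/-- The braided factorial (Woronowicz symmetriser)
`[n]!_Ψ = ([1]_Ψ ⊗ id^{⊗(n-1)}) ([2]_Ψ ⊗ id^{⊗(n-2)}) ⋯ [n]_Ψ`. -/
def braidedFactorial (Ψ : V ⊗[R] V →ₗ[R] V ⊗[R] V) : (n : ℕ) → (⨂[R]^n V) →ₗ[R] ⨂[R]^n V
  | 0 => LinearMap.id
  | n + 1 => tensorId (braidedFactorial Ψ n) ∘ₗ braidedInt Ψ (n + 1)

/-- The elements of `⨁ n, ker [n]!_Ψ` are the relations of the Nichols algebra. -/
inductive NicholsRel (Ψ : V ⊗[R] V →ₗ[R] V ⊗[R] V) : TensorAlgebra R V → TensorAlgebra R V → Prop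
  | of_ker (n : ℕ) (x : ⨂[R]^n V) (hx : braidedFactorial Ψ n x = 0) :
      NicholsRel Ψ (TensorPower.toTensorAlgebra x) 0

/-- The algebra `𝓑(V, Ψ) = T(V) / ⨁ n, ker [n]!_Ψ`. -/
def Nichols (Ψ : V ⊗[R] V →ₗ[R] V ⊗[R] V) : Type _ := RingQuot (NicholsRel Ψ)

instance (Ψ : V ⊗[R] V →ₗ[R] V ⊗[R] V) : Ring (Nichols Ψ) :=
  inferInstanceAs (Ring (RingQuot (NicholsRel Ψ)))

instance (Ψ : V ⊗[R] V →ₗ[R] V ⊗[R] V) : Algebra R (Nichols Ψ) :=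
  inferInstanceAs (Algebra R (RingQuot (NicholsRel Ψ)))

/-- The canonical map `V → 𝓑(V, Ψ)`. -/
def Nichols.ι (Ψ : V ⊗[R] V →ₗ[R] V ⊗[R] V) : V →ₗ[R] Nichols Ψ :=
  (RingQuot.mkAlgHom R (NicholsRel Ψ)).toLinearMap ∘ₗ TensorAlgebra.ι R

/-- The braiding `τ Ψ τ`, where `τ` is the transposition. -/
def flipBraiding (Ψ : V ⊗[R] V →ₗ[R] V ⊗[R] V) : V ⊗[R] V →ₗ[R] V ⊗[R] V :=
  (TensorProduct.comm R V V).toLinearMap ∘ₗ Ψ ∘ₗ (TensorProduct.comm R V V).toLinearMap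

end Nichols

/-! ### Braided doubles over a group -/

section Double

variable {G Vm Vp : Type*} [Group G] [AddCommGroup Vm] [Module ℂ Vm] [AddCommGroup Vp]
  [Module ℂ Vp]

/-- The free algebra on `V⁻ ⊕ V⁺ ⊕ ℂG`. -/
abbrev DoubleGen (G Vm Vp : Type*) [Group G] [AddCommGroup Vm] [Module ℂ Vm] [AddCommGroup Vp]
    [Module ℂ Vp] : Type _ :=
  TensorAlgebra ℂ (Vm × Vp × MonoidAlgebra ℂ G)

/-- The generators `v ∈ V⁻`. -/
def genNeg : Vm →ₗ[ℂ] DoubleGen G Vm Vp := TensorAlgebra.ι ℂ ∘ₗ LinearMap.inl ℂ _ _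

/-- The generators `f ∈ V⁺`. -/
def genPos : Vp →ₗ[ℂ] DoubleGen G Vm Vp :=
  TensorAlgebra.ι ℂ ∘ₗ LinearMap.inr ℂ _ _ ∘ₗ LinearMap.inl ℂ _ _

/-- The generators `x ∈ ℂG`. -/
def genGrp : MonoidAlgebra ℂ G →ₗ[ℂ] DoubleGen G Vm Vp :=
  TensorAlgebra.ι ℂ ∘ₗ LinearMap.inr ℂ _ _ ∘ₗ LinearMap.inr ℂ _ _

/-- The relations of `A_β(I⁻, I⁺)`: the first four families present the semidirect product
`T(V⁻ ⊕ V⁺) ⋊ G` as a quotient of the free algebra on `V⁻ ⊕ V⁺ ⊕ ℂG`; the others are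
`f v - v f = β(f ⊗ v)`, `I⁻ = 0` and `I⁺ = 0`. -/
inductive DoubleRel (ρm : Representation ℂ G Vm) (ρp : Representation ℂ G Vp)
    (β : Vp →ₗ[ℂ] Vm →ₗ[ℂ] MonoidAlgebra ℂ G)
    (Im : Set (TensorAlgebra ℂ Vm)) (Ip : Set (TensorAlgebra ℂ Vp)) :
    DoubleGen G Vm Vp → DoubleGen G Vm Vp → Prop
  | grp_one : DoubleRel ρm ρp β Im Ip (genGrp 1) 1
  | grp_mul (x y : MonoidAlgebra ℂ G) :
      DoubleRel ρm ρp β Im Ip (genGrp x * genGrp y) (genGrp (x * y))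
  | grp_neg (g : G) (v : Vm) :
      DoubleRel ρm ρp β Im Ip (genGrp (MonoidAlgebra.single g 1) * genNeg v)
        (genNeg (ρm g v) * genGrp (MonoidAlgebra.single g 1))
  | grp_pos (g : G) (f : Vp) :
      DoubleRel ρm ρp β Im Ip (genGrp (MonoidAlgebra.single g 1) * genPos f)
        (genPos (ρp g f) * genGrp (MonoidAlgebra.single g 1))
  | pos_neg (f : Vp) (v : Vm) :
      DoubleRel ρm ρp β Im Ip (genPos f * genNeg v) (genNeg v * genPos f + genGrp (β f v))
  | neg (x : TensorAlgebra ℂ Vm) (hx : x ∈ Im) :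
      DoubleRel ρm ρp β Im Ip (TensorAlgebra.lift ℂ genNeg x) 0
  | pos (x : TensorAlgebra ℂ Vp) (hx : x ∈ Ip) :
      DoubleRel ρm ρp β Im Ip (TensorAlgebra.lift ℂ genPos x) 0

variable (ρm : Representation ℂ G Vm) (ρp : Representation ℂ G Vp)
  (β : Vp →ₗ[ℂ] Vm →ₗ[ℂ] MonoidAlgebra ℂ G)
  (Im : Set (TensorAlgebra ℂ Vm)) (Ip : Set (TensorAlgebra ℂ Vp))

/-- The algebra `A_β(I⁻, I⁺)`. -/
def Double : Type _ := RingQuot (DoubleRel ρm ρp β Im Ip)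

instance : Ring (Double ρm ρp β Im Ip) :=
  inferInstanceAs (Ring (RingQuot (DoubleRel ρm ρp β Im Ip)))

instance : Algebra ℂ (Double ρm ρp β Im Ip) :=
  inferInstanceAs (Algebra ℂ (RingQuot (DoubleRel ρm ρp β Im Ip)))

/-- The quotient map onto `A_β(I⁻, I⁺)`. -/
def Double.mk : DoubleGen G Vm Vp →ₐ[ℂ] Double ρm ρp β Im Ip :=
  RingQuot.mkAlgHom ℂ (DoubleRel ρm ρp β Im Ip)

/-- The element `v` of `A_β(I⁻, I⁺)`, for `v ∈ V⁻`. -/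
def Double.neg : Vm →ₗ[ℂ] Double ρm ρp β Im Ip :=
  (Double.mk ρm ρp β Im Ip).toLinearMap ∘ₗ genNeg

/-- The element `f` of `A_β(I⁻, I⁺)`, for `f ∈ V⁺`. -/
def Double.pos : Vp →ₗ[ℂ] Double ρm ρp β Im Ip :=
  (Double.mk ρm ρp β Im Ip).toLinearMap ∘ₗ genPos

/-- The map `ℂG → A_β(I⁻, I⁺)`. -/
def Double.grpAlg : MonoidAlgebra ℂ G →ₗ[ℂ] Double ρm ρp β Im Ip :=
  (Double.mk ρm ρp β Im Ip).toLinearMap ∘ₗ genGrp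

theorem Double.mk_rel {x y : DoubleGen G Vm Vp} (h : DoubleRel ρm ρp β Im Ip x y) :
    Double.mk ρm ρp β Im Ip x = Double.mk ρm ρp β Im Ip y :=
  RingQuot.mkAlgHom_rel ℂ h

/-- The element `g` of `A_β(I⁻, I⁺)`, for `g ∈ G`. -/
def Double.grp : G →* Double ρm ρp β Im Ip where
  toFun g := Double.grpAlg ρm ρp β Im Ip (MonoidAlgebra.single g 1)
  map_one' := by
    have := Double.mk_rel ρm ρp β Im Ip DoubleRel.grp_one
    rwa [map_one (Double.mk ρm ρp β Im Ip)] at this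
  map_mul' g h := by
    have := Double.mk_rel ρm ρp β Im Ip
      (DoubleRel.grp_mul (MonoidAlgebra.single g 1) (MonoidAlgebra.single h 1))
    rw [map_mul, MonoidAlgebra.single_mul_single, mul_one] at this
    exact this.symm

/-- The map `T(V⁻) → A_β(I⁻, I⁺)`. -/
def Double.negAlg : TensorAlgebra ℂ Vm →ₐ[ℂ] Double ρm ρp β Im Ip :=
  TensorAlgebra.lift ℂ (Double.neg ρm ρp β Im Ip)

/-- The map `T(V⁺) → A_β(I⁻, I⁺)`. -/
def Double.posAlg : TensorAlgebra ℂ Vp →ₐ[ℂ] Double ρm ρp β Im Ip :=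
  TensorAlgebra.lift ℂ (Double.pos ρm ρp β Im Ip)

/-- The graded `G`-invariant ideals `I⁻ ⊂ T^{>0}(V⁻)` such that `[V⁺, I⁻] ⊂ I⁻ ⊗ ℂG` in
`A_β(0, 0)`. -/
structure IsNegIdeal (I : TwoSidedIdeal (TensorAlgebra ℂ Vm)) : Prop where
  graded : ∀ x ∈ I, ∀ n : ℕ, (DirectSum.decompose
    (fun n : ℕ => LinearMap.range (TensorAlgebra.ι ℂ : Vm →ₗ[ℂ] TensorAlgebra ℂ Vm) ^ n) x n :
      TensorAlgebra ℂ Vm) ∈ I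
  positive : ∀ x ∈ I, TensorAlgebra.algebraMapInv x = 0
  invariant : ∀ g, ∀ x ∈ I, TensorAlgebra.lift ℂ (TensorAlgebra.ι ℂ ∘ₗ ρm g) x ∈ I
  commutator : ∀ f : Vp, ∀ x ∈ I,
    Double.pos ρm ρp β ∅ ∅ f * Double.negAlg ρm ρp β ∅ ∅ x -
      Double.negAlg ρm ρp β ∅ ∅ x * Double.pos ρm ρp β ∅ ∅ f ∈
    Submodule.span ℂ {z | ∃ y ∈ I, ∃ g : G,
      z = Double.negAlg ρm ρp β ∅ ∅ y * Double.grp ρm ρp β ∅ ∅ g}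

/-- The graded `G`-invariant ideals `I⁺ ⊂ T^{>0}(V⁺)` such that `[I⁺, V⁻] ⊂ ℂG ⊗ I⁺` in
`A_β(0, 0)`. -/
structure IsPosIdeal (I : TwoSidedIdeal (TensorAlgebra ℂ Vp)) : Prop where
  graded : ∀ x ∈ I, ∀ n : ℕ, (DirectSum.decompose
    (fun n : ℕ => LinearMap.range (TensorAlgebra.ι ℂ : Vp →ₗ[ℂ] TensorAlgebra ℂ Vp) ^ n) x n :
      TensorAlgebra ℂ Vp) ∈ I
  positive : ∀ x ∈ I, TensorAlgebra.algebraMapInv x = 0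
  invariant : ∀ g, ∀ x ∈ I, TensorAlgebra.lift ℂ (TensorAlgebra.ι ℂ ∘ₗ ρp g) x ∈ I
  commutator : ∀ v : Vm, ∀ x ∈ I,
    Double.posAlg ρm ρp β ∅ ∅ x * Double.neg ρm ρp β ∅ ∅ v -
      Double.neg ρm ρp β ∅ ∅ v * Double.posAlg ρm ρp β ∅ ∅ x ∈
    Submodule.span ℂ {z | ∃ y ∈ I, ∃ g : G,
      z = Double.grp ρm ρp β ∅ ∅ g * Double.posAlg ρm ρp β ∅ ∅ y}

/-- The largest ideal `I⁻_β`: the sum of all `I⁻` as above. -/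
def maxNegIdeal : TwoSidedIdeal (TensorAlgebra ℂ Vm) := sSup {I | IsNegIdeal ρm ρp β I}

/-- The largest ideal `I⁺_β`: the sum of all `I⁺` as above. -/
def maxPosIdeal : TwoSidedIdeal (TensorAlgebra ℂ Vp) := sSup {I | IsPosIdeal ρm ρp β I}

/-- The minimal braided double `A_β(I⁻_β, I⁺_β)`. -/
abbrev MinimalDouble : Type _ :=
  Double ρm ρp β (maxNegIdeal ρm ρp β) (maxPosIdeal ρm ρp β)

end Double

/-! ### Braided Heisenberg doubles -/

section Heisenberg

variable {G Y : Type*} [Group G] [DecidableEq G] [Fintype G] [AddCommGroup Y] [Module ℂ Y]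
  (𝒴 : YDMod ℂ G Y)

/-- `β(f ⊗ v) = ⟨f, v⁽⁰⁾⟩ v⁽¹⁾`, where `δ(v) = v⁽⁰⁾ ⊗ v⁽¹⁾` is the coaction, that is
`δ(v) = v ⊗ g` for `v ∈ Y_g`. -/
def heisBeta : Module.Dual ℂ Y →ₗ[ℂ] Y →ₗ[ℂ] MonoidAlgebra ℂ G :=
  ∑ g, (LinearMap.llcomp ℂ Y ℂ (MonoidAlgebra ℂ G) (MonoidAlgebra.lsingle g)) ∘ₗ
    (𝒴.proj g).dualMap

theorem heisBeta_apply (f : Module.Dual ℂ Y) (v : Y) :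
    heisBeta 𝒴 f v = ∑ g, MonoidAlgebra.single g (f (𝒴.proj g v)) := by
  simp [heisBeta]

/-- The algebras `A_β(I⁻, I⁺)` for `V⁻ = Y`, `V⁺ = Y*` and `β(f ⊗ v) = ⟨f, v⁽⁰⁾⟩ v⁽¹⁾`. -/
abbrev YDDouble (Im : Set (TensorAlgebra ℂ Y)) (Ip : Set (TensorAlgebra ℂ (Module.Dual ℂ Y))) :
    Type _ :=
  Double 𝒴.act 𝒴.dual.act (heisBeta 𝒴) Im Ip

/-- The braided Heisenberg double `𝓗_Y`. -/
abbrev Heis : Type _ := MinimalDouble 𝒴.act 𝒴.dual.act (heisBeta 𝒴)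

/-- The coaction `T(Y) → T(Y) ⊗ ℂG` extending the coaction of `Y` multiplicatively. -/
def tensorCoact : TensorAlgebra ℂ Y →ₐ[ℂ] MonoidAlgebra (TensorAlgebra ℂ Y) G :=
  TensorAlgebra.lift ℂ (∑ g, MonoidAlgebra.lsingle (R := ℂ) g ∘ₗ TensorAlgebra.ι ℂ ∘ₗ 𝒴.proj g)

theorem tensorCoact_ι (v : Y) :
    tensorCoact 𝒴 (TensorAlgebra.ι ℂ v) =
      ∑ g, MonoidAlgebra.single g (TensorAlgebra.ι ℂ (𝒴.proj g v)) := by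
  simp [tensorCoact]

theorem tensorCoact_ι_of_mem {h : G} {v : Y} (hv : v ∈ 𝒴.comp h) :
    tensorCoact 𝒴 (TensorAlgebra.ι ℂ v) = MonoidAlgebra.single h (TensorAlgebra.ι ℂ v) := by
  rw [tensorCoact_ι, Finset.sum_eq_single h]
  · rw [𝒴.proj_of_mem hv]
  · intro k _ hne
    rw [𝒴.proj_of_mem_ne hne.symm hv]; simp
  · simp

section Coaction

variable (Im : Set (TensorAlgebra ℂ Y)) (Ip : Set (TensorAlgebra ℂ (Module.Dual ℂ Y)))

local notation "𝐧" => Double.neg 𝒴.act 𝒴.dual.act (heisBeta 𝒴) Im Ip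
local notation "𝐩" => Double.pos 𝒴.act 𝒴.dual.act (heisBeta 𝒴) Im Ip
local notation "𝐠" => Double.grp 𝒴.act 𝒴.dual.act (heisBeta 𝒴) Im Ip
local notation "𝐧A" => Double.negAlg 𝒴.act 𝒴.dual.act (heisBeta 𝒴) Im Ip
local notation "𝐩A" => Double.posAlg 𝒴.act 𝒴.dual.act (heisBeta 𝒴) Im Ip

/-- The values of the coaction of `A_β(I⁻, I⁺)` on the generators:
`v ↦ v⁽⁰⁾ ⊗ v⁽¹⁾` for `v ∈ Y`, `f ↦ f ⊗ 1` for `f ∈ Y*`, and `g ↦ g ⊗ g` for `g ∈ G`. -/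
def preCoactGen : (Y × Module.Dual ℂ Y × MonoidAlgebra ℂ G) →ₗ[ℂ]
    MonoidAlgebra (YDDouble 𝒴 Im Ip) G :=
  LinearMap.coprod (∑ g, MonoidAlgebra.lsingle (R := ℂ) g ∘ₗ 𝐧 ∘ₗ 𝒴.proj g)
    (LinearMap.coprod (MonoidAlgebra.lsingle (R := ℂ) 1 ∘ₗ 𝐩)
      (Finsupp.lsum ℂ (fun g => LinearMap.toSpanSingleton ℂ _ (MonoidAlgebra.single g (𝐠 g))) ∘ₗ
        (MonoidAlgebra.coeffLinearEquiv ℂ).toLinearMap))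

/-- The multiplicative extension of the preceding map to the free algebra. -/
def preCoact : DoubleGen G Y (Module.Dual ℂ Y) →ₐ[ℂ] MonoidAlgebra (YDDouble 𝒴 Im Ip) G :=
  TensorAlgebra.lift ℂ (preCoactGen 𝒴 Im Ip)

theorem preCoact_neg (v : Y) :
    preCoact 𝒴 Im Ip (genNeg v) = ∑ g, MonoidAlgebra.single g (𝐧 (𝒴.proj g v)) := by
  simp [preCoact, preCoactGen, genNeg]

theorem preCoact_pos (f : Module.Dual ℂ Y) :
    preCoact 𝒴 Im Ip (genPos f) = MonoidAlgebra.single 1 (𝐩 f) := by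
  simp [preCoact, preCoactGen, genPos]

theorem preCoact_grp (g : G) (r : ℂ) :
    preCoact 𝒴 Im Ip (genGrp (MonoidAlgebra.single g r)) =
      MonoidAlgebra.single g (r • 𝐠 g) := by
  simp [preCoact, preCoactGen, genGrp, MonoidAlgebra.coeffLinearEquiv]

theorem preCoact_negAlg (x : TensorAlgebra ℂ Y) :
    preCoact 𝒴 Im Ip (TensorAlgebra.lift ℂ genNeg x) =
      MonoidAlgebra.mapAlgHom G 𝐧A (tensorCoact 𝒴 x) := by
  have : (preCoact 𝒴 Im Ip).comp (TensorAlgebra.lift ℂ genNeg) =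
      (MonoidAlgebra.mapAlgHom G 𝐧A).comp (tensorCoact 𝒴) := by
    ext v
    simp [preCoact_neg, tensorCoact_ι, Double.negAlg]
  exact congrArg (fun a => a x) this

theorem preCoact_posAlg (x : TensorAlgebra ℂ (Module.Dual ℂ Y)) :
    preCoact 𝒴 Im Ip (TensorAlgebra.lift ℂ genPos x) = MonoidAlgebra.single 1 (𝐩A x) := by
  have : (preCoact 𝒴 Im Ip).comp (TensorAlgebra.lift ℂ genPos) =
      MonoidAlgebra.singleOneAlgHom.comp 𝐩A := by
    ext v
    simp [preCoact_pos, Double.posAlg]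
  exact congrArg (fun a => a x) this

theorem Double.mk_genNeg (v : Y) :
    Double.mk 𝒴.act 𝒴.dual.act (heisBeta 𝒴) Im Ip (genNeg v) = 𝐧 v := rfl

theorem Double.grp_neg (g : G) (v : Y) : 𝐠 g * 𝐧 v = 𝐧 (𝒴.act g v) * 𝐠 g := by
  have := Double.mk_rel 𝒴.act 𝒴.dual.act (heisBeta 𝒴) Im Ip (DoubleRel.grp_neg g v)
  rwa [map_mul, map_mul] at this

theorem Double.grp_pos (g : G) (f : Module.Dual ℂ Y) :
    𝐠 g * 𝐩 f = 𝐩 (𝒴.dual.act g f) * 𝐠 g := by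
  have := Double.mk_rel 𝒴.act 𝒴.dual.act (heisBeta 𝒴) Im Ip (DoubleRel.grp_pos g f)
  rwa [map_mul, map_mul] at this

theorem Double.grpAlg_single (g : G) (r : ℂ) :
    Double.grpAlg 𝒴.act 𝒴.dual.act (heisBeta 𝒴) Im Ip (MonoidAlgebra.single g r) = r • 𝐠 g := by
  have : MonoidAlgebra.single g r = r • MonoidAlgebra.single g (1 : ℂ) := by simp
  rw [this, map_smul]; rfl

theorem Double.pos_neg (f : Module.Dual ℂ Y) (v : Y) :
    𝐩 f * 𝐧 v = 𝐧 v * 𝐩 f + ∑ g, f (𝒴.proj g v) • 𝐠 g := by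
  have := Double.mk_rel 𝒴.act 𝒴.dual.act (heisBeta 𝒴) Im Ip (DoubleRel.pos_neg f v)
  rw [map_mul, map_add, map_mul] at this
  refine this.trans (congrArg _ ?_)
  change Double.grpAlg 𝒴.act 𝒴.dual.act (heisBeta 𝒴) Im Ip _ = _
  rw [heisBeta_apply, map_sum]
  exact Finset.sum_congr rfl fun g _ => Double.grpAlg_single 𝒴 Im Ip g _

theorem Double.mk_lift_neg (x : TensorAlgebra ℂ Y) :
    Double.mk 𝒴.act 𝒴.dual.act (heisBeta 𝒴) Im Ip (TensorAlgebra.lift ℂ genNeg x) = 𝐧A x := by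
  have : (Double.mk 𝒴.act 𝒴.dual.act (heisBeta 𝒴) Im Ip).comp (TensorAlgebra.lift ℂ genNeg) =
      𝐧A := by
    ext v
    simp [Double.negAlg, Double.neg]
  exact congrArg (fun a => a x) this

theorem Double.mk_lift_pos (x : TensorAlgebra ℂ (Module.Dual ℂ Y)) :
    Double.mk 𝒴.act 𝒴.dual.act (heisBeta 𝒴) Im Ip (TensorAlgebra.lift ℂ genPos x) = 𝐩A x := by
  have : (Double.mk 𝒴.act 𝒴.dual.act (heisBeta 𝒴) Im Ip).comp (TensorAlgebra.lift ℂ genPos) =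
      𝐩A := by
    ext v
    simp [Double.posAlg, Double.pos]
  exact congrArg (fun a => a x) this

theorem Double.posAlg_eq_zero (x : TensorAlgebra ℂ (Module.Dual ℂ Y)) (hx : x ∈ Ip) :
    𝐩A x = 0 := by
  have := Double.mk_rel 𝒴.act 𝒴.dual.act (heisBeta 𝒴) Im Ip (DoubleRel.pos x hx)
  rwa [Double.mk_lift_pos, map_zero] at this

theorem Double.negAlg_eq_zero (x : TensorAlgebra ℂ Y) (hx : x ∈ Im) : 𝐧A x = 0 := by
  have := Double.mk_rel 𝒴.act 𝒴.dual.act (heisBeta 𝒴) Im Ip (DoubleRel.neg x hx)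
  rwa [Double.mk_lift_neg, map_zero] at this

theorem YDMod.act_proj (g h : G) (v : Y) :
    𝒴.proj (g * h * g⁻¹) (𝒴.act g v) = 𝒴.act g (𝒴.proj h v) := by
  have : 𝒴.proj (g * h * g⁻¹) ∘ₗ 𝒴.act g = 𝒴.act g ∘ₗ 𝒴.proj h := by
    refine 𝒴.ext_hom fun k v hv => ?_
    by_cases hk : k = h
    · subst hk
      simp [𝒴.proj_of_mem hv, 𝒴.proj_of_mem (𝒴.act_mem g k v hv)]
    · have hk' : g * k * g⁻¹ ≠ g * h * g⁻¹ := by simpa using hk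
      simp [𝒴.proj_of_mem_ne hk hv, 𝒴.proj_of_mem_ne hk' (𝒴.act_mem g k v hv)]
  exact congrArg (fun a => a v) this

/-- The relations in `Im` hold for the components of the coaction of `T(Y)`. -/
def RelGraded : Prop := ∀ x ∈ Im, MonoidAlgebra.mapAlgHom G 𝐧A (tensorCoact 𝒴 x) = 0

theorem preCoact_rel (hIm : RelGraded 𝒴 Im Ip)
    ⦃x y : DoubleGen G Y (Module.Dual ℂ Y)⦄
    (h : DoubleRel 𝒴.act 𝒴.dual.act (heisBeta 𝒴) Im Ip x y) :
    preCoact 𝒴 Im Ip x = preCoact 𝒴 Im Ip y := by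
  induction h with
  | grp_one =>
    rw [map_one (preCoact 𝒴 Im Ip), MonoidAlgebra.one_def, preCoact_grp, one_smul, map_one]
    rfl
  | grp_mul x y =>
    rw [map_mul]
    induction x using MonoidAlgebra.induction_linear with
    | zero => simp
    | add a b ha hb => simp only [map_add, add_mul, ha, hb]
    | single g r =>
      induction y using MonoidAlgebra.induction_linear with
      | zero => simp
      | add a b ha hb => simp only [map_add, mul_add, ha, hb]
      | single h s =>
        rw [MonoidAlgebra.single_mul_single, preCoact_grp, preCoact_grp, preCoact_grp,
          MonoidAlgebra.single_mul_single, map_mul, smul_mul_smul_comm]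
  | grp_neg g v =>
    rw [map_mul, map_mul, preCoact_grp, preCoact_neg, preCoact_neg, one_smul, Finset.mul_sum,
      Finset.sum_mul]
    refine Fintype.sum_equiv (MulAut.conj g).toEquiv _ _ fun h => ?_
    rw [MonoidAlgebra.single_mul_single, MonoidAlgebra.single_mul_single]
    simp only [MulEquiv.toEquiv_eq_coe, MulEquiv.coe_toEquiv, MulAut.conj_apply]
    rw [Double.grp_neg, YDMod.act_proj, inv_mul_cancel_right]
  | grp_pos g f =>
    rw [map_mul, map_mul, preCoact_grp, preCoact_pos, preCoact_pos, one_smul,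
      MonoidAlgebra.single_mul_single, MonoidAlgebra.single_mul_single, Double.grp_pos, mul_one,
      one_mul]
  | pos_neg f v =>
    rw [map_mul, map_add, map_mul, preCoact_pos, preCoact_neg, heisBeta_apply, map_sum, map_sum,
      Finset.mul_sum, Finset.sum_mul, ← Finset.sum_add_distrib]
    refine Finset.sum_congr rfl fun g _ => ?_
    rw [preCoact_grp, MonoidAlgebra.single_mul_single, MonoidAlgebra.single_mul_single, mul_one,
      one_mul, ← MonoidAlgebra.single_add, Double.pos_neg, Finset.sum_eq_single g,
      𝒴.proj_of_mem (𝒴.proj_mem g v)]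
    · intro k _ hne
      rw [𝒴.proj_of_mem_ne hne.symm (𝒴.proj_mem g v)]; simp
    · simp
  | neg x hx => rw [preCoact_negAlg, hIm x hx, map_zero]
  | pos x hx => rw [preCoact_posAlg, Double.posAlg_eq_zero 𝒴 Im Ip x hx, map_zero]; simp

/-- The coaction on `A_β(I⁻, I⁺)`. -/
def Double.coact (hIm : RelGraded 𝒴 Im Ip) :
    YDDouble 𝒴 Im Ip →ₐ[ℂ] MonoidAlgebra (YDDouble 𝒴 Im Ip) G :=
  RingQuot.liftAlgHom ℂ ⟨preCoact 𝒴 Im Ip, preCoact_rel 𝒴 Im Ip hIm⟩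

variable (hIm : RelGraded 𝒴 Im Ip)

theorem Double.coact_mk (x : DoubleGen G Y (Module.Dual ℂ Y)) :
    Double.coact 𝒴 Im Ip hIm (Double.mk 𝒴.act 𝒴.dual.act (heisBeta 𝒴) Im Ip x) =
      preCoact 𝒴 Im Ip x :=
  RingQuot.liftAlgHom_mkAlgHom_apply ℂ _ _ x

theorem Double.coact_neg {g : G} {v : Y} (hv : v ∈ 𝒴.comp g) :
    Double.coact 𝒴 Im Ip hIm (𝐧 v) = MonoidAlgebra.single g (𝐧 v) := by
  refine (Double.coact_mk 𝒴 Im Ip hIm (genNeg v)).trans ?_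
  rw [preCoact_neg, Finset.sum_eq_single g]
  · rw [𝒴.proj_of_mem hv]
  · intro k _ hne
    rw [𝒴.proj_of_mem_ne hne.symm hv]; simp
  · simp

theorem Double.coact_pos (f : Module.Dual ℂ Y) :
    Double.coact 𝒴 Im Ip hIm (𝐩 f) = MonoidAlgebra.single 1 (𝐩 f) :=
  (Double.coact_mk 𝒴 Im Ip hIm (genPos f)).trans (preCoact_pos 𝒴 Im Ip f)

theorem Double.coact_grp (g : G) :
    Double.coact 𝒴 Im Ip hIm (𝐠 g) = MonoidAlgebra.single g (𝐠 g) :=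
  (Double.coact_mk 𝒴 Im Ip hIm _).trans ((preCoact_grp 𝒴 Im Ip g 1).trans (by rw [one_smul]))

theorem Double.coact_negAlg (x : TensorAlgebra ℂ Y) :
    Double.coact 𝒴 Im Ip hIm (𝐧A x) = MonoidAlgebra.mapAlgHom G 𝐧A (tensorCoact 𝒴 x) := by
  rw [← Double.mk_lift_neg, Double.coact_mk, preCoact_negAlg]

theorem Double.mk_induction {P : YDDouble 𝒴 Im Ip → Prop}
    (smul_one : ∀ r : ℂ, P (algebraMap ℂ _ r)) (neg : ∀ g, ∀ v ∈ 𝒴.comp g, P (𝐧 v))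
    (pos : ∀ f, P (𝐩 f)) (grp : ∀ (g : G) (r : ℂ), P (r • 𝐠 g))
    (add : ∀ a b, P a → P b → P (a + b)) (mul : ∀ a b, P a → P b → P (a * b))
    (a : YDDouble 𝒴 Im Ip) : P a := by
  obtain ⟨x, rfl⟩ := RingQuot.mkAlgHom_surjective ℂ _ a
  change P (Double.mk 𝒴.act 𝒴.dual.act (heisBeta 𝒴) Im Ip x)
  have zero : P 0 := by simpa using smul_one 0
  induction x using TensorAlgebra.induction with
  | algebraMap r => rw [AlgHom.commutes]; exact smul_one r
  | mul a b ha hb => rw [map_mul]; exact mul _ _ ha hb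
  | add a b ha hb => rw [map_add]; exact add _ _ ha hb
  | ι z =>
    obtain ⟨v, f, x⟩ := z
    have hz : ((v, f, x) : Y × Module.Dual ℂ Y × MonoidAlgebra ℂ G) =
        (v, 0, 0) + ((0, f, 0) + (0, 0, x)) := by simp
    rw [hz, map_add, map_add, map_add, map_add]
    refine add _ _ ?_ (add _ _ (pos f) ?_)
    · change P (𝐧 v)
      induction v using 𝒴.induction with
      | zero => rw [map_zero]; exact zero
      | add v w hv hw => rw [map_add]; exact add _ _ (hv (by simp)) (hw (by simp))
      | hom g v hv => exact neg g v hv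
    · change P (Double.grpAlg 𝒴.act 𝒴.dual.act (heisBeta 𝒴) Im Ip x)
      clear hz
      induction x using MonoidAlgebra.induction_linear with
      | zero => rw [map_zero]; exact zero
      | add v w hv hw => rw [map_add]; exact add _ _ hv hw
      | single g r => rw [Double.grpAlg_single]; exact grp g r

/-- The `G`-grading of `A_β(I⁻, I⁺)` given by the coaction `δ`: `A_g = {a | δ(a) = a ⊗ g}`.
The degree of `v ∈ Y_g` is `g`, the degree of `f ∈ Y*` is `1`, the degree of `g ∈ G` is `g`. -/
def Double.grading : GradedAlg ℂ G (YDDouble 𝒴 Im Ip) where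
  comp g := LinearMap.eqLocus (Double.coact 𝒴 Im Ip hIm).toLinearMap
    (MonoidAlgebra.lsingle (R := ℂ) g)
  one_mem := by
    rw [LinearMap.mem_eqLocus]
    simp [MonoidAlgebra.one_def]
  mul_mem := fun g h a b ha hb => by
    rw [LinearMap.mem_eqLocus] at ha hb ⊢
    simp only [AlgHom.toLinearMap_apply, MonoidAlgebra.lsingle_apply] at ha hb ⊢
    rw [map_mul, ha, hb, MonoidAlgebra.single_mul_single]
  isInternal := by
    refine isInternal_of_separating _ (fun g => Finsupp.lapply g ∘ₗ
      (MonoidAlgebra.coeffLinearEquiv ℂ).toLinearMap ∘ₗ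
      (Double.coact 𝒴 Im Ip hIm).toLinearMap) ?_ ?_ ?_
    · intro g a ha
      rw [LinearMap.mem_eqLocus] at ha
      simp only [LinearMap.comp_apply, ha]
      simp [MonoidAlgebra.coeffLinearEquiv]
    · intro g h hgh a ha
      rw [LinearMap.mem_eqLocus] at ha
      simp only [LinearMap.comp_apply, ha]
      simp [MonoidAlgebra.coeffLinearEquiv, hgh]
    · rw [eq_top_iff]
      intro a _
      induction a using Double.mk_induction 𝒴 Im Ip with
      | smul_one r =>
        refine Submodule.mem_iSup_of_mem 1 ?_
        rw [LinearMap.mem_eqLocus]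
        simp
      | neg g v hv =>
        refine Submodule.mem_iSup_of_mem g ?_
        exact Double.coact_neg 𝒴 Im Ip hIm hv
      | pos f =>
        refine Submodule.mem_iSup_of_mem 1 ?_
        exact Double.coact_pos 𝒴 Im Ip hIm f
      | grp g r =>
        refine Submodule.smul_mem _ _ (Submodule.mem_iSup_of_mem g ?_)
        exact Double.coact_grp 𝒴 Im Ip hIm g
      | add a b ha hb => exact Submodule.add_mem _ (ha trivial) (hb trivial)
      | mul a b ha hb =>
        have ha := ha trivial
        have hb := hb trivial
        refine Submodule.iSup_induction _ (motive := fun a => a * b ∈ _) ha ?_ ?_ ?_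
        · intro g a ha
          refine Submodule.iSup_induction _ (motive := fun b => a * b ∈ _) hb ?_ ?_ ?_
          · intro h b hb
            refine Submodule.mem_iSup_of_mem (g * h) ?_
            rw [LinearMap.mem_eqLocus] at ha hb ⊢
            simp only [AlgHom.toLinearMap_apply, MonoidAlgebra.lsingle_apply] at ha hb ⊢
            rw [map_mul, ha, hb, MonoidAlgebra.single_mul_single]
          · rw [mul_zero]; exact Submodule.zero_mem _
          · intro x y hx hy
            rw [mul_add]; exact Submodule.add_mem _ hx hy
        · rw [zero_mul]; exact Submodule.zero_mem _
        · intro x y hx hy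
          rw [add_mul]; exact Submodule.add_mem _ hx hy

end Coaction

/-- The component in degree `g` of an element of `T(Y)`. -/
def tensorComp (g : G) : TensorAlgebra ℂ Y →ₗ[ℂ] TensorAlgebra ℂ Y :=
  Finsupp.lapply g ∘ₗ (MonoidAlgebra.coeffLinearEquiv ℂ).toLinearMap ∘ₗ
    (tensorCoact 𝒴).toLinearMap

theorem tensorComp_apply (g : G) (x : TensorAlgebra ℂ Y) :
    tensorComp 𝒴 g x = (tensorCoact 𝒴 x).coeff g := rfl

theorem tensorComp_ι_mul {h : G} {v : Y} (hv : v ∈ 𝒴.comp h) (g : G) (x : TensorAlgebra ℂ Y) :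
    tensorComp 𝒴 g (TensorAlgebra.ι ℂ v * x) =
      TensorAlgebra.ι ℂ v * tensorComp 𝒴 (h⁻¹ * g) x := by
  rw [tensorComp_apply, tensorComp_apply, map_mul, tensorCoact_ι_of_mem 𝒴 hv,
    MonoidAlgebra.coeff_single_mul_apply]

theorem tensorComp_mul_ι {h : G} {v : Y} (hv : v ∈ 𝒴.comp h) (g : G) (x : TensorAlgebra ℂ Y) :
    tensorComp 𝒴 g (x * TensorAlgebra.ι ℂ v) =
      tensorComp 𝒴 (g * h⁻¹) x * TensorAlgebra.ι ℂ v := by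
  rw [tensorComp_apply, tensorComp_apply, map_mul, tensorCoact_ι_of_mem 𝒴 hv,
    MonoidAlgebra.coeff_mul_single_apply]

/-- The span of the homogeneous components of the elements of an ideal of `T(Y)`. -/
def compSpan (I : TwoSidedIdeal (TensorAlgebra ℂ Y)) : Submodule ℂ (TensorAlgebra ℂ Y) :=
  Submodule.span ℂ {z | ∃ u ∈ I, ∃ g : G, z = tensorComp 𝒴 g u}

theorem compSpan_mul_left (I : TwoSidedIdeal (TensorAlgebra ℂ Y)) (t x : TensorAlgebra ℂ Y)
    (hx : x ∈ compSpan 𝒴 I) : t * x ∈ compSpan 𝒴 I := by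
  induction t using TensorAlgebra.induction generalizing x with
  | algebraMap r => rw [← Algebra.smul_def]; exact Submodule.smul_mem _ _ hx
  | add a b ha hb => rw [add_mul]; exact Submodule.add_mem _ (ha x hx) (hb x hx)
  | mul a b ha hb => rw [mul_assoc]; exact ha _ (hb x hx)
  | ι v =>
    induction v using 𝒴.induction with
    | zero => simp
    | add a b ha hb => rw [map_add, add_mul]; exact Submodule.add_mem _ ha hb
    | hom h v hv =>
      induction hx using Submodule.span_induction with
      | mem z hz =>
        obtain ⟨u, hu, g, rfl⟩ := hz
        refine Submodule.subset_span ⟨_, I.mul_mem_left (TensorAlgebra.ι ℂ v) u hu, h * g, ?_⟩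
        rw [tensorComp_ι_mul 𝒴 hv, inv_mul_cancel_left]
      | zero => simp
      | add a b _ _ ha hb => rw [mul_add]; exact Submodule.add_mem _ ha hb
      | smul r a _ ha => rw [mul_smul_comm]; exact Submodule.smul_mem _ _ ha

theorem compSpan_mul_right (I : TwoSidedIdeal (TensorAlgebra ℂ Y)) (x t : TensorAlgebra ℂ Y)
    (hx : x ∈ compSpan 𝒴 I) : x * t ∈ compSpan 𝒴 I := by
  induction t using TensorAlgebra.induction generalizing x with
  | algebraMap r =>
    rw [← Algebra.commutes, ← Algebra.smul_def]; exact Submodule.smul_mem _ _ hx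
  | add a b ha hb => rw [mul_add]; exact Submodule.add_mem _ (ha x hx) (hb x hx)
  | mul a b ha hb => rw [← mul_assoc]; exact hb _ (ha x hx)
  | ι v =>
    induction v using 𝒴.induction with
    | zero => simp
    | add a b ha hb => rw [map_add, mul_add]; exact Submodule.add_mem _ ha hb
    | hom h v hv =>
      induction hx using Submodule.span_induction with
      | mem z hz =>
        obtain ⟨u, hu, g, rfl⟩ := hz
        refine Submodule.subset_span ⟨_, I.mul_mem_right u (TensorAlgebra.ι ℂ v) hu, g * h, ?_⟩
        rw [tensorComp_mul_ι 𝒴 hv, mul_inv_cancel_right]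
      | zero => simp
      | add a b _ _ ha hb => rw [add_mul]; exact Submodule.add_mem _ ha hb
      | smul r a _ ha => rw [smul_mul_assoc]; exact Submodule.smul_mem _ _ ha

/-- The ideal generated by the homogeneous components of the elements of an ideal. -/
def compIdeal (I : TwoSidedIdeal (TensorAlgebra ℂ Y)) : TwoSidedIdeal (TensorAlgebra ℂ Y) :=
  TwoSidedIdeal.mk' (compSpan 𝒴 I : Set (TensorAlgebra ℂ Y)) (Submodule.zero_mem _)
    (fun ha hb => Submodule.add_mem _ ha hb) (fun ha => Submodule.neg_mem _ ha)
    (fun {x y} hy => compSpan_mul_left 𝒴 I x y hy) (fun {x y} hx => compSpan_mul_right 𝒴 I x y hx)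

theorem mem_compIdeal (I : TwoSidedIdeal (TensorAlgebra ℂ Y)) (x : TensorAlgebra ℂ Y) :
    x ∈ compIdeal 𝒴 I ↔ x ∈ compSpan 𝒴 I :=
  TwoSidedIdeal.mem_mk' _ _ _ _ _ _ _

theorem tensorComp_mem_compIdeal (I : TwoSidedIdeal (TensorAlgebra ℂ Y)) {u : TensorAlgebra ℂ Y}
    (hu : u ∈ I) (g : G) : tensorComp 𝒴 g u ∈ compIdeal 𝒴 I :=
  (mem_compIdeal 𝒴 I _).2 (Submodule.subset_span ⟨u, hu, g, rfl⟩)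

theorem compIdeal_smul_mem (I : TwoSidedIdeal (TensorAlgebra ℂ Y)) (r : ℂ)
    {x : TensorAlgebra ℂ Y} (hx : x ∈ compIdeal 𝒴 I) : r • x ∈ compIdeal 𝒴 I := by
  rw [mem_compIdeal] at hx ⊢
  exact Submodule.smul_mem _ _ hx

theorem algebraMapInv_tensorComp (g : G) (u : TensorAlgebra ℂ Y)
    (hu : TensorAlgebra.algebraMapInv u = 0) :
    TensorAlgebra.algebraMapInv (tensorComp 𝒴 g u) = 0 := by
  have key : (MonoidAlgebra.mapAlgHom G (TensorAlgebra.algebraMapInv (R := ℂ) (M := Y))).comp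
      (tensorCoact 𝒴) =
      (MonoidAlgebra.singleOneAlgHom (R := ℂ) (M := G) (A := ℂ)).comp
        TensorAlgebra.algebraMapInv := by
    ext v
    simp [tensorCoact_ι, TensorAlgebra.algebraMapInv]
  have := congrArg (fun a => (a u).coeff g) key
  simpa [hu, tensorComp_apply] using this

theorem lift_act_tensorComp (k g : G) (u : TensorAlgebra ℂ Y) :
    TensorAlgebra.lift ℂ (TensorAlgebra.ι ℂ ∘ₗ 𝒴.act k) (tensorComp 𝒴 g u) =
      tensorComp 𝒴 (k * g * k⁻¹) (TensorAlgebra.lift ℂ (TensorAlgebra.ι ℂ ∘ₗ 𝒴.act k) u) := by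
  have key : (MonoidAlgebra.domCongr ℂ (TensorAlgebra ℂ Y) (MulAut.conj k)).toAlgHom.comp
      ((MonoidAlgebra.mapAlgHom G (TensorAlgebra.lift ℂ (TensorAlgebra.ι ℂ ∘ₗ 𝒴.act k))).comp
        (tensorCoact 𝒴)) =
      (tensorCoact 𝒴).comp (TensorAlgebra.lift ℂ (TensorAlgebra.ι ℂ ∘ₗ 𝒴.act k)) := by
    apply TensorAlgebra.hom_ext
    refine 𝒴.ext_hom fun h v hv => ?_
    simp [tensorCoact_ι_of_mem 𝒴 hv, tensorCoact_ι_of_mem 𝒴 (𝒴.act_mem k h v hv)]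
  have := congrArg (fun a => (a u).coeff (k * g * k⁻¹)) key
  have e : k⁻¹ * (k * g * k⁻¹) * k = g := by group
  simpa [tensorComp_apply, e] using this

theorem tensorComp_pow_mem (g : G) (n : ℕ) (x : TensorAlgebra ℂ Y)
    (hx : x ∈ LinearMap.range (TensorAlgebra.ι ℂ : Y →ₗ[ℂ] TensorAlgebra ℂ Y) ^ n) :
    tensorComp 𝒴 g x ∈ LinearMap.range (TensorAlgebra.ι ℂ : Y →ₗ[ℂ] TensorAlgebra ℂ Y) ^ n := by
  induction n generalizing g x with
  | zero =>
    rw [pow_zero, Submodule.mem_one] at hx ⊢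
    obtain ⟨r, rfl⟩ := hx
    rw [tensorComp_apply, AlgHom.commutes, MonoidAlgebra.coe_algebraMap]
    by_cases hg : g = 1
    · subst hg; exact ⟨r, by simp⟩
    · exact ⟨0, by simp [MonoidAlgebra.coeff_single, Ne.symm hg]⟩
  | succ n ih =>
    rw [pow_succ'] at hx ⊢
    induction hx using Submodule.mul_induction_on' with
    | mem_mul_mem a ha b hb =>
      obtain ⟨v, rfl⟩ := ha
      induction v using 𝒴.induction with
      | zero => simp
      | add v w hv hw => rw [map_add, add_mul, map_add]; exact Submodule.add_mem _ hv hw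
      | hom h v hv =>
        rw [tensorComp_ι_mul 𝒴 hv]
        exact Submodule.mul_mem_mul ⟨v, rfl⟩ (ih _ b hb)
    | add a _ b _ ha hb => rw [map_add]; exact Submodule.add_mem _ ha hb

theorem decompose_tensorComp (g : G) (n : ℕ) (u : TensorAlgebra ℂ Y) :
    (DirectSum.decompose (fun n : ℕ =>
      LinearMap.range (TensorAlgebra.ι ℂ : Y →ₗ[ℂ] TensorAlgebra ℂ Y) ^ n) (tensorComp 𝒴 g u) n :
        TensorAlgebra ℂ Y) =
    tensorComp 𝒴 g (DirectSum.decompose (fun n : ℕ =>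
      LinearMap.range (TensorAlgebra.ι ℂ : Y →ₗ[ℂ] TensorAlgebra ℂ Y) ^ n) u n) := by
  induction u using DirectSum.Decomposition.inductionOn (fun n : ℕ =>
      LinearMap.range (TensorAlgebra.ι ℂ : Y →ₗ[ℂ] TensorAlgebra ℂ Y) ^ n) with
  | zero => simp
  | add a b ha hb => simp [ha, hb]
  | homogeneous m =>
    rename_i i
    by_cases hi : i = n
    · subst hi
      rw [DirectSum.decompose_of_mem_same _ m.2,
        DirectSum.decompose_of_mem_same _ (tensorComp_pow_mem 𝒴 g i m m.2)]
    · rw [DirectSum.decompose_of_mem_ne _ m.2 hi,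
        DirectSum.decompose_of_mem_ne _ (tensorComp_pow_mem 𝒴 g i m m.2) hi, map_zero]

theorem isNegIdeal_compIdeal (I : TwoSidedIdeal (TensorAlgebra ℂ Y))
    (hI : IsNegIdeal 𝒴.act 𝒴.dual.act (heisBeta 𝒴) I) :
    IsNegIdeal 𝒴.act 𝒴.dual.act (heisBeta 𝒴) (compIdeal 𝒴 I) where
  graded x hx n := by
    rw [mem_compIdeal] at hx
    induction hx using Submodule.span_induction with
    | mem z hz =>
      obtain ⟨u, hu, g, rfl⟩ := hz
      rw [decompose_tensorComp]
      exact tensorComp_mem_compIdeal 𝒴 I (hI.graded u hu n) g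
    | zero => simp
    | add a b _ _ ha hb => simpa using TwoSidedIdeal.add_mem _ ha hb
    | smul r a _ ha =>
      rw [DirectSum.decompose_smul]
      exact compIdeal_smul_mem 𝒴 I r ha
  positive x hx := by
    rw [mem_compIdeal] at hx
    induction hx using Submodule.span_induction with
    | mem z hz =>
      obtain ⟨u, hu, g, rfl⟩ := hz
      exact algebraMapInv_tensorComp 𝒴 g u (hI.positive u hu)
    | zero => simp
    | add a b _ _ ha hb => simp [ha, hb]
    | smul r a _ ha => simp [ha]
  invariant k x hx := by
    rw [mem_compIdeal] at hx
    induction hx using Submodule.span_induction with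
    | mem z hz =>
      obtain ⟨u, hu, g, rfl⟩ := hz
      rw [lift_act_tensorComp]
      exact tensorComp_mem_compIdeal 𝒴 I (hI.invariant k u hu) _
    | zero => simp
    | add a b _ _ ha hb => rw [map_add]; exact TwoSidedIdeal.add_mem _ ha hb
    | smul r a _ ha => rw [map_smul]; exact compIdeal_smul_mem 𝒴 I r ha
  commutator f x hx := by
    rw [mem_compIdeal] at hx
    induction hx using Submodule.span_induction with
    | mem z hz =>
      obtain ⟨u, hu, g, rfl⟩ := hz
      have h0 : RelGraded 𝒴 ∅ ∅ := fun x hx => hx.elim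
      let c : YDDouble 𝒴 ∅ ∅ →ₗ[ℂ] YDDouble 𝒴 ∅ ∅ := Finsupp.lapply g ∘ₗ
        (MonoidAlgebra.coeffLinearEquiv ℂ).toLinearMap ∘ₗ (Double.coact 𝒴 ∅ ∅ h0).toLinearMap
      have hc : ∀ a, c a = (Double.coact 𝒴 ∅ ∅ h0 a).coeff g := fun a => rfl
      have hcu : c (Double.pos 𝒴.act 𝒴.dual.act (heisBeta 𝒴) ∅ ∅ f *
            Double.negAlg 𝒴.act 𝒴.dual.act (heisBeta 𝒴) ∅ ∅ u -
          Double.negAlg 𝒴.act 𝒴.dual.act (heisBeta 𝒴) ∅ ∅ u *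
            Double.pos 𝒴.act 𝒴.dual.act (heisBeta 𝒴) ∅ ∅ f) =
          Double.pos 𝒴.act 𝒴.dual.act (heisBeta 𝒴) ∅ ∅ f *
            Double.negAlg 𝒴.act 𝒴.dual.act (heisBeta 𝒴) ∅ ∅ (tensorComp 𝒴 g u) -
          Double.negAlg 𝒴.act 𝒴.dual.act (heisBeta 𝒴) ∅ ∅ (tensorComp 𝒴 g u) *
            Double.pos 𝒴.act 𝒴.dual.act (heisBeta 𝒴) ∅ ∅ f := by
        rw [map_sub, hc, hc, map_mul, map_mul, Double.coact_pos, Double.coact_negAlg,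
          MonoidAlgebra.coeff_single_one_mul, MonoidAlgebra.coeff_mul_single_one]
        simp [tensorComp_apply]
      rw [← hcu]
      have hmem := hI.commutator f u hu
      clear hcu
      generalize Double.pos 𝒴.act 𝒴.dual.act (heisBeta 𝒴) ∅ ∅ f *
            Double.negAlg 𝒴.act 𝒴.dual.act (heisBeta 𝒴) ∅ ∅ u -
          Double.negAlg 𝒴.act 𝒴.dual.act (heisBeta 𝒴) ∅ ∅ u *
            Double.pos 𝒴.act 𝒴.dual.act (heisBeta 𝒴) ∅ ∅ f = w at hmem ⊢
      induction hmem using Submodule.span_induction with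
      | mem z hz =>
        obtain ⟨y, hy, k, rfl⟩ := hz
        refine Submodule.subset_span
          ⟨_, tensorComp_mem_compIdeal 𝒴 I hy (g * k⁻¹), k, ?_⟩
        rw [hc, map_mul, Double.coact_grp, Double.coact_negAlg,
          MonoidAlgebra.coeff_mul_single_apply]
        simp [tensorComp_apply]
      | zero => simp
      | add a b _ _ ha hb => rw [map_add]; exact Submodule.add_mem _ ha hb
      | smul r a _ ha => rw [map_smul]; exact Submodule.smul_mem _ _ ha
    | zero => simp
    | add a b _ _ ha hb =>
      rw [map_add, mul_add, add_mul, add_sub_add_comm]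
      exact Submodule.add_mem _ ha hb
    | smul r a _ ha =>
      rw [map_smul, mul_smul_comm, smul_mul_assoc, ← smul_sub]
      exact Submodule.smul_mem _ _ ha

theorem negAlg_coact_eq_zero (J : TwoSidedIdeal (TensorAlgebra ℂ Y))
    (Ip : Set (TensorAlgebra ℂ (Module.Dual ℂ Y))) (x : TensorAlgebra ℂ Y)
    (h : ∀ g, tensorComp 𝒴 g x ∈ J) :
    MonoidAlgebra.mapAlgHom G (Double.negAlg 𝒴.act 𝒴.dual.act (heisBeta 𝒴) J Ip)
      (tensorCoact 𝒴 x) = 0 := by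
  ext g
  have h2 := Double.negAlg_eq_zero 𝒴 _ Ip _ (h g)
  simpa [tensorComp_apply] using h2

theorem algHom_eq_zero_of_mem_sSup {A B : Type*} [Ring A] [Ring B] [Algebra ℂ A] [Algebra ℂ B]
    (φ : A →ₐ[ℂ] B) (S : Set (TwoSidedIdeal A)) (h : ∀ I ∈ S, ∀ u ∈ I, φ u = 0) (x : A)
    (hx : x ∈ sSup S) : φ x = 0 := by
  have hle : sSup S ≤ TwoSidedIdeal.ker φ :=
    sSup_le fun I hI u hu => (TwoSidedIdeal.mem_ker φ).2 (h I hI u hu)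
  exact (TwoSidedIdeal.mem_ker φ).1 (hle hx)

theorem mem_sSup_of_mem_of_mem {A : Type*} [Ring A] (S : Set (TwoSidedIdeal A)) {I : TwoSidedIdeal A}
    (hI : I ∈ S) {x : A} (hx : x ∈ I) : x ∈ sSup S :=
  (le_sSup hI : I ≤ sSup S) hx

theorem heis_relations_graded :
    RelGraded 𝒴 (maxNegIdeal 𝒴.act 𝒴.dual.act (heisBeta 𝒴))
      (maxPosIdeal 𝒴.act 𝒴.dual.act (heisBeta 𝒴)) := by
  intro x hx
  refine algHom_eq_zero_of_mem_sSup ((MonoidAlgebra.mapAlgHom G (Double.negAlg 𝒴.act 𝒴.dual.act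
    (heisBeta 𝒴) _ _)).comp (tensorCoact 𝒴))
    {I | IsNegIdeal 𝒴.act 𝒴.dual.act (heisBeta 𝒴) I} ?_ x hx
  intro I hI u hu
  exact negAlg_coact_eq_zero 𝒴 _ _ u fun g =>
    mem_sSup_of_mem_of_mem _ (isNegIdeal_compIdeal 𝒴 I hI) (tensorComp_mem_compIdeal 𝒴 I hu g)

/-- The `G`-grading of the braided Heisenberg double: the degree of `v ∈ Y_g` is `g`, the degree
of `f ∈ Y*` is `1`, the degree of `g ∈ G` is `g`. -/
def heisGrading : GradedAlg ℂ G (Heis 𝒴) :=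
  Double.grading 𝒴 _ _ (heis_relations_graded 𝒴)

/-- The element `v ∈ Y` of `𝓗_Y`. -/
def Heis.neg : Y →ₗ[ℂ] Heis 𝒴 := Double.neg 𝒴.act 𝒴.dual.act (heisBeta 𝒴) _ _

/-- The element `f ∈ Y*` of `𝓗_Y`. -/
def Heis.pos : Module.Dual ℂ Y →ₗ[ℂ] Heis 𝒴 := Double.pos 𝒴.act 𝒴.dual.act (heisBeta 𝒴) _ _

/-- The element `g ∈ G` of `𝓗_Y`. -/
def Heis.grp : G →* Heis 𝒴 := Double.grp 𝒴.act 𝒴.dual.act (heisBeta 𝒴) _ _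

theorem Heis.neg_mem {g : G} {v : Y} (hv : v ∈ 𝒴.comp g) :
    Heis.neg 𝒴 v ∈ (heisGrading 𝒴).comp g :=
  Double.coact_neg 𝒴 _ _ _ hv

theorem Heis.pos_mem (f : Module.Dual ℂ Y) : Heis.pos 𝒴 f ∈ (heisGrading 𝒴).comp 1 :=
  Double.coact_pos 𝒴 _ _ _ f

theorem Heis.grp_mem (g : G) : Heis.grp 𝒴 g ∈ (heisGrading 𝒴).comp g :=
  Double.coact_grp 𝒴 _ _ _ g

/-- `𝓗_Y` as a Yetter-Drinfeld module: the above grading and the action of `G` by conjugation,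
`g ▷ a = g a g⁻¹`. -/
def heisYD : YDMod ℂ G (Heis 𝒴) where
  toGradedMod := (heisGrading 𝒴).toGradedMod
  free := fun g => Module.Free.of_divisionRing ℂ ((heisGrading 𝒴).comp g)
  act :=
    { toFun := fun g => LinearMap.mulLeft ℂ (Heis.grp 𝒴 g) ∘ₗ
        LinearMap.mulRight ℂ (Heis.grp 𝒴 g⁻¹)
      map_one' := by ext a; simp
      map_mul' := fun g h => by ext a; simp [mul_assoc] }
  act_mem := fun g h a ha => by
    change Heis.grp 𝒴 g * (a * Heis.grp 𝒴 g⁻¹) ∈ (heisGrading 𝒴).comp (g * h * g⁻¹)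
    rw [mul_assoc g h]
    exact (heisGrading 𝒴).mul_mem _ _ _ _ (Heis.grp_mem 𝒴 g)
      ((heisGrading 𝒴).mul_mem _ _ _ _ ha (Heis.grp_mem 𝒴 g⁻¹))

/-! ### The cocycle extension -/

variable (R : Type*) [CommRing R] [Algebra ℂ R] (μ : Cocycle G Rˣ)

/-- The extension of `𝓗_Y` by the cocycle `μ`: the twist by `μ` of `R ⊗ 𝓗_Y`. -/
abbrev HeisExt : Type _ := CocycleTwist ((heisGrading 𝒴).baseChange R) μ

/-- The extension of `𝓗_Y` by `μ` as a Yetter-Drinfeld module over `R`: the grading is that of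
`R ⊗ 𝓗_Y`, and the action is `g ▷_χ a = χ(g, k) (g ▷ a)` for `a` of degree `k`. -/
def heisExtYD : YDMod R G (HeisExt 𝒴 R μ) :=
  (((heisYD 𝒴).baseChange R).twist μ : YDMod R G (R ⊗[ℂ] Heis 𝒴))

/-- The element `v ∈ Y` of the extension. -/
def HeisExt.neg (v : Y) : HeisExt 𝒴 R μ := CocycleTwist.of _ μ (1 ⊗ₜ[ℂ] Heis.neg 𝒴 v)

/-- The element `f ∈ Y*` of the extension. -/
def HeisExt.pos (f : Module.Dual ℂ Y) : HeisExt 𝒴 R μ :=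
  CocycleTwist.of _ μ (1 ⊗ₜ[ℂ] Heis.pos 𝒴 f)

/-- The element `g ∈ G` of the extension. -/
def HeisExt.grp (g : G) : HeisExt 𝒴 R μ := CocycleTwist.of _ μ (1 ⊗ₜ[ℂ] Heis.grp 𝒴 g)

/-- `Ỹ_μ`: the module `R ⊗ Y` with the grading of `Y` and the action `▷_χ`. -/
def extYD : YDMod R G (R ⊗[ℂ] Y) := (𝒴.baseChange R).twist μ

/-- `𝓑(Ỹ_μ)`. -/
abbrev NicholsNeg : Type _ := Nichols (extYD 𝒴 R μ).braiding

/-- `𝓑(Ỹ*, τ Ψ* τ)`, where `Ỹ* = R ⊗ Y*` is the trivial extension of `Y*` and `Ψ*` is its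
braiding. -/
abbrev NicholsPos : Type _ := Nichols (flipBraiding (𝒴.dual.baseChange R).braiding)

end Heisenberg

end

end BraidedDoubles

open BraidedDoubles

namespace BraidedDoubles

noncomputable section

open scoped TensorProduct

/-! Skew derivations control everything. Wherever the cross relations hold, moving `f ∈ Y*` through
`x ∈ T(Y)` gives `f x = x f + ∑ g, D_{f,g}(x) g` with `D_{f,g}(x v) = ⟨f, v_g⟩ x + D_{f,g}(x) (g ▷
v)` (`commutator_negD`). Moving `v ∈ Y` through `x ∈ T(Y*)` gives operators `E_{v,g}` in the same
way, with the group elements on the left (`commutator_posE`). Both families lower the degree by one.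
The `radical` of such a family consists of the tensors all of whose iterated derivatives have
constant term zero.

Over `ℂ`, the maximal ideals `I⁻_β`, `I⁺_β` are the radicals of `D` and `E`. A radical is an
admissible ideal because stability under the derivations is the commutator condition
(`isNegIdeal_ideal`). Conversely, `A_β(0, 0)` acts on `T(Y)/rad ⊗ ℂG ⊗ T(Y*)/rad` by formulas copied
from left multiplication. This action reads off the coefficient of `g` in `[f, x]` modulo the
radical, so an admissible ideal is stable modulo the radical and lies in it (`isNegIdeal_le`). The
same representation descends to `𝓗_Y` and inverts the multiplication map `a ⊗ g ⊗ b ↦ a g b`. As a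
consequence, an element of `T(Y)` without constant term that commutes with `Y*` in `𝓗_Y` is zero
there (`Heis.negAlg_eq_zero_of_commute`).

Nichols algebras are quotients by radicals as well. Contracting the last tensor factor of `[n]_Ψ x`
with a functional is a derivative of `x` (`toTensorAlgebra_contr_braidedInt`), so `ker [n]!_Ψ` is
the degree `n` part of a radical. For `Y*` with the braiding `τ Ψ* τ` this produces derivations that
strip letters from the right, whereas `E` strips them from the left. The two families commute and
their constant terms determine each other, so the radicals agree (`radical_posE_eq`).

Now the cocycle. A basis of `𝓗_Y` made of products `a g b` with homogeneous `a` is only rescaled by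
units when the product becomes `⋆`, so the extension has a triangular basis
(`HeisExt.exists_basis`). The ratio of `μ(g, k)` and `μ(g k g⁻¹, g)` is `χ(g, k)`, which yields the
cross relations with `▷_χ`; relations with `Y*`, which has degree `1`, do not feel the twist. The
main point is that the kernel of `T(Ỹ_μ) → (𝓗_Y)_μ` is the radical of the twisted derivations
(`HeisExt.negAlg_eq_zero_iff`). The kernel is stable under them by the triangular basis. Conversely,
if `x` has no constant term and its derivatives vanish in the extension, its image commutes with
`Y*`, also for the untwisted product. Applying functionals on `R` then reduces its vanishing to the
statement over `ℂ` above. No compatibility of radicals with extension of scalars is needed.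

For the universal property, the triangular decomposition prescribes a linear map `φ`. The `y` with
`φ(y w) = φ(y) φ(w)` for all `w` form a subalgebra, and it contains the generators because the cross
relations rewrite a generator times `a x b` in the same way in both algebras
(`map_mul_of_crossRelations`). -/

/-! ### Degree-lowering operators on tensor algebras -/

section Lowering

variable {R V I : Type*} [CommRing R] [AddCommGroup V] [Module R V]

/-- The homogeneous component `V^{⊗n}` of the tensor algebra. -/
abbrev tensorPow (R V : Type*) [CommRing R] [AddCommGroup V] [Module R V] (n : ℕ) :
    Submodule R (TensorAlgebra R V) :=
  LinearMap.range (TensorAlgebra.ι R : V →ₗ[R] TensorAlgebra R V) ^ n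

/-- A family of operators on `T(V)` that lower the degree by one. -/
structure Lowering (D : I → TensorAlgebra R V →ₗ[R] TensorAlgebra R V) : Prop where
  one : ∀ i, D i 1 = 0
  pow : ∀ i n x, x ∈ tensorPow R V (n + 1) → D i x ∈ tensorPow R V n

/-- The composite of the operators of a list, the head of the list acting first. -/
def iterD (D : I → TensorAlgebra R V →ₗ[R] TensorAlgebra R V) :
    List I → TensorAlgebra R V →ₗ[R] TensorAlgebra R V
  | [] => LinearMap.id
  | i :: L => iterD D L ∘ₗ D i

/-- The largest `D`-stable submodule of the augmentation ideal. -/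
def radical (D : I → TensorAlgebra R V →ₗ[R] TensorAlgebra R V) :
    Submodule R (TensorAlgebra R V) :=
  ⨅ L, LinearMap.ker (TensorAlgebra.algebraMapInv.toLinearMap ∘ₗ iterD D L)

variable {D : I → TensorAlgebra R V →ₗ[R] TensorAlgebra R V}

theorem mem_radical {x : TensorAlgebra R V} :
    x ∈ radical D ↔ ∀ L, TensorAlgebra.algebraMapInv (iterD D L x) = 0 := by
  simp [radical, Submodule.mem_iInf]

theorem iterD_append (L L' : List I) (x : TensorAlgebra R V) :
    iterD D (L ++ L') x = iterD D L' (iterD D L x) := by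
  induction L generalizing x with
  | nil => rfl
  | cons i L ih => exact ih _

theorem map_mem_radical {x : TensorAlgebra R V} (hx : x ∈ radical D) (i : I) :
    D i x ∈ radical D :=
  mem_radical.2 fun L => mem_radical.1 hx (i :: L)

theorem algebraMapInv_of_mem_radical {x : TensorAlgebra R V} (hx : x ∈ radical D) :
    TensorAlgebra.algebraMapInv x = 0 :=
  mem_radical.1 hx []

theorem mem_radical_of_forall {x : TensorAlgebra R V} (h0 : TensorAlgebra.algebraMapInv x = 0)
    (h : ∀ i, D i x ∈ radical D) : x ∈ radical D :=
  mem_radical.2 fun L => match L with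
    | [] => h0
    | i :: L => mem_radical.1 (h i) L

/-- This justifies the word "largest"; the inclusions of ideals and kernels in a radical below all
come from it. -/
theorem le_radical {S : Submodule R (TensorAlgebra R V)}
    (h0 : ∀ x ∈ S, TensorAlgebra.algebraMapInv x = 0) (h : ∀ i, ∀ x ∈ S, D i x ∈ S) :
    S ≤ radical D := by
  intro x hx
  rw [mem_radical]
  intro L
  induction L generalizing x with
  | nil => exact h0 x hx
  | cons i L ih => exact ih (h i x hx)

theorem algebraMapInv_of_mem_tensorPow_succ {n : ℕ} {x : TensorAlgebra R V}
    (hx : x ∈ tensorPow R V (n + 1)) : TensorAlgebra.algebraMapInv x = 0 := by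
  rw [tensorPow, pow_succ] at hx
  induction hx using Submodule.mul_induction_on' with
  | mem_mul_mem a ha b hb =>
    obtain ⟨v, rfl⟩ := hb
    simp [TensorAlgebra.algebraMapInv]
  | add a _ b _ ha hb => rw [map_add, ha, hb, add_zero]

theorem mem_tensorPow_zero {x : TensorAlgebra R V} (hx : x ∈ tensorPow R V 0) :
    ∃ r, algebraMap R _ r = x := by
  rwa [tensorPow, pow_zero, Submodule.mem_one] at hx

theorem Lowering.map_algebraMap (hD : Lowering D) (i : I) (r : R) :
    D i (algebraMap R _ r) = 0 := by
  rw [Algebra.algebraMap_eq_smul_one, map_smul, hD.one, smul_zero]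

/-- The augmentation only sees degree `0`, and a word of operators reaches it from degree `n` only
if its length is `n`. -/
theorem Lowering.algebraMapInv_iterD (hD : Lowering D) {n : ℕ} {x : TensorAlgebra R V}
    (hx : x ∈ tensorPow R V n) {L : List I} (hL : L.length ≠ n) :
    TensorAlgebra.algebraMapInv (iterD D L x) = 0 := by
  induction n generalizing x L with
  | zero =>
    obtain ⟨r, rfl⟩ := mem_tensorPow_zero hx
    cases L with
    | nil => simp at hL
    | cons i L => simp [iterD, hD.map_algebraMap]
  | succ n ih =>
    cases L with
    | nil => exact algebraMapInv_of_mem_tensorPow_succ hx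
    | cons i L => exact ih (hD.pow i n x hx) (by simpa using hL)

theorem Lowering.iterD_eq_zero (hD : Lowering D) {n : ℕ} {x : TensorAlgebra R V}
    (hx : x ∈ tensorPow R V n) {L : List I} (hL : n < L.length) : iterD D L x = 0 := by
  induction n generalizing x L with
  | zero =>
    obtain ⟨r, rfl⟩ := mem_tensorPow_zero hx
    cases L with
    | nil => simp at hL
    | cons i L => simp [iterD, hD.map_algebraMap]
  | succ n ih =>
    cases L with
    | nil => simp at hL
    | cons i L => exact ih (hD.pow i n x hx) (by simpa using hL)

theorem tensorPow_induction {P : TensorAlgebra R V → Prop}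
    (hom : ∀ n, ∀ x ∈ tensorPow R V n, P x) (add : ∀ x y, P x → P y → P (x + y))
    (x : TensorAlgebra R V) : P x := by
  induction x using DirectSum.Decomposition.inductionOn (tensorPow R V) with
  | zero => exact hom 0 0 (Submodule.zero_mem _)
  | homogeneous m => exact hom _ m m.2
  | add a b ha hb => exact add _ _ ha hb

theorem Lowering.exists_iterD_eq_zero (hD : Lowering D) (x : TensorAlgebra R V) :
    ∃ n, ∀ L : List I, n ≤ L.length → iterD D L x = 0 := by
  induction x using tensorPow_induction with
  | hom n x hx => exact ⟨n + 1, fun L hL => hD.iterD_eq_zero hx hL⟩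
  | add x y hx hy =>
    obtain ⟨n, hn⟩ := hx
    obtain ⟨m, hm⟩ := hy
    refine ⟨max n m, fun L hL => ?_⟩
    rw [map_add, hn L (le_trans (le_max_left _ _) hL), hm L (le_trans (le_max_right _ _) hL),
      add_zero]

/-- The condition attached to a word `L` only involves the component of degree `L.length`, so the
conditions separate by degree. This matters because the relations of a Nichols algebra are
homogeneous. -/
theorem Lowering.decompose_mem_radical (hD : Lowering D) {x : TensorAlgebra R V}
    (hx : x ∈ radical D) (n : ℕ) :
    (DirectSum.decompose (tensorPow R V) x n : TensorAlgebra R V) ∈ radical D := by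
  rw [mem_radical] at hx ⊢
  intro L
  by_cases hL : L.length = n
  -- Writing `0` as the constant term for `x` itself makes the goal additive in `x`, so homogeneous
  -- `x` suffice.
  · rw [← hx L]
    clear hx
    induction x using tensorPow_induction with
    | hom m x hm =>
      by_cases hmn : m = n
      · subst hmn
        rw [DirectSum.decompose_of_mem_same _ hm]
      · rw [DirectSum.decompose_of_mem_ne _ hm hmn,
          hD.algebraMapInv_iterD hm (by rw [hL]; exact Ne.symm hmn)]
        simp
    | add x y hx hy => simp [hx, hy]
  · exact hD.algebraMapInv_iterD (SetLike.coe_mem _) hL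

/-- A linear map on `T(V)` whose kernel is compatible with the operators `D i` has kernel
`radical D`. -/
theorem Lowering.ker_iff (hD : Lowering D) {H : Type*} [AddCommGroup H] [Module R H]
    (N : TensorAlgebra R V →ₗ[R] H) (stable : ∀ x, N x = 0 → ∀ i, N (D i x) = 0)
    (detect : ∀ x, TensorAlgebra.algebraMapInv x = 0 → (∀ i, N (D i x) = 0) → N x = 0)
    (inj : ∀ r, N (algebraMap R _ r) = 0 → r = 0) (x : TensorAlgebra R V) :
    N x = 0 ↔ x ∈ radical D := by
  constructor
  · intro hx
    refine le_radical (S := LinearMap.ker N) (fun y hy => ?_) (fun i y hy => stable y hy i) hx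
    have hy : N y = 0 := hy
    -- A kernel element is not known to have constant term zero. Subtracting the constant term
    -- changes no derivative, so `detect` applies to the difference, and `inj` then kills the
    -- constant.
    have key : N (y - algebraMap R _ (TensorAlgebra.algebraMapInv y)) = 0 := by
      refine detect _ ?_ fun i => ?_
      · rw [map_sub, TensorAlgebra.algebraMap_leftInverse, sub_self]
      · rw [map_sub, hD.map_algebraMap, sub_zero]
        exact stable y hy i
    refine inj _ ?_
    rw [map_sub, hy, zero_sub, neg_eq_zero] at key
    exact key
  -- Induction on a length `n` from which on all words of operators annihilate `x`; each `D i x` has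
  -- a smaller one.
  · obtain ⟨n, hn⟩ := hD.exists_iterD_eq_zero x
    intro hx
    induction n generalizing x with
    | zero =>
      have : x = 0 := hn [] (Nat.zero_le _)
      rw [this, map_zero]
    | succ n ih =>
      exact detect x (algebraMapInv_of_mem_radical hx) fun i =>
        ih (D i x) (fun L hL => hn (i :: L) (by simpa using hL)) (map_mem_radical hx i)

end Lowering

/-! ### Skew derivations of tensor algebras -/

section Skew

variable {R V I K : Type*} [CommRing R] [AddCommGroup V] [Module R V] [Fintype K]

/-- One step of the recursion that defines `skewD`. -/
def skewStep (φ : I → V →ₗ[R] R) (J : I → K → I) (A : I → K → V →ₗ[R] V) :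
    V →ₗ[R] Module.End R (TensorAlgebra R V × (I → TensorAlgebra R V)) :=
  LinearMap.mk₂ R (fun v p => (p.1 * TensorAlgebra.ι R v,
      fun i => φ i v • p.1 + ∑ k, p.2 (J i k) * TensorAlgebra.ι R (A i k v)))
    (fun v w p => by
      ext1
      · simp [mul_add]
      · ext i; simp [mul_add, add_smul, Finset.sum_add_distrib]; abel)
    (fun r v p => by
      ext1
      · simp
      · ext i; simp [mul_smul, Finset.smul_sum])
    (fun v p q => by
      ext1
      · simp [add_mul]
      · ext i; simp [add_mul, Finset.sum_add_distrib]; abel)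
    (fun r v p => by
      ext1
      · simp
      · ext i; simp [Finset.smul_sum, smul_comm r])

/-- The algebra map that defines `skewD`. -/
def skewLift (φ : I → V →ₗ[R] R) (J : I → K → I) (A : I → K → V →ₗ[R] V) :
    TensorAlgebra R V →ₐ[R] (Module.End R (TensorAlgebra R V × (I → TensorAlgebra R V)))ᵐᵒᵖ :=
  -- The first component carries the word read so far and the second its derivatives. Letters are
  -- appended on the right, so they act in reversed order: hence the opposite algebra.
  TensorAlgebra.lift R ((MulOpposite.opLinearEquiv R).toLinearMap ∘ₗ skewStep φ J A)

/-- The operators with `D i 1 = 0` and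
`D i (x v) = φ i v • x + ∑ k, D (J i k) x * A i k v` for `v ∈ V`. -/
def skewD (φ : I → V →ₗ[R] R) (J : I → K → I) (A : I → K → V →ₗ[R] V) (i : I) :
    TensorAlgebra R V →ₗ[R] TensorAlgebra R V :=
  LinearMap.proj i ∘ₗ LinearMap.snd R _ _ ∘ₗ LinearMap.applyₗ (1, 0) ∘ₗ
    (MulOpposite.opLinearEquiv R).symm.toLinearMap ∘ₗ (skewLift φ J A).toLinearMap

variable (φ : I → V →ₗ[R] R) (J : I → K → I) (A : I → K → V →ₗ[R] V)

theorem skewD_apply (i : I) (x : TensorAlgebra R V) :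
    skewD φ J A i x = ((skewLift φ J A x).unop (1, 0)).2 i := rfl

theorem skewLift_mul_ι (x : TensorAlgebra R V) (v : V) (p) :
    (skewLift φ J A (x * TensorAlgebra.ι R v)).unop p =
      skewStep φ J A v ((skewLift φ J A x).unop p) := by
  rw [map_mul, MulOpposite.unop_mul, Module.End.mul_apply]
  congr 1
  simp [skewLift]

theorem tensorAlgebra_induction_right {P : TensorAlgebra R V → Prop}
    (one : P 1) (add : ∀ x y, P x → P y → P (x + y)) (smul : ∀ (r : R) x, P x → P (r • x))
    (mul : ∀ x v, P x → P (x * TensorAlgebra.ι R v)) (x : TensorAlgebra R V) : P x := by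
  have key : ∀ n, ∀ x ∈ tensorPow R V n, P x := by
    intro n
    induction n with
    | zero =>
      intro x hx
      obtain ⟨r, rfl⟩ := mem_tensorPow_zero hx
      rw [Algebra.algebraMap_eq_smul_one]
      exact smul _ _ one
    | succ n ih =>
      intro x hx
      rw [tensorPow, pow_succ] at hx
      induction hx using Submodule.mul_induction_on' with
      | mem_mul_mem a ha b hb =>
        obtain ⟨v, rfl⟩ := hb
        exact mul _ _ (ih _ ha)
      | add a _ b _ ha hb => exact add _ _ ha hb
  exact tensorPow_induction key add x

theorem tensorAlgebra_induction_left {P : TensorAlgebra R V → Prop}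
    (one : P 1) (add : ∀ x y, P x → P y → P (x + y)) (smul : ∀ (r : R) x, P x → P (r • x))
    (mul : ∀ v x, P x → P (TensorAlgebra.ι R v * x)) (x : TensorAlgebra R V) : P x := by
  have key : ∀ n, ∀ x ∈ tensorPow R V n, P x := by
    intro n
    induction n with
    | zero =>
      intro x hx
      obtain ⟨r, rfl⟩ := mem_tensorPow_zero hx
      rw [Algebra.algebraMap_eq_smul_one]
      exact smul _ _ one
    | succ n ih =>
      intro x hx
      rw [tensorPow, pow_succ'] at hx
      induction hx using Submodule.mul_induction_on' with
      | mem_mul_mem a ha b hb =>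
        obtain ⟨v, rfl⟩ := ha
        exact mul _ _ (ih _ hb)
      | add a _ b _ ha hb => exact add _ _ ha hb
  exact tensorPow_induction key add x

theorem skewLift_fst (x : TensorAlgebra R V) :
    ((skewLift φ J A x).unop (1, 0)).1 = x := by
  induction x using tensorAlgebra_induction_right with
  | one => simp
  | add x y hx hy => simp [hx, hy]
  | smul r x hx => simp [hx]
  | mul x v hx =>
    rw [skewLift_mul_ι]
    change ((skewLift φ J A x).unop (1, 0)).1 * _ = _
    rw [hx]

theorem skewD_mul_ι (i : I) (x : TensorAlgebra R V) (v : V) :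
    skewD φ J A i (x * TensorAlgebra.ι R v) =
      φ i v • x + ∑ k, skewD φ J A (J i k) x * TensorAlgebra.ι R (A i k v) := by
  rw [skewD_apply, skewLift_mul_ι]
  change φ i v • ((skewLift φ J A x).unop (1, 0)).1 + _ = _
  rw [skewLift_fst]
  rfl

theorem skewD_one (i : I) : skewD φ J A i 1 = 0 := by
  rw [skewD_apply, map_one]; rfl

theorem skewD_ι (i : I) (v : V) :
    skewD φ J A i (TensorAlgebra.ι R v) = algebraMap R _ (φ i v) := by
  have := skewD_mul_ι φ J A i 1 v
  simpa [skewD_one, Algebra.algebraMap_eq_smul_one] using this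

theorem skewD_lowering : Lowering (skewD φ J A) where
  one := skewD_one φ J A
  pow i n x hx := by
    induction n generalizing i x with
    | zero =>
      rw [tensorPow, zero_add, pow_one] at hx
      obtain ⟨v, rfl⟩ := hx
      rw [skewD_ι, tensorPow, pow_zero, Submodule.mem_one]
      exact ⟨_, rfl⟩
    | succ n ih =>
      rw [tensorPow, pow_succ] at hx
      induction hx using Submodule.mul_induction_on' with
      | mem_mul_mem a ha b hb =>
        obtain ⟨v, rfl⟩ := hb
        rw [skewD_mul_ι]
        refine Submodule.add_mem _ (Submodule.smul_mem _ _ ha) (Submodule.sum_mem _ fun k _ => ?_)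
        rw [tensorPow, pow_succ]
        exact Submodule.mul_mem_mul (ih _ _ ha) ⟨_, rfl⟩
      | add a _ b _ ha hb => rw [map_add]; exact Submodule.add_mem _ ha hb

/-- One step of the recursion that defines `coskewD`. -/
def coskewStep (φ : V →ₗ[R] R) (A : V →ₗ[R] V) :
    V →ₗ[R] Module.End R (TensorAlgebra R V × TensorAlgebra R V) :=
  LinearMap.mk₂ R (fun v p => (TensorAlgebra.ι R v * p.1,
      φ v • p.1 + TensorAlgebra.ι R (A v) * p.2))
    (fun v w p => by ext1 <;> simp [add_mul, add_smul]; abel)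
    (fun r v p => by ext1 <;> simp [mul_smul])
    (fun v p q => by ext1 <;> simp [mul_add]; abel)
    (fun r v p => by ext1 <;> simp [smul_comm r])

/-- The operator with `E 1 = 0` and `E (v x) = φ v • x + A v * E x` for `v ∈ V`. -/
def coskewD (φ : V →ₗ[R] R) (A : V →ₗ[R] V) : TensorAlgebra R V →ₗ[R] TensorAlgebra R V :=
  LinearMap.snd R _ _ ∘ₗ LinearMap.applyₗ (1, 0) ∘ₗ
    (TensorAlgebra.lift R (coskewStep φ A)).toLinearMap

theorem coskewD_one (φ : V →ₗ[R] R) (A : V →ₗ[R] V) : coskewD φ A 1 = 0 := by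
  simp [coskewD]

theorem coskewD_ι_mul (φ : V →ₗ[R] R) (A : V →ₗ[R] V) (v : V) (x : TensorAlgebra R V) :
    coskewD φ A (TensorAlgebra.ι R v * x) =
      φ v • x + TensorAlgebra.ι R (A v) * coskewD φ A x := by
  have fst : ∀ x : TensorAlgebra R V,
      (TensorAlgebra.lift R (coskewStep φ A) x (1, 0)).1 = x := by
    intro x
    induction x using tensorAlgebra_induction_left with
    | one => simp
    | add x y hx hy => simp [hx, hy]
    | smul r x hx => simp [hx]
    | mul v x hx =>
      rw [map_mul, Module.End.mul_apply, TensorAlgebra.lift_ι_apply]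
      change _ * (TensorAlgebra.lift R (coskewStep φ A) x (1, 0)).1 = _
      rw [hx]
  change (TensorAlgebra.lift R (coskewStep φ A) (_ * x) (1, 0)).2 = _
  rw [map_mul, Module.End.mul_apply, TensorAlgebra.lift_ι_apply]
  change φ v • (TensorAlgebra.lift R (coskewStep φ A) x (1, 0)).1 + _ = _
  rw [fst]
  rfl

theorem coskewD_ι (φ : V →ₗ[R] R) (A : V →ₗ[R] V) (v : V) :
    coskewD φ A (TensorAlgebra.ι R v) = algebraMap R _ (φ v) := by
  have := coskewD_ι_mul φ A v 1
  simpa [coskewD_one, Algebra.algebraMap_eq_smul_one] using this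

theorem coskewD_lowering (φ : I → V →ₗ[R] R) (A : I → V →ₗ[R] V) :
    Lowering (fun i => coskewD (φ i) (A i)) where
  one i := coskewD_one _ _
  pow i n x hx := by
    induction n generalizing x with
    | zero =>
      rw [tensorPow, zero_add, pow_one] at hx
      obtain ⟨v, rfl⟩ := hx
      rw [coskewD_ι, tensorPow, pow_zero, Submodule.mem_one]
      exact ⟨_, rfl⟩
    | succ n ih =>
      rw [tensorPow, pow_succ'] at hx
      induction hx using Submodule.mul_induction_on' with
      | mem_mul_mem a ha b hb =>
        obtain ⟨v, rfl⟩ := ha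
        rw [coskewD_ι_mul]
        refine Submodule.add_mem _ (Submodule.smul_mem _ _ hb) ?_
        rw [tensorPow, pow_succ']
        exact Submodule.mul_mem_mul ⟨_, rfl⟩ (ih _ hb)
      | add a _ b _ ha hb => rw [map_add]; exact Submodule.add_mem _ ha hb

end Skew

/-! ### Nichols algebras and skew derivations -/

section Nichols

variable {R V I K : Type*} [CommRing R] [AddCommGroup V] [Module R V] [Fintype K]

/-- The contraction `t ⊗ v ↦ φ v • t`. -/
def contr (T : Type*) [AddCommGroup T] [Module R T] (φ : V →ₗ[R] R) : T ⊗[R] V →ₗ[R] T :=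
  (TensorProduct.rid R T).toLinearMap ∘ₗ φ.lTensor T

@[simp]
theorem contr_tmul {T : Type*} [AddCommGroup T] [Module R T] (φ : V →ₗ[R] R) (t : T) (v : V) :
    contr T φ (t ⊗ₜ v) = φ v • t := by
  simp [contr]

theorem contr_rTensor {T T' : Type*} [AddCommGroup T] [Module R T] [AddCommGroup T'] [Module R T']
    (φ : V →ₗ[R] R) (a : T →ₗ[R] T') (z : T ⊗[R] V) :
    contr T' φ (a.rTensor V z) = a (contr T φ z) := by
  induction z with
  | zero => simp
  | tmul t v => simp
  | add x y hx hy => simp [hx, hy]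

/-- The coefficients of `z` in the basis `b` of the right factor are contractions with the `b.coord
k`, which are combinations of the `φ i`. -/
theorem eq_zero_of_contr {κ T : Type*} [AddCommGroup T] [Module R T] (b : Module.Basis κ R V)
    (φ : I → V →ₗ[R] R) (hb : ∀ k, b.coord k ∈ Submodule.span R (Set.range φ)) (z : T ⊗[R] V)
    (hz : ∀ i, contr T (φ i) z = 0) : z = 0 := by
  classical
  have key : ∀ ψ ∈ Submodule.span R (Set.range φ), contr T ψ z = 0 := by
    intro ψ hψ
    induction hψ using Submodule.span_induction with
    | mem ψ h => obtain ⟨i, rfl⟩ := h; exact hz i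
    | zero => simp [contr]
    | add a b _ _ ha hb =>
      simp only [contr, LinearMap.comp_apply, LinearMap.lTensor_add, LinearMap.add_apply,
        map_add] at ha hb ⊢
      rw [ha, hb, add_zero]
    | smul r a _ ha =>
      simp only [contr, LinearMap.comp_apply, LinearMap.lTensor_smul, LinearMap.smul_apply,
        map_smul] at ha ⊢
      rw [ha, smul_zero]
  apply (TensorProduct.equivFinsuppOfBasisRight (M := T) b).injective
  ext k
  rw [TensorProduct.equivFinsuppOfBasisRight_apply, map_zero]
  exact key _ (hb k)

theorem toTensorAlgebra_tensorSnoc {n : ℕ} (t : ⨂[R]^n V) (v : V) :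
    TensorPower.toTensorAlgebra (tensorSnoc R V n (t ⊗ₜ v)) =
      TensorPower.toTensorAlgebra t * TensorAlgebra.ι R v := by
  have := TensorPower.toTensorAlgebra_gMul t
    ((PiTensorProduct.subsingletonEquiv (R := R) (s := fun _ : Fin 1 => V) 0).symm v)
  refine this.trans ?_
  congr 1
  rw [PiTensorProduct.subsingletonEquiv_symm_apply' (0 : Fin 1)]
  erw [TensorPower.toTensorAlgebra_tprod]
  simp [TensorAlgebra.tprod_apply]

theorem toTensorAlgebra_zero (t : ⨂[R]^0 V) :
    ∃ r, TensorPower.toTensorAlgebra t = algebraMap R (TensorAlgebra R V) r := by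
  refine ⟨PiTensorProduct.isEmptyEquiv (Fin 0) t, ?_⟩
  obtain ⟨r, rfl⟩ := (PiTensorProduct.isEmptyEquiv (R := R) (s := fun _ : Fin 0 => V)
    (Fin 0)).symm.surjective t
  rw [LinearEquiv.apply_symm_apply]
  simp [PiTensorProduct.isEmptyEquiv, Algebra.algebraMap_eq_smul_one, TensorAlgebra.tprod_apply]

theorem toTensorAlgebra_mem_tensorPow {n : ℕ} (t : ⨂[R]^n V) :
    TensorPower.toTensorAlgebra t ∈ tensorPow R V n := by
  induction n with
  | zero =>
    obtain ⟨r, hr⟩ := toTensorAlgebra_zero t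
    rw [hr, tensorPow, pow_zero, Submodule.mem_one]
    exact ⟨r, rfl⟩
  | succ n ih =>
    obtain ⟨z, rfl⟩ := (tensorSnoc R V n).surjective t
    induction z with
    | zero => simp
    | tmul t v =>
      rw [toTensorAlgebra_tensorSnoc, tensorPow, pow_succ]
      exact Submodule.mul_mem_mul (ih t) ⟨v, rfl⟩
    | add x y hx hy => rw [map_add, map_add]; exact Submodule.add_mem _ hx hy

variable (Ψ : V ⊗[R] V →ₗ[R] V ⊗[R] V) (φ : I → V →ₗ[R] R) (J : I → K → I)
  (A : I → K → V →ₗ[R] V)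

theorem tensorSnoc_symm_lastBraid {n : ℕ} (t : ⨂[R]^n V) (w v : V) :
    (tensorSnoc R V (n + 1)).symm
        (lastBraid Ψ n (tensorSnoc R V (n + 1) (tensorSnoc R V n (t ⊗ₜ w) ⊗ₜ v))) =
      (tensorSnoc R V n).toLinearMap.rTensor V
        ((TensorProduct.assoc R _ V V).symm (t ⊗ₜ Ψ (w ⊗ₜ v))) := by
  simp [lastBraid, LinearEquiv.conj_apply]
  rfl

theorem tensorSnoc_symm_tensorId {n : ℕ} (T : (⨂[R]^n V) →ₗ[R] ⨂[R]^n V) (x : ⨂[R]^(n + 1) V) :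
    (tensorSnoc R V n).symm (tensorId T x) = T.rTensor V ((tensorSnoc R V n).symm x) := by
  simp [tensorId, LinearEquiv.conj_apply]

theorem contr_assoc_symm {n : ℕ} (f : V →ₗ[R] R) (t : ⨂[R]^n V) (z : V ⊗[R] V) :
    contr _ f ((tensorSnoc R V n).toLinearMap.rTensor V
      ((TensorProduct.assoc R _ V V).symm (t ⊗ₜ z))) = tensorSnoc R V n (t ⊗ₜ contr V f z) := by
  induction z with
  | zero => simp
  | tmul a b => simp
  | add x y hx hy => simp [TensorProduct.tmul_add, hx, hy]

variable (h : ∀ i w v, contr V (φ i) (Ψ (w ⊗ₜ v)) = ∑ k, φ (J i k) w • A i k v)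

include h

/-- Both sides obey the same recursion. On `y ⊗ v`, the summand `id` of the braided integer
contributes `φ i v • y`. In the other summand, `h` carries the contraction across `Ψ` and turns it
into contractions of the shorter braided integer with the `φ (J i k)`, leaving the letters `A i k v`
on the right. -/
theorem toTensorAlgebra_contr_braidedInt (n : ℕ) (i : I) (x : ⨂[R]^(n + 1) V) :
    TensorPower.toTensorAlgebra
        (contr _ (φ i) ((tensorSnoc R V n).symm (braidedInt Ψ (n + 1) x))) =
      skewD φ J A i (TensorPower.toTensorAlgebra x) := by
  induction n generalizing i with
  | zero =>
    obtain ⟨z, rfl⟩ := (tensorSnoc R V 0).surjective x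
    induction z with
    | zero => simp
    | tmul t v =>
      obtain ⟨r, hr⟩ := toTensorAlgebra_zero t
      rw [toTensorAlgebra_tensorSnoc, skewD_mul_ι, hr]
      simp [braidedInt, hr, (skewD_lowering φ J A).map_algebraMap]
    | add x y hx hy => simp only [map_add, hx, hy]
  | succ n ih =>
    obtain ⟨z, rfl⟩ := (tensorSnoc R V (n + 1)).surjective x
    induction z with
    | zero => simp
    | tmul y v =>
      rw [toTensorAlgebra_tensorSnoc, skewD_mul_ι, braidedInt]
      simp only [LinearMap.add_apply, LinearMap.id_apply, map_add, LinearMap.comp_apply,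
        LinearEquiv.symm_apply_apply, contr_tmul, map_smul]
      congr 1
      have e : tensorId (braidedInt Ψ (n + 1)) (tensorSnoc R V (n + 1) (y ⊗ₜ v)) =
          tensorSnoc R V (n + 1) (braidedInt Ψ (n + 1) y ⊗ₜ v) := by
        simp [tensorId, LinearEquiv.conj_apply]
      rw [e]
      simp only [← ih]
      obtain ⟨z, hz⟩ := (tensorSnoc R V n).surjective (braidedInt Ψ (n + 1) y)
      rw [← hz]
      clear hz e
      induction z with
      | zero => simp
      | tmul t w =>
        rw [tensorSnoc_symm_lastBraid, contr_assoc_symm, h, TensorProduct.tmul_sum, map_sum,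
          map_sum]
        refine Finset.sum_congr rfl fun k _ => ?_
        simp [toTensorAlgebra_tensorSnoc]
      | add a b ha hb =>
        simp only [map_add, TensorProduct.add_tmul, ha, hb, add_mul, Finset.sum_add_distrib]
    | add x y hx hy => simp only [map_add, hx, hy]

variable {κ : Type*} (b : Module.Basis κ R V)
  (hb : ∀ k, b.coord k ∈ Submodule.span R (Set.range φ))

include hb

/-- By `hb`, a tensor in `V^{⊗n} ⊗ V` vanishes when all its contractions with the `φ i` do. Those of
`([n]! ⊗ id) [n+1] x` are `[n]!` applied to the derivatives of `x`, so the kernels satisfy the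
recursion that defines the radical. -/
theorem braidedFactorial_eq_zero_iff (n : ℕ) (x : ⨂[R]^n V) :
    braidedFactorial Ψ n x = 0 ↔ TensorPower.toTensorAlgebra x ∈ radical (skewD φ J A) := by
  induction n with
  | zero =>
    obtain ⟨r, rfl⟩ := (PiTensorProduct.isEmptyEquiv (R := R) (s := fun _ : Fin 0 => V)
      (Fin 0)).symm.surjective x
    have e : TensorPower.toTensorAlgebra ((PiTensorProduct.isEmptyEquiv (R := R)
        (s := fun _ : Fin 0 => V) (Fin 0)).symm r) = algebraMap R (TensorAlgebra R V) r := by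
      simp [PiTensorProduct.isEmptyEquiv, Algebra.algebraMap_eq_smul_one,
        TensorAlgebra.tprod_apply]
    rw [e, braidedFactorial, LinearMap.id_apply, LinearEquiv.map_eq_zero_iff]
    constructor
    · rintro rfl
      rw [map_zero]; exact Submodule.zero_mem _
    · intro hr
      simpa using algebraMapInv_of_mem_radical hr
  | succ n ih =>
    rw [braidedFactorial, LinearMap.comp_apply,
      ← LinearEquiv.map_eq_zero_iff (tensorSnoc R V n).symm, tensorSnoc_symm_tensorId]
    constructor
    · intro hx
      refine mem_radical_of_forall
        (algebraMapInv_of_mem_tensorPow_succ (toTensorAlgebra_mem_tensorPow x)) fun i => ?_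
      rw [← toTensorAlgebra_contr_braidedInt Ψ φ J A h, ← ih, ← contr_rTensor, hx, map_zero]
    · intro hx
      refine eq_zero_of_contr b φ hb _ fun i => ?_
      rw [contr_rTensor, ih, toTensorAlgebra_contr_braidedInt Ψ φ J A h]
      exact map_mem_radical hx i

/-- An algebra map from `T(V)` with kernel `radical (skewD φ J A)` induces an embedding of the
Nichols algebra. -/
theorem exists_nichols_embedding {H : Type*} [Ring H] [Algebra R H] (N : TensorAlgebra R V →ₐ[R] H)
    (hN : ∀ x, N x = 0 ↔ x ∈ radical (skewD φ J A)) :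
    ∃ im : Nichols Ψ →ₐ[R] H, (∀ v, im (Nichols.ι Ψ v) = N (TensorAlgebra.ι R v)) ∧
      Function.Injective im ∧ im.range = N.range := by
  have hrel : ∀ ⦃x y⦄, NicholsRel Ψ x y → N x = N y := by
    rintro _ _ ⟨n, x, hx⟩
    rw [map_zero, hN]
    exact (braidedFactorial_eq_zero_iff Ψ φ J A h b hb n x).1 hx
  let im : Nichols Ψ →ₐ[R] H := RingQuot.liftAlgHom R ⟨N, hrel⟩
  have him : ∀ x, im (RingQuot.mkAlgHom R (NicholsRel Ψ) x) = N x := fun x =>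
    RingQuot.liftAlgHom_mkAlgHom_apply R _ _ x
  refine ⟨im, fun v => him _, ?_, ?_⟩
  · rw [injective_iff_map_eq_zero]
    intro a ha
    obtain ⟨x, rfl⟩ := RingQuot.mkAlgHom_surjective R (NicholsRel Ψ) a
    have hx : x ∈ radical (skewD φ J A) := (hN x).1 ((him x).symm.trans ha)
    classical
    -- The relations of the Nichols algebra are homogeneous, so `x` is split into components; each
    -- is again in the radical and hence a relation.
    rw [← DirectSum.sum_support_decompose (tensorPow R V) x, map_sum]
    refine Finset.sum_eq_zero fun n _ => ?_
    have hxn := (skewD_lowering φ J A).decompose_mem_radical hx n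
    obtain ⟨t, ht⟩ : ∃ t : ⨂[R]^n V, TensorPower.toTensorAlgebra t =
        (DirectSum.decompose (tensorPow R V) x n : TensorAlgebra R V) := by
      have : ∀ n, tensorPow R V n ≤ LinearMap.range
          (TensorPower.toTensorAlgebra : (⨂[R]^n V) →ₗ[R] TensorAlgebra R V) := by
        intro n
        induction n with
        | zero =>
          intro y hy
          obtain ⟨r, rfl⟩ := mem_tensorPow_zero hy
          refine ⟨r • PiTensorProduct.tprod R Fin.elim0, ?_⟩
          rw [map_smul, TensorPower.toTensorAlgebra_tprod]
          simp [TensorAlgebra.tprod_apply, Algebra.algebraMap_eq_smul_one]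
        | succ n ih =>
          rw [tensorPow, pow_succ, Submodule.mul_le]
          rintro y hy _ ⟨v, rfl⟩
          obtain ⟨t, rfl⟩ := ih hy
          exact ⟨_, toTensorAlgebra_tensorSnoc t v⟩
      exact this n (SetLike.coe_mem _)
    rw [← ht] at hxn ⊢
    have := RingQuot.mkAlgHom_rel R
      (NicholsRel.of_ker n t ((braidedFactorial_eq_zero_iff Ψ φ J A h b hb n t).2 hxn))
    rwa [map_zero] at this
  · ext z
    constructor
    · rintro ⟨a, rfl⟩
      obtain ⟨x, rfl⟩ := RingQuot.mkAlgHom_surjective R (NicholsRel Ψ) a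
      exact ⟨x, (him x).symm⟩
    · rintro ⟨x, rfl⟩
      exact ⟨_, him x⟩

end Nichols

section Skew

variable {R G V W : Type*} [CommRing R] [Group G] [AddCommGroup V] [Module R V]

/-! ### Skew derivations and group actions -/

/-- The action of `G` on `T(V)` by algebra automorphisms. -/
def tensorAct (ρ : Representation R G V) (g : G) : TensorAlgebra R V →ₐ[R] TensorAlgebra R V :=
  TensorAlgebra.lift R (TensorAlgebra.ι R ∘ₗ ρ g)

@[simp]
theorem tensorAct_ι (ρ : Representation R G V) (g : G) (v : V) :
    tensorAct ρ g (TensorAlgebra.ι R v) = TensorAlgebra.ι R (ρ g v) := by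
  simp [tensorAct]

theorem tensorAct_mul (ρ : Representation R G V) (g h : G) (x : TensorAlgebra R V) :
    tensorAct ρ (g * h) x = tensorAct ρ g (tensorAct ρ h x) := by
  have : tensorAct ρ (g * h) = (tensorAct ρ g).comp (tensorAct ρ h) := by ext v; simp
  rw [this]; rfl

theorem tensorAct_one (ρ : Representation R G V) (x : TensorAlgebra R V) :
    tensorAct ρ 1 x = x := by
  have : tensorAct ρ 1 = AlgHom.id R _ := by ext v; simp
  rw [this]; rfl

theorem algebraMapInv_tensorAct (ρ : Representation R G V) (g : G) (x : TensorAlgebra R V) :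
    TensorAlgebra.algebraMapInv (tensorAct ρ g x) = TensorAlgebra.algebraMapInv x := by
  have : (TensorAlgebra.algebraMapInv (R := R) (M := V)).comp (tensorAct ρ g) =
      TensorAlgebra.algebraMapInv := by
    ext v; simp [TensorAlgebra.algebraMapInv]
  exact congrArg (fun a => a x) this

/-- Compatibility of a family of operators on `T(V)` with the product and the action of `G`. -/
structure IsSkewLeibniz {I : Type*} (ρ : Representation R G V)
    (D : I → TensorAlgebra R V →ₗ[R] TensorAlgebra R V) : Prop where
  leibniz : ∀ i, ∃ g h, ∀ x y, D i (x * y) = tensorAct ρ g x * D i y + D i x * tensorAct ρ h y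
  equivariant : ∀ i g, ∃ j, ∀ x, D i (tensorAct ρ g x) = tensorAct ρ g (D j x)

namespace IsSkewLeibniz

variable {I : Type*} {ρ : Representation R G V}
  {D : I → TensorAlgebra R V →ₗ[R] TensorAlgebra R V}

/-- The translate of the radical by `g` is stable by equivariance, and `g` preserves constant terms.
-/
theorem tensorAct_mem_radical (hD : IsSkewLeibniz ρ D) (g : G) {x : TensorAlgebra R V}
    (hx : x ∈ radical D) : tensorAct ρ g x ∈ radical D := by
  refine le_radical (S := (radical D).map (tensorAct ρ g).toLinearMap) ?_ ?_ ⟨x, hx, rfl⟩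
  · rintro _ ⟨y, hy, rfl⟩
    exact (algebraMapInv_tensorAct ρ g y).trans (algebraMapInv_of_mem_radical hy)
  · rintro i _ ⟨y, hy, rfl⟩
    obtain ⟨j, hj⟩ := hD.equivariant i g
    exact ⟨D j y, map_mem_radical hy j, (hj y).symm⟩

/-- The span of all `a x b` with `x` in the radical is stable: the Leibniz rule, applied twice,
differentiates `a`, `x` or `b` and translates the other factors by group elements, which preserve
the radical. Twists on both sides are allowed so that `negD` and `posE` are covered together. -/
theorem mul_mul_mem_radical (hD : IsSkewLeibniz ρ D) (a b : TensorAlgebra R V)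
    {x : TensorAlgebra R V} (hx : x ∈ radical D) : a * x * b ∈ radical D := by
  refine le_radical
    (S := Submodule.span R {z | ∃ a b, ∃ x ∈ radical D, z = a * x * b}) ?_ ?_
    (Submodule.subset_span ⟨a, b, x, hx, rfl⟩)
  · intro z hz
    induction hz using Submodule.span_induction with
    | mem z h =>
      obtain ⟨a, b, x, hx, rfl⟩ := h
      simp [algebraMapInv_of_mem_radical hx]
    | zero => simp
    | add a b _ _ ha hb => simp [ha, hb]
    | smul r a _ ha => simp [ha]
  · intro i z hz
    induction hz using Submodule.span_induction with
    | mem z h =>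
      obtain ⟨a, b, x, hx, rfl⟩ := h
      obtain ⟨g, h, hgh⟩ := hD.leibniz i
      rw [hgh, hgh, map_mul, add_mul]
      refine Submodule.add_mem _ ?_ (Submodule.add_mem _ ?_ ?_) <;> refine Submodule.subset_span ?_
      · exact ⟨_, _, _, hD.tensorAct_mem_radical g hx, rfl⟩
      · exact ⟨_, _, _, map_mem_radical hx i, rfl⟩
      · exact ⟨_, _, _, hD.tensorAct_mem_radical h hx, rfl⟩
    | zero => simp
    | add a b _ _ ha hb => rw [map_add]; exact Submodule.add_mem _ ha hb
    | smul r a _ ha => rw [map_smul]; exact Submodule.smul_mem _ _ ha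

theorem mul_mem_radical_left (hD : IsSkewLeibniz ρ D) (a : TensorAlgebra R V)
    {x : TensorAlgebra R V} (hx : x ∈ radical D) : a * x ∈ radical D := by
  simpa using hD.mul_mul_mem_radical a 1 hx

theorem mul_mem_radical_right (hD : IsSkewLeibniz ρ D) (a : TensorAlgebra R V)
    {x : TensorAlgebra R V} (hx : x ∈ radical D) : x * a ∈ radical D := by
  simpa using hD.mul_mul_mem_radical 1 a hx

/-- The radical as a two-sided ideal. -/
def ideal (hD : IsSkewLeibniz ρ D) : TwoSidedIdeal (TensorAlgebra R V) :=
  TwoSidedIdeal.mk' (radical D : Set (TensorAlgebra R V)) (Submodule.zero_mem _)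
    (fun ha hb => Submodule.add_mem _ ha hb) (fun ha => Submodule.neg_mem _ ha)
    (fun {a _} hx => hD.mul_mem_radical_left a hx)
    (fun {_ a} hx => hD.mul_mem_radical_right a hx)

theorem mem_ideal (hD : IsSkewLeibniz ρ D) {x : TensorAlgebra R V} :
    x ∈ hD.ideal ↔ x ∈ radical D :=
  TwoSidedIdeal.mem_mk' _ _ _ _ _ _ _

end IsSkewLeibniz

theorem coskewD_mul (φ : V →ₗ[R] R) (A : V →ₗ[R] V) (x y : TensorAlgebra R V) :
    coskewD φ A (x * y) = TensorAlgebra.lift R (TensorAlgebra.ι R ∘ₗ A) x * coskewD φ A y +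
      coskewD φ A x * y := by
  induction x using tensorAlgebra_induction_left with
  | one => simp [coskewD_one]
  | add a b ha hb => simp only [add_mul, map_add, ha, hb]; abel
  | smul r a ha => simp only [smul_mul_assoc, map_smul, ha, smul_add]
  | mul v a ha =>
    rw [mul_assoc, coskewD_ι_mul, coskewD_ι_mul, ha, map_mul]
    simp [mul_add, add_mul, mul_assoc]; abel

variable [DecidableEq G] (𝒱 : YDMod R G V)

/-- The operators `D` with `D 1 = 0` and `D (x v) = ⟨f, v_g⟩ x + D x * (g ▷ v)`, for the
functional `f` with index `i.1` and `g = i.2`. -/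
def negD (F : W → V →ₗ[R] R) : W × G → TensorAlgebra R V →ₗ[R] TensorAlgebra R V :=
  skewD (fun i => F i.1 ∘ₗ 𝒱.proj i.2) (fun i (_ : Unit) => i) (fun i _ => 𝒱.act i.2)

/-- The operators `E` with `E 1 = 0` and `E (v x) = ⟨f, v⟩ x + (g⁻¹ ▷ v) * E x`, for the
functional `f` with index `i` and `g = i.2`. -/
def posE (F : W × G → V →ₗ[R] R) (i : W × G) : TensorAlgebra R V →ₗ[R] TensorAlgebra R V :=
  coskewD (F i) (𝒱.act i.2⁻¹)

/-- The operators `D` with `D w 1 = 0` and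
`D w (x v) = ⟨w, v⟩ x + ∑ h, D (h⁻¹ ▷ w) x * v_h`. -/
def posD [Fintype G] (F : W → V →ₗ[R] R) (a : G → W → W) :
    W → TensorAlgebra R V →ₗ[R] TensorAlgebra R V :=
  skewD F (fun w h => a h⁻¹ w) (fun _ h => 𝒱.proj h)

theorem negD_mul_ι (F : W → V →ₗ[R] R) (i : W × G) (x : TensorAlgebra R V) (v : V) :
    negD 𝒱 F i (x * TensorAlgebra.ι R v) = F i.1 (𝒱.proj i.2 v) • x +
      negD 𝒱 F i x * TensorAlgebra.ι R (𝒱.act i.2 v) := by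
  simp [negD, skewD_mul_ι]

theorem negD_mul (F : W → V →ₗ[R] R) (i : W × G) (x y : TensorAlgebra R V) :
    negD 𝒱 F i (x * y) = x * negD 𝒱 F i y + negD 𝒱 F i x * tensorAct 𝒱.act i.2 y := by
  induction y using tensorAlgebra_induction_right with
  | one => simp [negD, skewD_one]
  | add a b ha hb => simp only [mul_add, map_add, ha, hb]; abel
  | smul r a ha => simp only [mul_smul_comm, map_smul, ha, smul_add]
  | mul a v ha =>
    rw [← mul_assoc, negD_mul_ι, negD_mul_ι, ha, map_mul]
    simp [mul_add, add_mul, mul_assoc]; abel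

theorem negD_one (F : W → V →ₗ[R] R) (i : W × G) : negD 𝒱 F i 1 = 0 := skewD_one _ _ _ _

theorem negD_ι (F : W → V →ₗ[R] R) (i : W × G) (v : V) :
    negD 𝒱 F i (TensorAlgebra.ι R v) = algebraMap R _ (F i.1 (𝒱.proj i.2 v)) :=
  skewD_ι _ _ _ _ _

theorem negD_lowering (F : W → V →ₗ[R] R) : Lowering (negD 𝒱 F) := skewD_lowering _ _ _

theorem proj_act [Fintype G] (g h : G) (v : V) :
    𝒱.proj (g * h * g⁻¹) (𝒱.act g v) = 𝒱.act g (𝒱.proj h v) := by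
  have : 𝒱.proj (g * h * g⁻¹) ∘ₗ 𝒱.act g = 𝒱.act g ∘ₗ 𝒱.proj h := by
    refine 𝒱.ext_hom fun k v hv => ?_
    by_cases hk : k = h
    · subst hk
      simp [𝒱.proj_of_mem hv, 𝒱.proj_of_mem (𝒱.act_mem g k v hv)]
    · have hk' : g * k * g⁻¹ ≠ g * h * g⁻¹ := by simpa using hk
      simp [𝒱.proj_of_mem_ne hk hv, 𝒱.proj_of_mem_ne hk' (𝒱.act_mem g k v hv)]
  exact congrArg (fun a => a v) this

/-- Transport of structure: the pairing is invariant and `g` carries the component of degree `k` to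
that of degree `g k g⁻¹`. -/
theorem negD_tensorAct [Fintype G] (F : W → V →ₗ[R] R) (a : G → W → W)
    (hF : ∀ g w v, F (a g w) (𝒱.act g v) = F w v) (g : G) (w : W) (k : G)
    (x : TensorAlgebra R V) :
    negD 𝒱 F (a g w, g * k * g⁻¹) (tensorAct 𝒱.act g x) =
      tensorAct 𝒱.act g (negD 𝒱 F (w, k) x) := by
  induction x using tensorAlgebra_induction_right with
  | one => simp [negD_one]
  | add a b ha hb => simp only [map_add, ha, hb]
  | smul r a ha => simp only [map_smul, ha]
  | mul x v hx =>
    have e : 𝒱.act (g * k * g⁻¹) (𝒱.act g v) = 𝒱.act g (𝒱.act k v) := by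
      rw [← Module.End.mul_apply, ← Module.End.mul_apply, ← map_mul, ← map_mul,
        inv_mul_cancel_right]
    rw [map_mul, tensorAct_ι, negD_mul_ι, negD_mul_ι, hx, map_add, map_smul,
      map_mul (tensorAct 𝒱.act g), tensorAct_ι]
    simp only
    rw [proj_act, hF, e]

theorem negD_isSkewLeibniz [Fintype G] (F : W → V →ₗ[R] R) (a : G → W → W)
    (hF : ∀ g w v, F (a g w) (𝒱.act g v) = F w v) (ha : ∀ g w, a g (a g⁻¹ w) = w) :
    IsSkewLeibniz 𝒱.act (negD 𝒱 F) where
  leibniz i := ⟨1, i.2, fun x y => by rw [negD_mul, tensorAct_one]⟩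
  equivariant i g := ⟨(a g⁻¹ i.1, g⁻¹ * i.2 * g), fun x => by
    rw [← negD_tensorAct 𝒱 F a hF, ha]
    congr 1
    congr 1
    ext1
    · rfl
    · simp only; group⟩

/-- The compatibility of braiding and derivations needed for the Nichols algebra of `𝒱`. Projecting
the last factor of `∑ g, (g ▷ v) ⊗ w_g` selects one `g`, so a one-element index set `K` is enough.
-/
theorem negD_braiding [Fintype G] (F : W → V →ₗ[R] R) (i : W × G) (w v : V) :
    contr V (F i.1 ∘ₗ 𝒱.proj i.2) (𝒱.braiding (w ⊗ₜ v)) =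
      F i.1 (𝒱.proj i.2 w) • 𝒱.act i.2 v := by
  simp only [YDMod.braiding, LinearMap.sum_apply, map_sum]
  rw [Finset.sum_eq_single i.2]
  · simp [𝒱.proj_of_mem (𝒱.proj_mem _ w)]
  · intro h _ hne
    simp [𝒱.proj_of_mem_ne hne (𝒱.proj_mem _ w)]
  · simp

theorem posE_one (F : W × G → V →ₗ[R] R) (i : W × G) : posE 𝒱 F i 1 = 0 := coskewD_one _ _

theorem posE_ι (F : W × G → V →ₗ[R] R) (i : W × G) (v : V) :
    posE 𝒱 F i (TensorAlgebra.ι R v) = algebraMap R _ (F i v) := coskewD_ι _ _ _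

theorem posE_ι_mul (F : W × G → V →ₗ[R] R) (i : W × G) (v : V) (x : TensorAlgebra R V) :
    posE 𝒱 F i (TensorAlgebra.ι R v * x) =
      F i v • x + TensorAlgebra.ι R (𝒱.act i.2⁻¹ v) * posE 𝒱 F i x := coskewD_ι_mul _ _ _ _

theorem posE_mul (F : W × G → V →ₗ[R] R) (i : W × G) (x y : TensorAlgebra R V) :
    posE 𝒱 F i (x * y) = tensorAct 𝒱.act i.2⁻¹ x * posE 𝒱 F i y + posE 𝒱 F i x * y :=
  coskewD_mul _ _ _ _

theorem posE_lowering (F : W × G → V →ₗ[R] R) : Lowering (posE 𝒱 F) := coskewD_lowering _ _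

theorem posE_tensorAct (F : W × G → V →ₗ[R] R) (a : G → W → W)
    (hF : ∀ g w k v, F (a g w, g * k * g⁻¹) (𝒱.act g v) = F (w, k) v) (g : G) (w : W) (k : G)
    (x : TensorAlgebra R V) :
    posE 𝒱 F (a g w, g * k * g⁻¹) (tensorAct 𝒱.act g x) =
      tensorAct 𝒱.act g (posE 𝒱 F (w, k) x) := by
  induction x using tensorAlgebra_induction_left with
  | one => simp [posE_one]
  | add a b ha hb => simp only [map_add, ha, hb]
  | smul r a ha => simp only [map_smul, ha]
  | mul v x hx =>
    rw [map_mul, tensorAct_ι, posE_ι_mul, posE_ι_mul, hx, map_add, map_smul, map_mul, tensorAct_ι,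
      hF, ← Module.End.mul_apply, ← Module.End.mul_apply, ← map_mul, ← map_mul]
    congr 5
    simp only; group

theorem posE_isSkewLeibniz (F : W × G → V →ₗ[R] R) (a : G → W → W)
    (hF : ∀ g w k v, F (a g w, g * k * g⁻¹) (𝒱.act g v) = F (w, k) v)
    (ha : ∀ g w, a g (a g⁻¹ w) = w) : IsSkewLeibniz 𝒱.act (posE 𝒱 F) where
  leibniz i := ⟨i.2⁻¹, 1, fun x y => by rw [posE_mul, tensorAct_one]⟩
  equivariant i g := ⟨(a g⁻¹ i.1, g⁻¹ * i.2 * g), fun x => by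
    rw [← posE_tensorAct 𝒱 F a hF, ha]
    congr 1
    congr 1
    ext1
    · rfl
    · simp only; group⟩

/-! ### Right skew derivations for the flipped braiding -/

section PosD

variable [Fintype G] (F : W → V →ₗ[R] R) (a : G → W → W)

theorem posD_mul_ι (w : W) (x : TensorAlgebra R V) (v : V) :
    posD 𝒱 F a w (x * TensorAlgebra.ι R v) = F w v • x +
      ∑ h, posD 𝒱 F a (a h⁻¹ w) x * TensorAlgebra.ι R (𝒱.proj h v) := skewD_mul_ι _ _ _ _ _ _

theorem posD_one (w : W) : posD 𝒱 F a w 1 = 0 := skewD_one _ _ _ _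

variable (hF : ∀ g w v, F (a g w) (𝒱.act g v) = F w v)

include hF

/-- The flipped braiding sends `u ⊗ v` to `∑ h, v_h ⊗ (h ▷ u)`, and invariance of the pairing moves
`h` onto `w`. All degrees `h` contribute here, which is why the recursion of `posD` involves a sum.
-/
theorem posD_braiding (ha : ∀ g w, a g (a g⁻¹ w) = w) (w : W) (u v : V) :
    contr V (F w) (flipBraiding 𝒱.braiding (u ⊗ₜ v)) =
      ∑ h, F (a h⁻¹ w) u • 𝒱.proj h v := by
  simp only [flipBraiding, YDMod.braiding, LinearMap.sum_apply, map_sum, LinearMap.comp_apply]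
  refine Finset.sum_congr rfl fun h _ => ?_
  simp [← hF h (a h⁻¹ w) u, ha]

theorem posD_tensorAct (hmul : ∀ g h w, a (g * h) w = a g (a h w)) (g : G) (w : W)
    (x : TensorAlgebra R V) :
    posD 𝒱 F a (a g w) (tensorAct 𝒱.act g x) = tensorAct 𝒱.act g (posD 𝒱 F a w x) := by
  induction x using tensorAlgebra_induction_right generalizing w with
  | one => simp [posD_one]
  | add a b ha hb => simp only [map_add, ha, hb]
  | smul r a ha => simp only [map_smul, ha]
  | mul x v hx =>
    rw [map_mul, tensorAct_ι, posD_mul_ι, posD_mul_ι, hF, map_add, map_smul, map_sum]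
    congr 1
    symm
    refine Fintype.sum_equiv (MulAut.conj g).toEquiv _ _ fun h => ?_
    simp only [MulEquiv.toEquiv_eq_coe, MulEquiv.coe_toEquiv, MulAut.conj_apply]
    rw [map_mul, tensorAct_ι, proj_act, ← hx, ← hmul, ← hmul]
    congr 4
    group

/-- The left and the right skew derivations of `T(V)` commute. -/
theorem posE_posD (hmul : ∀ g h w, a (g * h) w = a g (a h w))
    (F' : W × G → V →ₗ[R] R) (hF' : ∀ i h v, v ∈ 𝒱.comp h → h ≠ i.2⁻¹ → F' i v = 0)
    (ha : ∀ g w, a g (a g⁻¹ w) = w)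
    (i : W × G) (w : W) (x : TensorAlgebra R V) :
    posE 𝒱 F' i (posD 𝒱 F a w x) = posD 𝒱 F a w (posE 𝒱 F' i x) := by
  induction x using tensorAlgebra_induction_right generalizing w with
  | one => simp [posD_one, posE_one]
  | add a b ha hb => simp only [map_add, ha, hb]
  | smul r a ha => simp only [map_smul, ha]
  | mul x v hx =>
    -- By `hF'`, the functional `F' i` only sees the component of degree `i.2⁻¹`.
    have e1 : F' i (𝒱.proj i.2⁻¹ v) = F' i v := by
      conv_rhs => rw [← 𝒱.sum_proj v, map_sum]
      rw [Finset.sum_eq_single i.2⁻¹]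
      · intro h _ hne
        exact hF' i h _ (𝒱.proj_mem h v) hne
      · simp
    -- On the other side of the identity only the summand `h = i.2⁻¹` has a nonzero value of `F' i`,
    -- and its operator has index `i.2 ▷ w`. Equivariance matches it with this term.
    have e2 : posD 𝒱 F a w (tensorAct 𝒱.act i.2⁻¹ x) =
        tensorAct 𝒱.act i.2⁻¹ (posD 𝒱 F a (a i.2 w) x) := by
      rw [← posD_tensorAct 𝒱 F a hF hmul]
      congr 1
      conv_lhs => rw [← ha i.2⁻¹ w, inv_inv]
    rw [posD_mul_ι, posE_mul, posE_ι, map_add, map_add, map_smul, map_sum, posD_mul_ι,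
      ← Algebra.commutes, ← Algebra.smul_def, map_smul, e2]
    simp only [posE_mul, posE_ι, Finset.sum_add_distrib, hx]
    rw [Finset.sum_eq_single i.2⁻¹]
    · rw [e1, inv_inv, ← Algebra.commutes, ← Algebra.smul_def]
      abel
    · intro h _ hne
      rw [hF' i h _ (𝒱.proj_mem h v) hne, map_zero, mul_zero]
    · simp

/-- The left and the right skew derivations have the same radical. -/
theorem radical_posE_eq (hmul : ∀ g h w, a (g * h) w = a g (a h w))
    (F' : W × G → V →ₗ[R] R) (hF' : ∀ i h v, v ∈ 𝒱.comp h → h ≠ i.2⁻¹ → F' i v = 0)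
    (ha : ∀ g w, a g (a g⁻¹ w) = w) (p : W → G → W) (hp : ∀ w g, F' (w, g) = F (p w g))
    (hsum : ∀ w, F w = ∑ g, F' (w, g)) :
    radical (posE 𝒱 F') = radical (posD 𝒱 F a) := by
  have hcomm := posE_posD 𝒱 F a hF hmul F' hF' ha
  have epsE : ∀ i x v, TensorAlgebra.algebraMapInv (posE 𝒱 F' i (x * TensorAlgebra.ι R v)) =
      F' i v * TensorAlgebra.algebraMapInv x := by
    intro i x v
    rw [posE_mul, posE_ι, map_add, map_mul, map_mul, algebraMapInv_tensorAct,
      TensorAlgebra.algebraMap_leftInverse]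
    simp [TensorAlgebra.algebraMapInv, mul_comm]
  have epsD : ∀ w x v, TensorAlgebra.algebraMapInv (posD 𝒱 F a w (x * TensorAlgebra.ι R v)) =
      F w v * TensorAlgebra.algebraMapInv x := by
    intro w x v
    rw [posD_mul_ι, map_add, map_smul, map_sum, smul_eq_mul, add_eq_left]
    refine Finset.sum_eq_zero fun h _ => ?_
    simp [TensorAlgebra.algebraMapInv]
  -- The constant terms of the two families determine each other: they only depend on the
  -- coefficient of the degree-one part, which is paired with `F w` or with `F' (w, g)`.
  have eps1 : ∀ w x, TensorAlgebra.algebraMapInv (posD 𝒱 F a w x) =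
      ∑ g, TensorAlgebra.algebraMapInv (posE 𝒱 F' (w, g) x) := by
    intro w x
    induction x using tensorAlgebra_induction_right with
    | one => simp [posD_one, posE_one]
    | add a b ha hb => simp only [map_add, ha, hb, Finset.sum_add_distrib]
    | smul r a ha => simp only [map_smul, ha, Finset.smul_sum]
    | mul x v _ =>
      simp only [epsD, epsE, hsum w, LinearMap.sum_apply, Finset.sum_mul]
  have eps2 : ∀ w g x, TensorAlgebra.algebraMapInv (posE 𝒱 F' (w, g) x) =
      TensorAlgebra.algebraMapInv (posD 𝒱 F a (p w g) x) := by
    intro w g x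
    induction x using tensorAlgebra_induction_right with
    | one => simp [posD_one, posE_one]
    | add a b ha hb => simp only [map_add, ha, hb]
    | smul r a ha => simp only [map_smul, ha]
    | mul x v _ => simp only [epsD, epsE, hp]
  -- An operator of one family can be moved behind any word of the other by commutation. Its
  -- constant term there is a sum of constant terms of words in the other family, which vanish on
  -- the radical.
  apply le_antisymm
  · refine le_radical (fun x hx => algebraMapInv_of_mem_radical hx) fun w x hx => ?_
    rw [mem_radical]
    intro L
    have : iterD (posE 𝒱 F') L (posD 𝒱 F a w x) = posD 𝒱 F a w (iterD (posE 𝒱 F') L x) := by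
      clear hx
      induction L generalizing x with
      | nil => rfl
      | cons i L ih => exact (congrArg _ (hcomm i w x)).trans (ih _)
    rw [this, eps1]
    refine Finset.sum_eq_zero fun g _ => ?_
    have := mem_radical.1 hx (L ++ [(w, g)])
    rwa [iterD_append] at this
  · refine le_radical (fun x hx => algebraMapInv_of_mem_radical hx) fun i x hx => ?_
    rw [mem_radical]
    intro L
    have : iterD (posD 𝒱 F a) L (posE 𝒱 F' i x) = posE 𝒱 F' i (iterD (posD 𝒱 F a) L x) := by
      clear hx
      induction L generalizing x with
      | nil => rfl
      | cons w L ih => exact (congrArg _ (hcomm i w x).symm).trans (ih _)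
    rw [this, eps2 i.1 i.2]
    have := mem_radical.1 hx (L ++ [p i.1 i.2])
    rwa [iterD_append] at this

end PosD

/-! ### Commutators with skew derivations -/

section Commutator

variable {B : Type*} [Ring B] [Algebra R B] (γ : G → B)

theorem grp_mul_lift (N : TensorAlgebra R V →ₐ[R] B)
    (hγ : ∀ g v, γ g * N (TensorAlgebra.ι R v) = N (TensorAlgebra.ι R (𝒱.act g v)) * γ g)
    (g : G) (x : TensorAlgebra R V) : γ g * N x = N (tensorAct 𝒱.act g x) * γ g := by
  induction x using tensorAlgebra_induction_left with
  | one => simp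
  | add a b ha hb => simp only [map_add, mul_add, add_mul, ha, hb]
  | smul r a ha => simp only [map_smul, mul_smul_comm, smul_mul_assoc, ha]
  | mul v x hx => rw [map_mul, ← mul_assoc, hγ, mul_assoc, hx, map_mul, map_mul, tensorAct_ι,
      mul_assoc]

variable [Fintype G]

/-- Moving `p w` past one more letter `v` creates the terms `F w v_g • γ g`. The group elements
created earlier must cross `v`, which replaces it by `g ▷ v`. This is the recursion of `negD`. -/
theorem commutator_negD (F : W → V →ₗ[R] R) (N : TensorAlgebra R V →ₐ[R] B) (p : W → B)
    (hγ : ∀ g v, γ g * N (TensorAlgebra.ι R v) = N (TensorAlgebra.ι R (𝒱.act g v)) * γ g)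
    (hp : ∀ w v, p w * N (TensorAlgebra.ι R v) = N (TensorAlgebra.ι R v) * p w +
      ∑ g, F w (𝒱.proj g v) • γ g) (w : W) (x : TensorAlgebra R V) :
    p w * N x = N x * p w + ∑ g, N (negD 𝒱 F (w, g) x) * γ g := by
  induction x using tensorAlgebra_induction_right with
  | one => simp [negD_one]
  | add a b ha hb =>
    simp only [map_add, mul_add, add_mul, ha, hb, Finset.sum_add_distrib]; abel
  | smul r a ha =>
    simp only [map_smul, mul_smul_comm, smul_mul_assoc, ha, smul_add, Finset.smul_sum]
  | mul x v hx =>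
    rw [map_mul, ← mul_assoc, hx, add_mul, mul_assoc, hp, mul_add, Finset.mul_sum, Finset.sum_mul,
      add_assoc, ← Finset.sum_add_distrib, mul_assoc]
    congr 1
    refine Finset.sum_congr rfl fun g _ => ?_
    rw [negD_mul_ι, map_add, map_smul, map_mul, add_mul, mul_assoc, mul_assoc, hγ, mul_smul_comm,
      smul_mul_assoc]

/-- Mirror image of the preceding commutator: the group elements are collected on the left, so a
letter `v` that crosses `γ g` becomes `g⁻¹ ▷ v`. -/
theorem commutator_posE (F : W × G → V →ₗ[R] R) (P : TensorAlgebra R V →ₐ[R] B) (n : W → B)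
    (hγ : ∀ g v, γ g * P (TensorAlgebra.ι R v) = P (TensorAlgebra.ι R (𝒱.act g v)) * γ g)
    (hn : ∀ w v, P (TensorAlgebra.ι R v) * n w = n w * P (TensorAlgebra.ι R v) +
      ∑ g, F (w, g) v • γ g) (w : W) (x : TensorAlgebra R V) :
    P x * n w = n w * P x + ∑ g, γ g * P (posE 𝒱 F (w, g) x) := by
  induction x using tensorAlgebra_induction_left with
  | one => simp [posE_one]
  | add a b ha hb =>
    simp only [map_add, mul_add, add_mul, ha, hb, Finset.sum_add_distrib]; abel
  | smul r a ha =>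
    simp only [map_smul, mul_smul_comm, smul_mul_assoc, ha, smul_add, Finset.smul_sum]
  | mul v x hx =>
    rw [map_mul, mul_assoc, hx, mul_add, ← mul_assoc, hn, add_mul, Finset.mul_sum, Finset.sum_mul,
      add_assoc, ← Finset.sum_add_distrib, mul_assoc]
    congr 1
    refine Finset.sum_congr rfl fun g _ => ?_
    rw [posE_ι_mul, map_add, map_smul, map_mul, mul_add, ← mul_assoc, ← mul_assoc, hγ,
      mul_smul_comm, smul_mul_assoc, ← Module.End.mul_apply, ← map_mul]
    simp

end Commutator

end Skew

theorem lTensor_rTensor_comm {k M N : Type*} [CommRing k] [AddCommGroup M] [Module k M]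
    [AddCommGroup N] [Module k N] (a : Module.End k M) (b : Module.End k N) (z : M ⊗[k] N) :
    b.lTensor M (a.rTensor N z) = a.rTensor N (b.lTensor M z) := by
  rw [← LinearMap.comp_apply, ← LinearMap.comp_apply, LinearMap.rTensor_comp_lTensor,
    LinearMap.lTensor_comp_rTensor]

section Heisenberg

variable {G Y : Type*} [Group G] [DecidableEq G] [AddCommGroup Y] [Module ℂ Y]
  (𝒴 : YDMod ℂ G Y)

theorem act_act_inv (g : G) (v : Y) : 𝒴.act g (𝒴.act g⁻¹ v) = v := by
  rw [← Module.End.mul_apply, ← map_mul]; simp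

theorem act_inv_act (g : G) (v : Y) : 𝒴.act g⁻¹ (𝒴.act g v) = v := by
  rw [← Module.End.mul_apply, ← map_mul]; simp

theorem heisD_add (f f' : Module.Dual ℂ Y) (g : G) (x : TensorAlgebra ℂ Y) :
    negD 𝒴 (fun f : Module.Dual ℂ Y => f) (f + f', g) x =
      negD 𝒴 (fun f : Module.Dual ℂ Y => f) (f, g) x +
        negD 𝒴 (fun f : Module.Dual ℂ Y => f) (f', g) x := by
  induction x using tensorAlgebra_induction_right with
  | one => simp [negD_one]
  | add a b ha hb => simp only [map_add, ha, hb]; abel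
  | smul r a ha => simp only [map_smul, ha, smul_add]
  | mul x v hx => simp only [negD_mul_ι, hx, LinearMap.add_apply, add_smul, add_mul]; abel

theorem heisD_smul (r : ℂ) (f : Module.Dual ℂ Y) (g : G) (x : TensorAlgebra ℂ Y) :
    negD 𝒴 (fun f : Module.Dual ℂ Y => f) (r • f, g) x =
      r • negD 𝒴 (fun f : Module.Dual ℂ Y => f) (f, g) x := by
  induction x using tensorAlgebra_induction_right with
  | one => simp [negD_one]
  | add a b ha hb => simp only [map_add, ha, hb, smul_add]
  | smul s a ha => simp only [map_smul, ha, smul_comm r s]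
  | mul x v hx =>
    simp only [negD_mul_ι, hx, LinearMap.smul_apply, smul_assoc, smul_add, smul_mul_assoc]

variable [Fintype G]

/-! ### The radicals of a Heisenberg double -/

/-- The skew derivations of `T(Y)` given by the elements of `Y*`. -/
abbrev heisD : Module.Dual ℂ Y × G → TensorAlgebra ℂ Y →ₗ[ℂ] TensorAlgebra ℂ Y :=
  negD 𝒴 (fun f : Module.Dual ℂ Y => f)

/-- The functional `f ↦ ⟨f, v_g⟩` on `Y*`. -/
def evalComp (i : Y × G) : Module.Dual ℂ Y →ₗ[ℂ] ℂ := Module.Dual.eval ℂ Y (𝒴.proj i.2 i.1)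

/-- The skew derivations of `T(Y*)` given by the elements of `Y`. -/
abbrev heisE : Y × G → TensorAlgebra ℂ (Module.Dual ℂ Y) →ₗ[ℂ] TensorAlgebra ℂ (Module.Dual ℂ Y) :=
  posE 𝒴.dual (evalComp 𝒴)

theorem dual_act_act (g : G) (f : Module.Dual ℂ Y) (v : Y) :
    𝒴.dual.act g f (𝒴.act g v) = f v := by
  change f (𝒴.act g⁻¹ (𝒴.act g v)) = f v
  rw [act_inv_act]

theorem heisD_isSkewLeibniz : IsSkewLeibniz 𝒴.act (heisD 𝒴) :=
  negD_isSkewLeibniz 𝒴 _ (fun g f => 𝒴.dual.act g f) (dual_act_act 𝒴) fun g f => by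
    rw [← Module.End.mul_apply, ← map_mul]; simp

theorem heisE_isSkewLeibniz : IsSkewLeibniz 𝒴.dual.act (heisE 𝒴) :=
  posE_isSkewLeibniz 𝒴.dual _ (fun g v => 𝒴.act g v)
    (fun g v k f => by
      change 𝒴.dual.act g f (𝒴.proj (g * k * g⁻¹) (𝒴.act g v)) = f (𝒴.proj k v)
      rw [proj_act, dual_act_act])
    (act_act_inv 𝒴)

/-- `T(Y)` modulo the radical. -/
abbrev NegQuot : Type _ := TensorAlgebra ℂ Y ⧸ radical (heisD 𝒴)

/-- `T(Y*)` modulo the radical. -/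
abbrev PosQuot : Type _ := TensorAlgebra ℂ (Module.Dual ℂ Y) ⧸ radical (heisE 𝒴)

/-- Left multiplication on `T(Y)` modulo the radical. -/
def NegQuot.mulLeft : TensorAlgebra ℂ Y →ₗ[ℂ] Module.End ℂ (NegQuot 𝒴) where
  toFun x := Submodule.mapQ _ _ (LinearMap.mulLeft ℂ x)
    fun _ hy => (heisD_isSkewLeibniz 𝒴).mul_mem_radical_left x hy
  map_add' x y :=
    Submodule.linearMap_qext _ (LinearMap.ext fun z => congrArg (Submodule.mkQ _) (add_mul x y z))
  map_smul' r x :=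
    Submodule.linearMap_qext _ (LinearMap.ext fun z => congrArg (Submodule.mkQ _) (smul_mul_assoc r x z))

/-- Left multiplication on `T(Y*)` modulo the radical. -/
def PosQuot.mulLeft : TensorAlgebra ℂ (Module.Dual ℂ Y) →ₗ[ℂ] Module.End ℂ (PosQuot 𝒴) where
  toFun x := Submodule.mapQ _ _ (LinearMap.mulLeft ℂ x)
    fun _ hy => (heisE_isSkewLeibniz 𝒴).mul_mem_radical_left x hy
  map_add' x y :=
    Submodule.linearMap_qext _ (LinearMap.ext fun z => congrArg (Submodule.mkQ _) (add_mul x y z))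
  map_smul' r x :=
    Submodule.linearMap_qext _ (LinearMap.ext fun z => congrArg (Submodule.mkQ _) (smul_mul_assoc r x z))

/-- The action of `G` on `T(Y)` modulo the radical. -/
def NegQuot.act (g : G) : Module.End ℂ (NegQuot 𝒴) :=
  Submodule.mapQ _ _ (tensorAct 𝒴.act g).toLinearMap
    fun _ hy => (heisD_isSkewLeibniz 𝒴).tensorAct_mem_radical g hy

/-- The skew derivations of `T(Y)` modulo the radical. -/
def NegQuot.der (g : G) : Module.Dual ℂ Y →ₗ[ℂ] Module.End ℂ (NegQuot 𝒴) where
  toFun f := Submodule.mapQ _ _ (heisD 𝒴 (f, g)) fun _ hy => map_mem_radical hy (f, g)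
  map_add' f f' := Submodule.linearMap_qext _ 
    (LinearMap.ext fun z => congrArg (Submodule.mkQ _) (heisD_add 𝒴 f f' g z))
  map_smul' r f := Submodule.linearMap_qext _ 
    (LinearMap.ext fun z => congrArg (Submodule.mkQ _) (heisD_smul 𝒴 r f g z))

/-! ### The regular module -/

/-- The underlying space of the regular representation of the Heisenberg double. -/
abbrev HeisMod : Type _ := G → NegQuot 𝒴 ⊗[ℂ] PosQuot 𝒴

/-- Operators on the first factor of the regular representation. -/
def HeisMod.onNeg : Module.End ℂ (NegQuot 𝒴) →ₗ[ℂ] Module.End ℂ (HeisMod 𝒴) where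
  toFun a := (a.rTensor (PosQuot 𝒴)).compLeft G
  map_add' a b := by
    refine LinearMap.ext fun F => funext fun h => ?_
    simp [LinearMap.rTensor_add]
  map_smul' r a := by
    refine LinearMap.ext fun F => funext fun h => ?_
    simp [LinearMap.rTensor_smul]

/-- Left translation by `g` on the regular representation. -/
def HeisMod.shift (g : G) : Module.End ℂ (HeisMod 𝒴) := LinearMap.funLeft ℂ _ fun h => g⁻¹ * h

/-- The action of `Y*` on the last factor of the regular representation. -/
def HeisMod.onPos : Module.Dual ℂ Y →ₗ[ℂ] Module.End ℂ (HeisMod 𝒴) where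
  -- In the double, `f h = h (h⁻¹ ▷ f)`, so `f` arrives at the last factor as `h⁻¹ ▷ f`.
  toFun f := LinearMap.pi fun h =>
    (PosQuot.mulLeft 𝒴 (TensorAlgebra.ι ℂ (𝒴.dual.act h⁻¹ f))).lTensor (NegQuot 𝒴) ∘ₗ
      LinearMap.proj h
  map_add' f f' := by
    refine LinearMap.ext fun F => funext fun h => ?_
    simp [LinearMap.lTensor_add]
  map_smul' r f := by
    refine LinearMap.ext fun F => funext fun h => ?_
    simp [LinearMap.lTensor_smul]

@[simp]
theorem HeisMod.onNeg_apply (a : Module.End ℂ (NegQuot 𝒴)) (F : HeisMod 𝒴) (h : G) :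
    HeisMod.onNeg 𝒴 a F h = a.rTensor (PosQuot 𝒴) (F h) := rfl

@[simp]
theorem HeisMod.shift_apply (g : G) (F : HeisMod 𝒴) (h : G) :
    HeisMod.shift 𝒴 g F h = F (g⁻¹ * h) := rfl

@[simp]
theorem HeisMod.onPos_apply (f : Module.Dual ℂ Y) (F : HeisMod 𝒴) (h : G) :
    HeisMod.onPos 𝒴 f F h =
      (PosQuot.mulLeft 𝒴 (TensorAlgebra.ι ℂ (𝒴.dual.act h⁻¹ f))).lTensor (NegQuot 𝒴) (F h) := rfl

/-- The action of `G` on the regular representation. -/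
def HeisMod.grp : G →* Module.End ℂ (HeisMod 𝒴) where
  toFun g := HeisMod.onNeg 𝒴 (NegQuot.act 𝒴 g) ∘ₗ HeisMod.shift 𝒴 g
  map_one' := by
    have : NegQuot.act 𝒴 1 = LinearMap.id :=
      Submodule.linearMap_qext _ (LinearMap.ext fun x =>
        congrArg (Submodule.mkQ _) (tensorAct_one _ x))
    refine LinearMap.ext fun F => funext fun h => ?_
    simp [this]
  map_mul' g h := by
    have : NegQuot.act 𝒴 (g * h) = NegQuot.act 𝒴 g ∘ₗ NegQuot.act 𝒴 h :=
      Submodule.linearMap_qext _ (LinearMap.ext fun x =>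
        congrArg (Submodule.mkQ _) (tensorAct_mul _ g h x))
    refine LinearMap.ext fun F => funext fun k => ?_
    simp [this, LinearMap.rTensor_comp, mul_assoc]

/-- The action of `Y` on the regular representation. -/
def HeisMod.neg : Y →ₗ[ℂ] Module.End ℂ (HeisMod 𝒴) :=
  HeisMod.onNeg 𝒴 ∘ₗ NegQuot.mulLeft 𝒴 ∘ₗ TensorAlgebra.ι ℂ

/-- The action of `Y*` on the regular representation. -/
def HeisMod.pos : Module.Dual ℂ Y →ₗ[ℂ] Module.End ℂ (HeisMod 𝒴) :=
  -- Modelled on `f a h b = ∑ g, D_{f,g}(a) g h b + a f h b`.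
  ∑ g, LinearMap.lcomp ℂ _ (HeisMod.shift 𝒴 g) ∘ₗ HeisMod.onNeg 𝒴 ∘ₗ NegQuot.der 𝒴 g +
    HeisMod.onPos 𝒴

theorem HeisMod.grp_apply (g : G) (F : HeisMod 𝒴) (h : G) :
    HeisMod.grp 𝒴 g F h = (NegQuot.act 𝒴 g).rTensor (PosQuot 𝒴) (F (g⁻¹ * h)) := rfl

theorem HeisMod.neg_apply (v : Y) (F : HeisMod 𝒴) (h : G) :
    HeisMod.neg 𝒴 v F h =
      (NegQuot.mulLeft 𝒴 (TensorAlgebra.ι ℂ v)).rTensor (PosQuot 𝒴) (F h) := rfl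

theorem HeisMod.pos_apply (f : Module.Dual ℂ Y) (F : HeisMod 𝒴) (h : G) :
    HeisMod.pos 𝒴 f F h =
      ∑ g, (NegQuot.der 𝒴 g f).rTensor (PosQuot 𝒴) (F (g⁻¹ * h)) +
      (PosQuot.mulLeft 𝒴 (TensorAlgebra.ι ℂ (𝒴.dual.act h⁻¹ f))).lTensor (NegQuot 𝒴) (F h) := by
  simp [HeisMod.pos]

/-- The action of the free algebra on the regular representation. -/
def HeisMod.preLift : DoubleGen G Y (Module.Dual ℂ Y) →ₐ[ℂ] Module.End ℂ (HeisMod 𝒴) :=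
  TensorAlgebra.lift ℂ (LinearMap.coprod (HeisMod.neg 𝒴) (LinearMap.coprod (HeisMod.pos 𝒴)
    (MonoidAlgebra.lift ℂ _ G (HeisMod.grp 𝒴)).toLinearMap))

theorem HeisMod.preLift_neg (v : Y) : HeisMod.preLift 𝒴 (genNeg v) = HeisMod.neg 𝒴 v := by
  simp [HeisMod.preLift, genNeg]

theorem HeisMod.preLift_pos (f : Module.Dual ℂ Y) :
    HeisMod.preLift 𝒴 (genPos f) = HeisMod.pos 𝒴 f := by
  simp [HeisMod.preLift, genPos]

theorem HeisMod.preLift_grpAlg (x : MonoidAlgebra ℂ G) :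
    HeisMod.preLift 𝒴 (genGrp x) = MonoidAlgebra.lift ℂ _ G (HeisMod.grp 𝒴) x := by
  simp [HeisMod.preLift, genGrp]

theorem HeisMod.preLift_grp (g : G) :
    HeisMod.preLift 𝒴 (genGrp (MonoidAlgebra.single g 1)) = HeisMod.grp 𝒴 g := by
  rw [HeisMod.preLift_grpAlg, MonoidAlgebra.lift_single, one_smul]

theorem NegQuot.act_comp_mulLeft (g : G) (v : Y) :
    NegQuot.act 𝒴 g ∘ₗ NegQuot.mulLeft 𝒴 (TensorAlgebra.ι ℂ v) =
      NegQuot.mulLeft 𝒴 (TensorAlgebra.ι ℂ (𝒴.act g v)) ∘ₗ NegQuot.act 𝒴 g :=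
  Submodule.linearMap_qext _ 
    (LinearMap.ext fun x => congrArg (Submodule.mkQ _)
      (show tensorAct 𝒴.act g (TensorAlgebra.ι ℂ v * x) = _ by rw [map_mul, tensorAct_ι]; rfl))

theorem NegQuot.act_comp_der (g k : G) (f : Module.Dual ℂ Y) :
    NegQuot.act 𝒴 g ∘ₗ NegQuot.der 𝒴 k f =
      NegQuot.der 𝒴 (g * k * g⁻¹) (𝒴.dual.act g f) ∘ₗ NegQuot.act 𝒴 g :=
  Submodule.linearMap_qext _ 
    (LinearMap.ext fun x => congrArg (Submodule.mkQ _)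
      (negD_tensorAct 𝒴 (fun f : Module.Dual ℂ Y => f) (fun g f => 𝒴.dual.act g f)
        (dual_act_act 𝒴) g f k x).symm)

/-- The Leibniz rule for a product that begins with a letter `v`; the extra term is what becomes
`β(f ⊗ v)`. -/
theorem NegQuot.der_comp_mulLeft (g : G) (f : Module.Dual ℂ Y) (v : Y) :
    NegQuot.der 𝒴 g f ∘ₗ NegQuot.mulLeft 𝒴 (TensorAlgebra.ι ℂ v) =
      NegQuot.mulLeft 𝒴 (TensorAlgebra.ι ℂ v) ∘ₗ NegQuot.der 𝒴 g f +
        f (𝒴.proj g v) • NegQuot.act 𝒴 g :=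
  Submodule.linearMap_qext _ 
    (LinearMap.ext fun x => congrArg (Submodule.mkQ _)
      (show heisD 𝒴 (f, g) (TensorAlgebra.ι ℂ v * x) = _ by
        rw [negD_mul, negD_ι, ← Algebra.smul_def]; rfl))

/-- The relations reduce to the three identities above for operators on `T(Y)` modulo the radical.
Operators on the last factor commute with them, apart from the translation of `f` by `h⁻¹`, which is
consistent with `g f = (g ▷ f) g`. -/
theorem HeisMod.preLift_rel ⦃x y : DoubleGen G Y (Module.Dual ℂ Y)⦄
    (h : DoubleRel 𝒴.act 𝒴.dual.act (heisBeta 𝒴) ∅ ∅ x y) :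
    HeisMod.preLift 𝒴 x = HeisMod.preLift 𝒴 y := by
  induction h with
  | grp_one => rw [preLift_grpAlg, map_one, map_one]
  | grp_mul x y => rw [map_mul, preLift_grpAlg, preLift_grpAlg, preLift_grpAlg, map_mul]
  | grp_neg g v =>
    rw [map_mul, map_mul, preLift_grp, preLift_neg, preLift_neg]
    refine LinearMap.ext fun F => funext fun h => ?_
    simp only [Module.End.mul_apply, grp_apply, neg_apply, ← LinearMap.rTensor_comp_apply,
      NegQuot.act_comp_mulLeft]
  | grp_pos g f =>
    rw [map_mul, map_mul, preLift_grp, preLift_pos, preLift_pos]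
    refine LinearMap.ext fun F => funext fun h => ?_
    simp only [Module.End.mul_apply, grp_apply, pos_apply, ← LinearMap.rTensor_comp_apply,
      map_add, map_sum, NegQuot.act_comp_der]
    congr 1
    · refine Fintype.sum_equiv (MulAut.conj g).toEquiv _ _ fun k => ?_
      simp only [MulEquiv.toEquiv_eq_coe, MulEquiv.coe_toEquiv, MulAut.conj_apply]
      congr 2
      group
    · have e : 𝒴.dual.act (g⁻¹ * h)⁻¹ f = 𝒴.dual.act h⁻¹ (𝒴.dual.act g f) := by
        rw [← Module.End.mul_apply, ← map_mul]; simp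
      rw [e]
      exact (lTensor_rTensor_comm _ _ _).symm
  | pos_neg f v =>
    rw [map_mul, map_add, map_mul, preLift_pos, preLift_neg, preLift_grpAlg, heisBeta_apply,
      map_sum]
    refine LinearMap.ext fun F => funext fun h => ?_
    simp only [Module.End.mul_apply, grp_apply, pos_apply, neg_apply,
      ← LinearMap.rTensor_comp_apply, map_add, map_sum, NegQuot.der_comp_mulLeft,
      LinearMap.rTensor_add, LinearMap.add_apply, Finset.sum_add_distrib, Pi.add_apply,
      LinearMap.sum_apply, Finset.sum_apply, MonoidAlgebra.lift_single, LinearMap.smul_apply,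
      Pi.smul_apply, LinearMap.rTensor_smul]
    rw [lTensor_rTensor_comm]
    abel
  | neg x hx => exact hx.elim
  | pos x hx => exact hx.elim

end Heisenberg

section Heisenberg

variable {G Y : Type*} [Group G] [DecidableEq G] [AddCommGroup Y] [Module ℂ Y] [Fintype G]
  (𝒴 : YDMod ℂ G Y)

/-! ### The regular representation -/

/-- The vector `a ⊗ h ⊗ b` of the regular representation. -/
def HeisMod.vec (h : G) (a : TensorAlgebra ℂ Y) (b : TensorAlgebra ℂ (Module.Dual ℂ Y)) :
    HeisMod 𝒴 :=
  Pi.single h (Submodule.Quotient.mk a ⊗ₜ[ℂ] Submodule.Quotient.mk b)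

theorem HeisMod.neg_vec (v : Y) (h : G) (a b) :
    HeisMod.neg 𝒴 v (HeisMod.vec 𝒴 h a b) = HeisMod.vec 𝒴 h (TensorAlgebra.ι ℂ v * a) b := by
  funext k
  rw [HeisMod.neg_apply, HeisMod.vec, HeisMod.vec]
  by_cases hk : k = h
  · subst hk
    simp only [Pi.single_eq_same]
    rfl
  · simp [hk]

theorem HeisMod.grp_vec (g h : G) (a b) :
    HeisMod.grp 𝒴 g (HeisMod.vec 𝒴 h a b) = HeisMod.vec 𝒴 (g * h) (tensorAct 𝒴.act g a) b := by
  funext k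
  rw [HeisMod.grp_apply, HeisMod.vec, HeisMod.vec]
  by_cases hk : k = g * h
  · subst hk
    simp only [Pi.single_eq_same, inv_mul_cancel_left]
    rfl
  · have hk' : g⁻¹ * k ≠ h := fun e => hk (by rw [← e, mul_inv_cancel_left])
    simp [hk, hk']

theorem HeisMod.pos_vec_one (f : Module.Dual ℂ Y) (h : G) (b) :
    HeisMod.pos 𝒴 f (HeisMod.vec 𝒴 h 1 b) =
      HeisMod.vec 𝒴 h 1 (TensorAlgebra.ι ℂ (𝒴.dual.act h⁻¹ f) * b) := by
  have hder : ∀ g z, (NegQuot.der 𝒴 g f).rTensor (PosQuot 𝒴)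
      (HeisMod.vec 𝒴 h 1 b z) = 0 := by
    intro g z
    rw [HeisMod.vec]
    by_cases hz : z = h
    · subst hz
      rw [Pi.single_eq_same, LinearMap.rTensor_tmul]
      have : NegQuot.der 𝒴 g f (Submodule.Quotient.mk 1) = 0 :=
        (congrArg (Submodule.mkQ _) (negD_one 𝒴 _ (f, g))).trans (map_zero _)
      rw [this, TensorProduct.zero_tmul]
    · simp [hz]
  funext k
  rw [HeisMod.pos_apply]
  simp only [hder, Finset.sum_const_zero, zero_add]
  rw [HeisMod.vec, HeisMod.vec]
  by_cases hk : k = h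
  · subst hk
    simp only [Pi.single_eq_same]
    rfl
  · simp [hk]

/-- Linear maps from the regular representation agree if they agree on all `a ⊗ h ⊗ b`. -/
theorem HeisMod.ext_vec {N : Type*} [AddCommGroup N] [Module ℂ N] {s t : HeisMod 𝒴 →ₗ[ℂ] N}
    (hst : ∀ h a b, s (HeisMod.vec 𝒴 h a b) = t (HeisMod.vec 𝒴 h a b)) : s = t := by
  refine LinearMap.pi_ext' fun h => TensorProduct.ext' fun a b => ?_
  obtain ⟨a, rfl⟩ := Submodule.Quotient.mk_surjective _ a
  obtain ⟨b, rfl⟩ := Submodule.Quotient.mk_surjective _ b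
  exact hst h a b

/-- The action of `T(Y)` on the regular representation. -/
def HeisMod.negAlg : TensorAlgebra ℂ Y →ₐ[ℂ] Module.End ℂ (HeisMod 𝒴) :=
  TensorAlgebra.lift ℂ (HeisMod.neg 𝒴)

/-- The action of `T(Y*)` on the regular representation. -/
def HeisMod.posAlg : TensorAlgebra ℂ (Module.Dual ℂ Y) →ₐ[ℂ] Module.End ℂ (HeisMod 𝒴) :=
  TensorAlgebra.lift ℂ (HeisMod.pos 𝒴)

theorem HeisMod.vec_add_left (h : G) (a a' b) : HeisMod.vec 𝒴 h (a + a') b =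
    HeisMod.vec 𝒴 h a b + HeisMod.vec 𝒴 h a' b := by
  simp only [HeisMod.vec, Submodule.Quotient.mk_add, TensorProduct.add_tmul, Pi.single_add]

theorem HeisMod.vec_smul_left (r : ℂ) (h : G) (a b) : HeisMod.vec 𝒴 h (r • a) b =
    r • HeisMod.vec 𝒴 h a b := by
  simp only [HeisMod.vec, Submodule.Quotient.mk_smul, ← TensorProduct.smul_tmul', Pi.single_smul]

theorem HeisMod.vec_add_right (h : G) (a b b') : HeisMod.vec 𝒴 h a (b + b') =
    HeisMod.vec 𝒴 h a b + HeisMod.vec 𝒴 h a b' := by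
  simp only [HeisMod.vec, Submodule.Quotient.mk_add, TensorProduct.tmul_add, Pi.single_add]

theorem HeisMod.vec_smul_right (r : ℂ) (h : G) (a b) : HeisMod.vec 𝒴 h a (r • b) =
    r • HeisMod.vec 𝒴 h a b := by
  simp only [HeisMod.vec, Submodule.Quotient.mk_smul, TensorProduct.tmul_smul, Pi.single_smul]

theorem HeisMod.negAlg_vec (x : TensorAlgebra ℂ Y) (h : G) (a b) :
    HeisMod.negAlg 𝒴 x (HeisMod.vec 𝒴 h a b) = HeisMod.vec 𝒴 h (x * a) b := by
  induction x using tensorAlgebra_induction_left with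
  | one => simp
  | add x y hx hy => rw [map_add, LinearMap.add_apply, hx, hy, add_mul, HeisMod.vec_add_left]
  | smul r x hx => rw [map_smul, LinearMap.smul_apply, hx, smul_mul_assoc, HeisMod.vec_smul_left]
  | mul v x hx =>
    rw [map_mul, Module.End.mul_apply, hx, mul_assoc, ← HeisMod.neg_vec, HeisMod.negAlg,
      TensorAlgebra.lift_ι_apply]

theorem HeisMod.posAlg_vec (x : TensorAlgebra ℂ (Module.Dual ℂ Y)) (h : G) (b) :
    HeisMod.posAlg 𝒴 x (HeisMod.vec 𝒴 h 1 b) =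
      HeisMod.vec 𝒴 h 1 (tensorAct 𝒴.dual.act h⁻¹ x * b) := by
  induction x using tensorAlgebra_induction_left with
  | one => simp
  | add x y hx hy =>
    rw [map_add, LinearMap.add_apply, hx, hy, map_add, add_mul, HeisMod.vec_add_right]
  | smul r x hx =>
    rw [map_smul, LinearMap.smul_apply, hx, map_smul, smul_mul_assoc, HeisMod.vec_smul_right]
  | mul v x hx =>
    rw [map_mul, Module.End.mul_apply, hx, map_mul, mul_assoc, tensorAct_ι, ← HeisMod.pos_vec_one,
      HeisMod.posAlg, TensorAlgebra.lift_ι_apply]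

theorem HeisMod.negAlg_eq_zero {x : TensorAlgebra ℂ Y} (hx : x ∈ radical (heisD 𝒴)) :
    HeisMod.negAlg 𝒴 x = 0 := by
  refine HeisMod.ext_vec 𝒴 fun h a b => ?_
  have : (Submodule.Quotient.mk (x * a) : NegQuot 𝒴) = 0 :=
    (Submodule.Quotient.mk_eq_zero _).2 ((heisD_isSkewLeibniz 𝒴).mul_mem_radical_right a hx)
  rw [HeisMod.negAlg_vec, HeisMod.vec, this]
  simp

theorem HeisMod.grp_mul_pos (g : G) (f : Module.Dual ℂ Y) :
    HeisMod.grp 𝒴 g * HeisMod.pos 𝒴 f = HeisMod.pos 𝒴 (𝒴.dual.act g f) * HeisMod.grp 𝒴 g := by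
  have := HeisMod.preLift_rel 𝒴 (DoubleRel.grp_pos g f)
  rwa [map_mul, map_mul, preLift_grp, preLift_pos, preLift_pos] at this

theorem HeisMod.pos_mul_neg (f : Module.Dual ℂ Y) (v : Y) :
    HeisMod.pos 𝒴 f * HeisMod.neg 𝒴 v = HeisMod.neg 𝒴 v * HeisMod.pos 𝒴 f +
      ∑ g, f (𝒴.proj g v) • HeisMod.grp 𝒴 g := by
  have := HeisMod.preLift_rel 𝒴 (DoubleRel.pos_neg f v)
  rw [map_mul, map_add, map_mul, preLift_neg, preLift_pos, preLift_grpAlg, heisBeta_apply,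
    map_sum] at this
  simpa only [MonoidAlgebra.lift_single] using this

/-- On `1 ⊗ h ⊗ b` this says that the radical is a right ideal stable under `G`. For `v a` in the
first factor, `x v = v x + ∑ g, g E_{v,g}(x)`, and the `E_{v,g}(x)` are again in the radical. So the
induction on `a` runs over all `x` simultaneously. -/
theorem HeisMod.posAlg_eq_zero {x : TensorAlgebra ℂ (Module.Dual ℂ Y)}
    (hx : x ∈ radical (heisE 𝒴)) : HeisMod.posAlg 𝒴 x = 0 := by
  refine HeisMod.ext_vec 𝒴 fun h a b => ?_
  rw [LinearMap.zero_apply]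
  induction a using tensorAlgebra_induction_left generalizing x with
  | one =>
    have : (Submodule.Quotient.mk (tensorAct 𝒴.dual.act h⁻¹ x * b) : PosQuot 𝒴) = 0 :=
      (Submodule.Quotient.mk_eq_zero _).2 ((heisE_isSkewLeibniz 𝒴).mul_mem_radical_right b
        ((heisE_isSkewLeibniz 𝒴).tensorAct_mem_radical _ hx))
    rw [HeisMod.posAlg_vec, HeisMod.vec, this]
    simp
  | add a a' ha ha' => rw [HeisMod.vec_add_left, map_add, ha hx, ha' hx, add_zero]
  | smul r a ha => rw [HeisMod.vec_smul_left, map_smul, ha hx, smul_zero]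
  | mul v a ha =>
    have key := commutator_posE 𝒴.dual (fun g => HeisMod.grp 𝒴 g) (evalComp 𝒴)
      (HeisMod.posAlg 𝒴) (fun v => HeisMod.neg 𝒴 v)
      (fun g f => by
        simp only [HeisMod.posAlg, TensorAlgebra.lift_ι_apply]; exact HeisMod.grp_mul_pos 𝒴 g f)
      (fun v f => by
        simp only [HeisMod.posAlg, TensorAlgebra.lift_ι_apply]; exact HeisMod.pos_mul_neg 𝒴 f v)
      v x
    have key := congrArg (fun t => t (HeisMod.vec 𝒴 h a b)) key
    rw [← HeisMod.neg_vec]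
    refine key.trans ?_
    simp only [LinearMap.add_apply, Module.End.mul_apply, LinearMap.sum_apply]
    rw [ha hx, map_zero, zero_add]
    refine Finset.sum_eq_zero fun g _ => ?_
    rw [ha (map_mem_radical hx (v, g)), map_zero]

/-! ### Coordinates from the regular representation -/

section Rep

variable {Im : Set (TensorAlgebra ℂ Y)} {Ip : Set (TensorAlgebra ℂ (Module.Dual ℂ Y))}
  (hIm : Im ⊆ radical (heisD 𝒴)) (hIp : Ip ⊆ radical (heisE 𝒴))

/-- The regular representation of `A_β(I⁻, I⁺)`. -/
def HeisMod.rep : YDDouble 𝒴 Im Ip →ₐ[ℂ] Module.End ℂ (HeisMod 𝒴) :=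
  RingQuot.liftAlgHom ℂ ⟨HeisMod.preLift 𝒴, fun x y h => by
    cases h with
    | grp_one => exact HeisMod.preLift_rel 𝒴 .grp_one
    | grp_mul x y => exact HeisMod.preLift_rel 𝒴 (.grp_mul x y)
    | grp_neg g v => exact HeisMod.preLift_rel 𝒴 (.grp_neg g v)
    | grp_pos g f => exact HeisMod.preLift_rel 𝒴 (.grp_pos g f)
    | pos_neg f v => exact HeisMod.preLift_rel 𝒴 (.pos_neg f v)
    | neg x hx =>
      have : (HeisMod.preLift 𝒴).comp (TensorAlgebra.lift ℂ genNeg) = HeisMod.negAlg 𝒴 := by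
        ext1; ext1 v; simp [HeisMod.preLift_neg, HeisMod.negAlg]
      rw [map_zero]
      exact (congrArg (fun a => a x) this).trans (HeisMod.negAlg_eq_zero 𝒴 (hIm hx))
    | pos x hx =>
      have : (HeisMod.preLift 𝒴).comp (TensorAlgebra.lift ℂ genPos) = HeisMod.posAlg 𝒴 := by
        ext1; ext1 v; simp [HeisMod.preLift_pos, HeisMod.posAlg]
      rw [map_zero]
      exact (congrArg (fun a => a x) this).trans (HeisMod.posAlg_eq_zero 𝒴 (hIp hx))⟩

theorem HeisMod.rep_mk (x : DoubleGen G Y (Module.Dual ℂ Y)) :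
    HeisMod.rep 𝒴 hIm hIp (Double.mk 𝒴.act 𝒴.dual.act (heisBeta 𝒴) Im Ip x) =
      HeisMod.preLift 𝒴 x :=
  RingQuot.liftAlgHom_mkAlgHom_apply ℂ _ _ x

theorem HeisMod.rep_negAlg (x : TensorAlgebra ℂ Y) :
    HeisMod.rep 𝒴 hIm hIp (Double.negAlg 𝒴.act 𝒴.dual.act (heisBeta 𝒴) Im Ip x) =
      HeisMod.negAlg 𝒴 x := by
  have : (HeisMod.rep 𝒴 hIm hIp).comp (Double.negAlg 𝒴.act 𝒴.dual.act (heisBeta 𝒴) Im Ip) =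
      HeisMod.negAlg 𝒴 := by
    ext1; ext1 v
    simp only [AlgHom.toLinearMap_apply, LinearMap.comp_apply, AlgHom.comp_apply, Double.negAlg,
      TensorAlgebra.lift_ι_apply, HeisMod.negAlg]
    exact (HeisMod.rep_mk 𝒴 hIm hIp _).trans (HeisMod.preLift_neg 𝒴 v)
  exact congrArg (fun a => a x) this

theorem HeisMod.rep_posAlg (x : TensorAlgebra ℂ (Module.Dual ℂ Y)) :
    HeisMod.rep 𝒴 hIm hIp (Double.posAlg 𝒴.act 𝒴.dual.act (heisBeta 𝒴) Im Ip x) =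
      HeisMod.posAlg 𝒴 x := by
  have : (HeisMod.rep 𝒴 hIm hIp).comp (Double.posAlg 𝒴.act 𝒴.dual.act (heisBeta 𝒴) Im Ip) =
      HeisMod.posAlg 𝒴 := by
    ext1; ext1 v
    simp only [AlgHom.toLinearMap_apply, LinearMap.comp_apply, AlgHom.comp_apply, Double.posAlg,
      TensorAlgebra.lift_ι_apply, HeisMod.posAlg]
    exact (HeisMod.rep_mk 𝒴 hIm hIp _).trans (HeisMod.preLift_pos 𝒴 v)
  exact congrArg (fun a => a x) this

theorem HeisMod.rep_grp (g : G) :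
    HeisMod.rep 𝒴 hIm hIp (Double.grp 𝒴.act 𝒴.dual.act (heisBeta 𝒴) Im Ip g) =
      HeisMod.grp 𝒴 g :=
  (HeisMod.rep_mk 𝒴 hIm hIp _).trans (HeisMod.preLift_grp 𝒴 g)

/-- The regular representation applied to the vector `1 ⊗ 1 ⊗ 1`. -/
def HeisMod.ofDouble : YDDouble 𝒴 Im Ip →ₗ[ℂ] HeisMod 𝒴 :=
  LinearMap.applyₗ (HeisMod.vec 𝒴 1 1 1) ∘ₗ (HeisMod.rep 𝒴 hIm hIp).toLinearMap

/-- Applied to `1 ⊗ 1 ⊗ 1`, the three factors build up the three tensor factors one after another,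
since the derivations kill `1`. The independence of the products `a g b` rests on this. -/
theorem HeisMod.ofDouble_apply (a : TensorAlgebra ℂ Y) (g : G)
    (b : TensorAlgebra ℂ (Module.Dual ℂ Y)) :
    HeisMod.ofDouble 𝒴 hIm hIp (Double.negAlg 𝒴.act 𝒴.dual.act (heisBeta 𝒴) Im Ip a *
      Double.grp 𝒴.act 𝒴.dual.act (heisBeta 𝒴) Im Ip g *
      Double.posAlg 𝒴.act 𝒴.dual.act (heisBeta 𝒴) Im Ip b) = HeisMod.vec 𝒴 g a b := by
  change HeisMod.rep 𝒴 hIm hIp (_ * _ * _) (HeisMod.vec 𝒴 1 1 1) = _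
  rw [map_mul, map_mul, HeisMod.rep_negAlg, HeisMod.rep_posAlg, HeisMod.rep_grp,
    Module.End.mul_apply, Module.End.mul_apply, HeisMod.posAlg_vec, HeisMod.grp_vec,
    HeisMod.negAlg_vec]
  simp [tensorAct_one]

end Rep

/-! ### Commutators in the doubles -/

section Commutator

variable (Im : Set (TensorAlgebra ℂ Y)) (Ip : Set (TensorAlgebra ℂ (Module.Dual ℂ Y)))

theorem Double.pos_mul_negAlg (f : Module.Dual ℂ Y) (x : TensorAlgebra ℂ Y) :
    Double.pos 𝒴.act 𝒴.dual.act (heisBeta 𝒴) Im Ip f *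
        Double.negAlg 𝒴.act 𝒴.dual.act (heisBeta 𝒴) Im Ip x =
      Double.negAlg 𝒴.act 𝒴.dual.act (heisBeta 𝒴) Im Ip x *
        Double.pos 𝒴.act 𝒴.dual.act (heisBeta 𝒴) Im Ip f +
      ∑ g, Double.negAlg 𝒴.act 𝒴.dual.act (heisBeta 𝒴) Im Ip (heisD 𝒴 (f, g) x) *
        Double.grp 𝒴.act 𝒴.dual.act (heisBeta 𝒴) Im Ip g :=
  commutator_negD 𝒴 (fun g => Double.grp 𝒴.act 𝒴.dual.act (heisBeta 𝒴) Im Ip g)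
    (fun f : Module.Dual ℂ Y => f) (Double.negAlg 𝒴.act 𝒴.dual.act (heisBeta 𝒴) Im Ip)
    (fun f => Double.pos 𝒴.act 𝒴.dual.act (heisBeta 𝒴) Im Ip f)
    (fun g v => by
      simp only [Double.negAlg, TensorAlgebra.lift_ι_apply]; exact Double.grp_neg 𝒴 Im Ip g v)
    (fun f v => by
      simp only [Double.negAlg, TensorAlgebra.lift_ι_apply]; exact Double.pos_neg 𝒴 Im Ip f v)
    f x

theorem Double.posAlg_mul_neg (v : Y) (x : TensorAlgebra ℂ (Module.Dual ℂ Y)) :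
    Double.posAlg 𝒴.act 𝒴.dual.act (heisBeta 𝒴) Im Ip x *
        Double.neg 𝒴.act 𝒴.dual.act (heisBeta 𝒴) Im Ip v =
      Double.neg 𝒴.act 𝒴.dual.act (heisBeta 𝒴) Im Ip v *
        Double.posAlg 𝒴.act 𝒴.dual.act (heisBeta 𝒴) Im Ip x +
      ∑ g, Double.grp 𝒴.act 𝒴.dual.act (heisBeta 𝒴) Im Ip g *
        Double.posAlg 𝒴.act 𝒴.dual.act (heisBeta 𝒴) Im Ip (heisE 𝒴 (v, g) x) :=
  commutator_posE 𝒴.dual (fun g => Double.grp 𝒴.act 𝒴.dual.act (heisBeta 𝒴) Im Ip g)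
    (evalComp 𝒴) (Double.posAlg 𝒴.act 𝒴.dual.act (heisBeta 𝒴) Im Ip)
    (fun v => Double.neg 𝒴.act 𝒴.dual.act (heisBeta 𝒴) Im Ip v)
    (fun g f => by
      simp only [Double.posAlg, TensorAlgebra.lift_ι_apply]; exact Double.grp_pos 𝒴 Im Ip g f)
    (fun v f => by
      simp only [Double.posAlg, TensorAlgebra.lift_ι_apply]; exact Double.pos_neg 𝒴 Im Ip f v)
    v x

end Commutator

/-! ### The maximal ideals -/

/-- The commutator of `f` with `x` is `∑ g, D_{f,g}(x) g`, so the commutator condition follows from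
stability of the radical under the derivations. -/
theorem isNegIdeal_ideal :
    IsNegIdeal 𝒴.act 𝒴.dual.act (heisBeta 𝒴) (heisD_isSkewLeibniz 𝒴).ideal where
  graded x hx n := by
    rw [IsSkewLeibniz.mem_ideal] at hx ⊢
    exact (negD_lowering 𝒴 _).decompose_mem_radical hx n
  positive x hx := algebraMapInv_of_mem_radical ((IsSkewLeibniz.mem_ideal _).1 hx)
  invariant g x hx := by
    rw [IsSkewLeibniz.mem_ideal] at hx ⊢
    exact (heisD_isSkewLeibniz 𝒴).tensorAct_mem_radical g hx
  commutator f x hx := by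
    rw [IsSkewLeibniz.mem_ideal] at hx
    rw [Double.pos_mul_negAlg, add_sub_cancel_left]
    exact Submodule.sum_mem _ fun g _ => Submodule.subset_span
      ⟨_, (IsSkewLeibniz.mem_ideal _).2 (map_mem_radical hx (f, g)), g, rfl⟩

theorem isPosIdeal_ideal :
    IsPosIdeal 𝒴.act 𝒴.dual.act (heisBeta 𝒴) (heisE_isSkewLeibniz 𝒴).ideal where
  graded x hx n := by
    rw [IsSkewLeibniz.mem_ideal] at hx ⊢
    exact (posE_lowering 𝒴.dual _).decompose_mem_radical hx n
  positive x hx := algebraMapInv_of_mem_radical ((IsSkewLeibniz.mem_ideal _).1 hx)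
  invariant g x hx := by
    rw [IsSkewLeibniz.mem_ideal] at hx ⊢
    exact (heisE_isSkewLeibniz 𝒴).tensorAct_mem_radical g hx
  commutator v x hx := by
    rw [IsSkewLeibniz.mem_ideal] at hx
    rw [Double.posAlg_mul_neg, add_sub_cancel_left]
    exact Submodule.sum_mem _ fun g _ => Submodule.subset_span
      ⟨_, (IsSkewLeibniz.mem_ideal _).2 (map_mem_radical hx (v, g)), g, rfl⟩

/-- The subspace underlying a two-sided ideal. -/
def idealSubmodule {A : Type*} [Ring A] [Algebra ℂ A] (I : TwoSidedIdeal A) : Submodule ℂ A where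
  carrier := I
  add_mem' := I.add_mem
  zero_mem' := I.zero_mem
  smul_mem' r x hx := by
    rw [Algebra.smul_def]
    exact I.mul_mem_left _ _ hx

/-- The augmentation of `T(Y)` modulo the radical. -/
def NegQuot.eps : NegQuot 𝒴 →ₗ[ℂ] ℂ :=
  Submodule.liftQ _ TensorAlgebra.algebraMapInv.toLinearMap
    fun _ hx => algebraMapInv_of_mem_radical hx

/-- The augmentation of `T(Y*)` modulo the radical. -/
def PosQuot.eps : PosQuot 𝒴 →ₗ[ℂ] ℂ :=
  Submodule.liftQ _ TensorAlgebra.algebraMapInv.toLinearMap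
    fun _ hx => algebraMapInv_of_mem_radical hx

/-- The coefficient `a` of `a ⊗ g ⊗ 1`. -/
def HeisMod.negCoeff (g : G) : HeisMod 𝒴 →ₗ[ℂ] NegQuot 𝒴 :=
  contr (NegQuot 𝒴) (PosQuot.eps 𝒴) ∘ₗ LinearMap.proj g

/-- The coefficient `b` of `1 ⊗ g ⊗ b`. -/
def HeisMod.posCoeff (g : G) : HeisMod 𝒴 →ₗ[ℂ] PosQuot 𝒴 :=
  contr (PosQuot 𝒴) (NegQuot.eps 𝒴) ∘ₗ (TensorProduct.comm ℂ _ _).toLinearMap ∘ₗ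
    LinearMap.proj g

theorem HeisMod.negCoeff_vec (g h : G) (a : TensorAlgebra ℂ Y) :
    HeisMod.negCoeff 𝒴 g (HeisMod.vec 𝒴 h a 1) =
      if g = h then Submodule.Quotient.mk a else 0 := by
  have : PosQuot.eps 𝒴 (Submodule.Quotient.mk 1) = 1 :=
    map_one (TensorAlgebra.algebraMapInv (R := ℂ) (M := Module.Dual ℂ Y))
  by_cases hg : g = h
  · subst hg
    simp [HeisMod.negCoeff, HeisMod.vec, this]
  · simp [HeisMod.negCoeff, HeisMod.vec, hg]

theorem HeisMod.posCoeff_vec (g h : G) (b : TensorAlgebra ℂ (Module.Dual ℂ Y)) :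
    HeisMod.posCoeff 𝒴 g (HeisMod.vec 𝒴 h 1 b) =
      if g = h then Submodule.Quotient.mk b else 0 := by
  have : NegQuot.eps 𝒴 (Submodule.Quotient.mk 1) = 1 :=
    map_one (TensorAlgebra.algebraMapInv (R := ℂ) (M := Y))
  by_cases hg : g = h
  · subst hg
    simp [HeisMod.posCoeff, HeisMod.vec, this]
  · simp [HeisMod.posCoeff, HeisMod.vec, hg]

/-- In the regular representation of `A_β(0, 0)` the coefficient of `g` in the commutator of `f` and
`x` is the class of `D_{f,g}(x)`, so this class comes from `I`. Coefficients are visible only modulo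
the radical, and therefore stability is proved for `I` plus the radical instead of `I`. -/
theorem isNegIdeal_le (I : TwoSidedIdeal (TensorAlgebra ℂ Y))
    (hI : IsNegIdeal 𝒴.act 𝒴.dual.act (heisBeta 𝒴) I) {x : TensorAlgebra ℂ Y} (hx : x ∈ I) :
    x ∈ radical (heisD 𝒴) := by
  refine le_radical (S := idealSubmodule I ⊔ radical (heisD 𝒴)) ?_ ?_
    (Submodule.mem_sup_left hx)
  · intro y hy
    obtain ⟨a, ha, b, hb, rfl⟩ := Submodule.mem_sup.1 hy
    rw [map_add, hI.positive a ha, algebraMapInv_of_mem_radical hb, add_zero]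
  · rintro ⟨f, g⟩ y hy
    obtain ⟨a, ha, b, hb, rfl⟩ := Submodule.mem_sup.1 hy
    rw [map_add]
    refine Submodule.add_mem _ ?_ (Submodule.mem_sup_right (map_mem_radical hb _))
    have hc := hI.commutator f a ha
    rw [Double.pos_mul_negAlg, add_sub_cancel_left] at hc
    -- The functional that reads the coefficient of `g`; it sends the span in the commutator
    -- condition into the image of `I`.
    let c := HeisMod.negCoeff 𝒴 g ∘ₗ
      HeisMod.ofDouble 𝒴 (Im := ∅) (Ip := ∅) (Set.empty_subset _) (Set.empty_subset _)
    have hcv : ∀ y h, c (Double.negAlg 𝒴.act 𝒴.dual.act (heisBeta 𝒴) ∅ ∅ y *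
        Double.grp 𝒴.act 𝒴.dual.act (heisBeta 𝒴) ∅ ∅ h) =
        if g = h then Submodule.Quotient.mk y else 0 := by
      intro y h
      have := HeisMod.ofDouble_apply 𝒴 (Im := ∅) (Ip := ∅) (Set.empty_subset _)
        (Set.empty_subset _) y h 1
      rw [map_one, mul_one] at this
      rw [LinearMap.comp_apply, this, HeisMod.negCoeff_vec]
    have h1 : Submodule.span ℂ {z | ∃ y ∈ I, ∃ g : G,
        z = Double.negAlg 𝒴.act 𝒴.dual.act (heisBeta 𝒴) ∅ ∅ y *
          Double.grp 𝒴.act 𝒴.dual.act (heisBeta 𝒴) ∅ ∅ g} ≤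
        ((idealSubmodule I).map (Submodule.mkQ (radical (heisD 𝒴)))).comap c := by
      rw [Submodule.span_le]
      rintro _ ⟨y, hy, h, rfl⟩
      rw [SetLike.mem_coe, Submodule.mem_comap, hcv]
      split_ifs
      · exact ⟨y, hy, rfl⟩
      · exact Submodule.zero_mem _
    have h2 := Submodule.mem_comap.1 (h1 hc)
    rw [map_sum] at h2
    simp only [hcv] at h2
    rw [Finset.sum_ite_eq, if_pos (Finset.mem_univ _)] at h2
    obtain ⟨z, hz, hzy⟩ := h2
    have h3 := (Submodule.Quotient.eq _).1 hzy
    have : heisD 𝒴 (f, g) a = z - (z - heisD 𝒴 (f, g) a) := by abel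
    rw [this]
    exact Submodule.sub_mem _ (Submodule.mem_sup_left hz) (Submodule.mem_sup_right h3)

/-- As for the negative ideals, with the coefficient `b` of `1 ⊗ g ⊗ b` and the operators `E_{v,g}`.
-/
theorem isPosIdeal_le (I : TwoSidedIdeal (TensorAlgebra ℂ (Module.Dual ℂ Y)))
    (hI : IsPosIdeal 𝒴.act 𝒴.dual.act (heisBeta 𝒴) I) {x : TensorAlgebra ℂ (Module.Dual ℂ Y)}
    (hx : x ∈ I) : x ∈ radical (heisE 𝒴) := by
  refine le_radical (S := idealSubmodule I ⊔ radical (heisE 𝒴)) ?_ ?_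
    (Submodule.mem_sup_left hx)
  · intro y hy
    obtain ⟨a, ha, b, hb, rfl⟩ := Submodule.mem_sup.1 hy
    rw [map_add, hI.positive a ha, algebraMapInv_of_mem_radical hb, add_zero]
  · rintro ⟨v, g⟩ y hy
    obtain ⟨a, ha, b, hb, rfl⟩ := Submodule.mem_sup.1 hy
    rw [map_add]
    refine Submodule.add_mem _ ?_ (Submodule.mem_sup_right (map_mem_radical hb _))
    have hc := hI.commutator v a ha
    rw [Double.posAlg_mul_neg, add_sub_cancel_left] at hc
    let c := HeisMod.posCoeff 𝒴 g ∘ₗ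
      HeisMod.ofDouble 𝒴 (Im := ∅) (Ip := ∅) (Set.empty_subset _) (Set.empty_subset _)
    have hcv : ∀ y h, c (Double.grp 𝒴.act 𝒴.dual.act (heisBeta 𝒴) ∅ ∅ h *
        Double.posAlg 𝒴.act 𝒴.dual.act (heisBeta 𝒴) ∅ ∅ y) =
        if g = h then Submodule.Quotient.mk y else 0 := by
      intro y h
      have := HeisMod.ofDouble_apply 𝒴 (Im := ∅) (Ip := ∅) (Set.empty_subset _)
        (Set.empty_subset _) 1 h y
      rw [map_one, one_mul] at this
      rw [LinearMap.comp_apply, this, HeisMod.posCoeff_vec]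
    have h1 : Submodule.span ℂ {z | ∃ y ∈ I, ∃ g : G,
        z = Double.grp 𝒴.act 𝒴.dual.act (heisBeta 𝒴) ∅ ∅ g *
          Double.posAlg 𝒴.act 𝒴.dual.act (heisBeta 𝒴) ∅ ∅ y} ≤
        ((idealSubmodule I).map (Submodule.mkQ (radical (heisE 𝒴)))).comap c := by
      rw [Submodule.span_le]
      rintro _ ⟨y, hy, h, rfl⟩
      rw [SetLike.mem_coe, Submodule.mem_comap, hcv]
      split_ifs
      · exact ⟨y, hy, rfl⟩
      · exact Submodule.zero_mem _
    have h2 := Submodule.mem_comap.1 (h1 hc)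
    rw [map_sum] at h2
    simp only [hcv] at h2
    rw [Finset.sum_ite_eq, if_pos (Finset.mem_univ _)] at h2
    obtain ⟨z, hz, hzy⟩ := h2
    have h3 := (Submodule.Quotient.eq _).1 hzy
    have : heisE 𝒴 (v, g) a = z - (z - heisE 𝒴 (v, g) a) := by abel
    rw [this]
    exact Submodule.sub_mem _ (Submodule.mem_sup_left hz) (Submodule.mem_sup_right h3)

theorem maxNegIdeal_eq :
    maxNegIdeal 𝒴.act 𝒴.dual.act (heisBeta 𝒴) = (heisD_isSkewLeibniz 𝒴).ideal :=
  le_antisymm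
    (sSup_le fun I hI _ hx => (IsSkewLeibniz.mem_ideal _).2 (isNegIdeal_le 𝒴 I hI hx))
    (le_sSup (isNegIdeal_ideal 𝒴))

theorem maxPosIdeal_eq :
    maxPosIdeal 𝒴.act 𝒴.dual.act (heisBeta 𝒴) = (heisE_isSkewLeibniz 𝒴).ideal :=
  le_antisymm
    (sSup_le fun I hI _ hx => (IsSkewLeibniz.mem_ideal _).2 (isPosIdeal_le 𝒴 I hI hx))
    (le_sSup (isPosIdeal_ideal 𝒴))

theorem mem_maxNegIdeal (x : TensorAlgebra ℂ Y) :
    x ∈ maxNegIdeal 𝒴.act 𝒴.dual.act (heisBeta 𝒴) ↔ x ∈ radical (heisD 𝒴) := by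
  rw [maxNegIdeal_eq, IsSkewLeibniz.mem_ideal]

theorem mem_maxPosIdeal (x : TensorAlgebra ℂ (Module.Dual ℂ Y)) :
    x ∈ maxPosIdeal 𝒴.act 𝒴.dual.act (heisBeta 𝒴) ↔ x ∈ radical (heisE 𝒴) := by
  rw [maxPosIdeal_eq, IsSkewLeibniz.mem_ideal]

end Heisenberg

/-! ### Homogeneous monomials -/

section HomMono

variable {G V A : Type*} [Group G] [DecidableEq G] [AddCommGroup V] [Module ℂ V]
  [Ring A] [Algebra ℂ A]

/-- Products of elements of `V` with homogeneous images in a graded algebra. -/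
inductive HomMono (𝒜 : GradedAlg ℂ G A) (n : V →ₗ[ℂ] A) : G → TensorAlgebra ℂ V → Prop
  | one : HomMono 𝒜 n 1 1
  | mul {g h : G} {v : V} {x : TensorAlgebra ℂ V} (hv : n v ∈ 𝒜.comp g) (hx : HomMono 𝒜 n h x) :
      HomMono 𝒜 n (g * h) (TensorAlgebra.ι ℂ v * x)

theorem HomMono.lift_mem {𝒜 : GradedAlg ℂ G A} {n : V →ₗ[ℂ] A} {g : G} {x : TensorAlgebra ℂ V}
    (hx : HomMono 𝒜 n g x) : TensorAlgebra.lift ℂ n x ∈ 𝒜.comp g := by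
  induction hx with
  | one => rw [map_one]; exact 𝒜.one_mem
  | mul hv _ ih =>
    rw [map_mul, TensorAlgebra.lift_ι_apply]
    exact 𝒜.mul_mem _ _ _ _ hv ih

theorem span_homMono (𝒜 : GradedAlg ℂ G A) (n : V →ₗ[ℂ] A)
    (hn : Submodule.span ℂ {v | ∃ g, n v ∈ 𝒜.comp g} = ⊤) (x : TensorAlgebra ℂ V) :
    x ∈ Submodule.span ℂ {x | ∃ g, HomMono 𝒜 n g x} := by
  induction x using tensorAlgebra_induction_left with
  | one => exact Submodule.subset_span ⟨1, .one⟩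
  | add x y hx hy => exact Submodule.add_mem _ hx hy
  | smul r x hx => exact Submodule.smul_mem _ _ hx
  | mul v x hx =>
    have hv : v ∈ Submodule.span ℂ {v | ∃ g, n v ∈ 𝒜.comp g} := by rw [hn]; trivial
    induction hv, hx using Submodule.span_induction₂ with
    | mem_mem v x hv hx =>
      obtain ⟨g, hv⟩ := hv
      obtain ⟨h, hx⟩ := hx
      exact Submodule.subset_span ⟨_, .mul hv hx⟩
    | zero_left => simp
    | zero_right => simp
    | add_left v w x _ _ _ h1 h2 => rw [map_add, add_mul]; exact Submodule.add_mem _ h1 h2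
    | add_right v x y _ _ _ h1 h2 => rw [mul_add]; exact Submodule.add_mem _ h1 h2
    | smul_left r v x _ _ h => rw [map_smul, smul_mul_assoc]; exact Submodule.smul_mem _ _ h
    | smul_right r v x _ _ h => rw [mul_smul_comm]; exact Submodule.smul_mem _ _ h

end HomMono

section Heisenberg

universe u v

variable {G : Type v} {Y : Type u} [Group G] [DecidableEq G] [AddCommGroup Y] [Module ℂ Y]
  [Fintype G] (𝒴 : YDMod ℂ G Y)

/-! ### The triangular decomposition of the braided Heisenberg double -/

/-- The map `T(Y) → 𝓗_Y`. -/
def Heis.negAlg : TensorAlgebra ℂ Y →ₐ[ℂ] Heis 𝒴 := TensorAlgebra.lift ℂ (Heis.neg 𝒴)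

/-- The map `T(Y*) → 𝓗_Y`. -/
def Heis.posAlg : TensorAlgebra ℂ (Module.Dual ℂ Y) →ₐ[ℂ] Heis 𝒴 :=
  TensorAlgebra.lift ℂ (Heis.pos 𝒴)

theorem Heis.grp_mul_neg (g : G) (v : Y) :
    Heis.grp 𝒴 g * Heis.neg 𝒴 v = Heis.neg 𝒴 (𝒴.act g v) * Heis.grp 𝒴 g :=
  Double.grp_neg 𝒴 _ _ g v

theorem Heis.grp_mul_pos (g : G) (f : Module.Dual ℂ Y) :
    Heis.grp 𝒴 g * Heis.pos 𝒴 f = Heis.pos 𝒴 (𝒴.dual.act g f) * Heis.grp 𝒴 g :=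
  Double.grp_pos 𝒴 _ _ g f

theorem Heis.pos_mul_neg (f : Module.Dual ℂ Y) (v : Y) :
    Heis.pos 𝒴 f * Heis.neg 𝒴 v =
      Heis.neg 𝒴 v * Heis.pos 𝒴 f + ∑ g, f (𝒴.proj g v) • Heis.grp 𝒴 g :=
  Double.pos_neg 𝒴 _ _ f v

theorem Heis.grp_mul_negAlg (g : G) (x : TensorAlgebra ℂ Y) :
    Heis.grp 𝒴 g * Heis.negAlg 𝒴 x = Heis.negAlg 𝒴 (tensorAct 𝒴.act g x) * Heis.grp 𝒴 g :=
  grp_mul_lift 𝒴 (fun g => Heis.grp 𝒴 g) (Heis.negAlg 𝒴)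
    (fun g v => by
      simp only [Heis.negAlg, TensorAlgebra.lift_ι_apply]; exact Heis.grp_mul_neg 𝒴 g v) g x

theorem Heis.pos_mul_negAlg (f : Module.Dual ℂ Y) (x : TensorAlgebra ℂ Y) :
    Heis.pos 𝒴 f * Heis.negAlg 𝒴 x = Heis.negAlg 𝒴 x * Heis.pos 𝒴 f +
      ∑ g, Heis.negAlg 𝒴 (heisD 𝒴 (f, g) x) * Heis.grp 𝒴 g :=
  Double.pos_mul_negAlg 𝒴 _ _ f x

theorem Heis.posAlg_mul_neg (v : Y) (x : TensorAlgebra ℂ (Module.Dual ℂ Y)) :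
    Heis.posAlg 𝒴 x * Heis.neg 𝒴 v = Heis.neg 𝒴 v * Heis.posAlg 𝒴 x +
      ∑ g, Heis.grp 𝒴 g * Heis.posAlg 𝒴 (heisE 𝒴 (v, g) x) :=
  Double.posAlg_mul_neg 𝒴 _ _ v x

/-- The map `T(Y) / radical → 𝓗_Y`. -/
def Heis.negQuot : NegQuot 𝒴 →ₗ[ℂ] Heis 𝒴 :=
  Submodule.liftQ _ (Heis.negAlg 𝒴).toLinearMap fun x hx =>
    Double.negAlg_eq_zero 𝒴 _ _ x ((mem_maxNegIdeal 𝒴 x).2 hx)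

/-- The map `T(Y*) / radical → 𝓗_Y`. -/
def Heis.posQuot : PosQuot 𝒴 →ₗ[ℂ] Heis 𝒴 :=
  Submodule.liftQ _ (Heis.posAlg 𝒴).toLinearMap fun x hx =>
    Double.posAlg_eq_zero 𝒴 _ _ x ((mem_maxPosIdeal 𝒴 x).2 hx)

/-- The map `a ⊗ g ⊗ b ↦ a g b`. -/
def Heis.ofMod : HeisMod 𝒴 →ₗ[ℂ] Heis 𝒴 :=
  ∑ g, LinearMap.mul' ℂ (Heis 𝒴) ∘ₗ TensorProduct.map
    (LinearMap.mulRight ℂ (Heis.grp 𝒴 g) ∘ₗ Heis.negQuot 𝒴) (Heis.posQuot 𝒴) ∘ₗ LinearMap.proj g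

theorem Heis.ofMod_single (g : G) (a : NegQuot 𝒴) (b : PosQuot 𝒴) :
    Heis.ofMod 𝒴 (Pi.single g (a ⊗ₜ[ℂ] b)) =
      Heis.negQuot 𝒴 a * Heis.grp 𝒴 g * Heis.posQuot 𝒴 b := by
  rw [Heis.ofMod, LinearMap.sum_apply, Finset.sum_eq_single g]
  · simp
  · intro h _ hne
    simp [hne]
  · simp

theorem Heis.ofMod_vec (g : G) (a b) :
    Heis.ofMod 𝒴 (HeisMod.vec 𝒴 g a b) =
      Heis.negAlg 𝒴 a * Heis.grp 𝒴 g * Heis.posAlg 𝒴 b :=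
  Heis.ofMod_single 𝒴 g _ _

/-- The coefficients of an element of `𝓗_Y` in the triangular decomposition. -/
def Heis.toMod : Heis 𝒴 →ₗ[ℂ] HeisMod 𝒴 :=
  HeisMod.ofDouble 𝒴 (fun x hx => (mem_maxNegIdeal 𝒴 x).1 hx)
    (fun x hx => (mem_maxPosIdeal 𝒴 x).1 hx)

theorem Heis.toMod_apply (a g b) :
    Heis.toMod 𝒴 (Heis.negAlg 𝒴 a * Heis.grp 𝒴 g * Heis.posAlg 𝒴 b) = HeisMod.vec 𝒴 g a b :=
  HeisMod.ofDouble_apply 𝒴 _ _ a g b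

/-- The span contains `1` and is stable under left multiplication by the generators. Only `f` needs
an argument: the commutator formula moves it past `a`, and the relation with `g` moves it into the
last factor. -/
theorem Heis.mem_span (z : Heis 𝒴) : z ∈ Submodule.span ℂ
    {z | ∃ a g b, z = Heis.negAlg 𝒴 a * Heis.grp 𝒴 g * Heis.posAlg 𝒴 b} := by
  have key : ∀ z : Heis 𝒴, Submodule.span ℂ
      {z | ∃ a g b, z = Heis.negAlg 𝒴 a * Heis.grp 𝒴 g * Heis.posAlg 𝒴 b} ≤
      (Submodule.span ℂ {z | ∃ a g b, z = Heis.negAlg 𝒴 a * Heis.grp 𝒴 g * Heis.posAlg 𝒴 b}).comap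
        (LinearMap.mulLeft ℂ z) := by
    intro z
    induction z using Double.mk_induction with
    | smul_one r =>
      intro s hs
      rw [Submodule.mem_comap, LinearMap.mulLeft_apply, ← Algebra.smul_def]
      exact Submodule.smul_mem _ _ hs
    | neg k v hv =>
      rw [Submodule.span_le]
      rintro _ ⟨a, g, b, rfl⟩
      refine Submodule.subset_span ⟨TensorAlgebra.ι ℂ v * a, g, b, ?_⟩
      change Heis.neg 𝒴 v * _ = _
      rw [map_mul (Heis.negAlg 𝒴), Heis.negAlg, TensorAlgebra.lift_ι_apply, mul_assoc, mul_assoc,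
        mul_assoc]
    | pos f =>
      rw [Submodule.span_le]
      rintro _ ⟨a, g, b, rfl⟩
      rw [SetLike.mem_coe, Submodule.mem_comap, LinearMap.mulLeft_apply]
      change Heis.pos 𝒴 f * _ ∈ _
      rw [← mul_assoc, ← mul_assoc, Heis.pos_mul_negAlg, add_mul, add_mul]
      refine Submodule.add_mem _ (Submodule.subset_span
        ⟨a, g, TensorAlgebra.ι ℂ (𝒴.dual.act g⁻¹ f) * b, ?_⟩) ?_
      · have := Heis.grp_mul_pos 𝒴 g (𝒴.dual.act g⁻¹ f)
        rw [← Module.End.mul_apply, ← map_mul, mul_inv_cancel, map_one, Module.End.one_apply]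
          at this
        rw [map_mul, Heis.posAlg, TensorAlgebra.lift_ι_apply, ← mul_assoc, mul_assoc _ _ (pos 𝒴 _),
          this, mul_assoc _ (pos 𝒴 f)]
      · rw [Finset.sum_mul, Finset.sum_mul]
        refine Submodule.sum_mem _ fun k _ => Submodule.subset_span
          ⟨heisD 𝒴 (f, k) a, k * g, b, ?_⟩
        rw [map_mul, ← mul_assoc]
    | grp k r =>
      rw [Submodule.span_le]
      rintro _ ⟨a, g, b, rfl⟩
      rw [SetLike.mem_coe, Submodule.mem_comap, LinearMap.mulLeft_apply, smul_mul_assoc]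
      refine Submodule.smul_mem _ _ (Submodule.subset_span ⟨tensorAct 𝒴.act k a, k * g, b, ?_⟩)
      change Heis.grp 𝒴 k * _ = _
      rw [map_mul, ← mul_assoc, ← mul_assoc, ← mul_assoc, Heis.grp_mul_negAlg]
    | add a b ha hb =>
      intro s hs
      rw [Submodule.mem_comap, LinearMap.mulLeft_apply, add_mul]
      exact Submodule.add_mem _ (Submodule.mem_comap.1 (ha hs)) (Submodule.mem_comap.1 (hb hs))
    | mul a b ha hb =>
      intro s hs
      rw [Submodule.mem_comap, LinearMap.mulLeft_apply, mul_assoc]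
      exact ha (hb hs)
  have h1 : (1 : Heis 𝒴) ∈ Submodule.span ℂ
      {z | ∃ a g b, z = Heis.negAlg 𝒴 a * Heis.grp 𝒴 g * Heis.posAlg 𝒴 b} :=
    Submodule.subset_span ⟨1, 1, 1, by simp⟩
  simpa using key z h1

/-- The triangular decomposition of `𝓗_Y`. -/
def Heis.equivMod : HeisMod 𝒴 ≃ₗ[ℂ] Heis 𝒴 :=
  LinearEquiv.ofLinearMap (Heis.ofMod 𝒴) (Heis.toMod 𝒴)
    (LinearMap.ext fun z => by
      induction Heis.mem_span 𝒴 z using Submodule.span_induction with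
      | mem z hz =>
        obtain ⟨a, g, b, rfl⟩ := hz
        rw [LinearMap.comp_apply, Heis.toMod_apply, Heis.ofMod_vec, LinearMap.id_apply]
      | zero => simp
      | add x y _ _ hx hy => rw [map_add, hx, hy, map_add]
      | smul r x _ hx => rw [map_smul, hx, map_smul])
    (HeisMod.ext_vec 𝒴 fun h a b => by
      rw [LinearMap.comp_apply, Heis.ofMod_vec, Heis.toMod_apply, LinearMap.id_apply])

theorem Heis.negAlg_eq_zero_iff (x : TensorAlgebra ℂ Y) :
    Heis.negAlg 𝒴 x = 0 ↔ x ∈ radical (heisD 𝒴) := by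
  constructor
  · intro hx
    have := congrArg (HeisMod.negCoeff 𝒴 1) (Heis.toMod_apply 𝒴 x 1 1)
    rw [HeisMod.negCoeff_vec, if_pos rfl, hx] at this
    simpa using this.symm
  · intro hx
    exact Double.negAlg_eq_zero 𝒴 _ _ x ((mem_maxNegIdeal 𝒴 x).2 hx)

theorem Heis.posAlg_eq_zero_iff (x : TensorAlgebra ℂ (Module.Dual ℂ Y)) :
    Heis.posAlg 𝒴 x = 0 ↔ x ∈ radical (heisE 𝒴) := by
  constructor
  · intro hx
    have := congrArg (HeisMod.posCoeff 𝒴 1) (Heis.toMod_apply 𝒴 1 1 x)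
    rw [HeisMod.posCoeff_vec, if_pos rfl, hx] at this
    simpa using this.symm
  · intro hx
    exact Double.posAlg_eq_zero 𝒴 _ _ x ((mem_maxPosIdeal 𝒴 x).2 hx)

theorem Heis.negAlg_eq_zero_of_sum (x : G → TensorAlgebra ℂ Y)
    (hx : ∑ g, Heis.negAlg 𝒴 (x g) * Heis.grp 𝒴 g = 0) (g : G) : x g ∈ radical (heisD 𝒴) := by
  have h := congrArg (fun z => HeisMod.negCoeff 𝒴 g (Heis.toMod 𝒴 z)) hx
  have e : ∀ k, HeisMod.negCoeff 𝒴 g (Heis.toMod 𝒴 (Heis.negAlg 𝒴 (x k) * Heis.grp 𝒴 k)) =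
      if g = k then Submodule.Quotient.mk (x k) else 0 := by
    intro k
    rw [← HeisMod.negCoeff_vec, ← Heis.toMod_apply, map_one, mul_one]
  simp only [map_sum, e, map_zero, Finset.sum_ite_eq, Finset.mem_univ, if_true] at h
  simpa using h

theorem Heis.posAlg_eq_zero_of_sum (x : G → TensorAlgebra ℂ (Module.Dual ℂ Y))
    (hx : ∑ g, Heis.grp 𝒴 g * Heis.posAlg 𝒴 (x g) = 0) (g : G) : x g ∈ radical (heisE 𝒴) := by
  have h := congrArg (fun z => HeisMod.posCoeff 𝒴 g (Heis.toMod 𝒴 z)) hx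
  have e : ∀ k, HeisMod.posCoeff 𝒴 g (Heis.toMod 𝒴 (Heis.grp 𝒴 k * Heis.posAlg 𝒴 (x k))) =
      if g = k then Submodule.Quotient.mk (x k) else 0 := by
    intro k
    rw [← HeisMod.posCoeff_vec, ← Heis.toMod_apply, map_one, one_mul]
  simp only [map_sum, e, map_zero, Finset.sum_ite_eq, Finset.mem_univ, if_true] at h
  simpa using h

/-- An element of positive degree of `T(Y)` that commutes with `Y*` in `𝓗_Y` vanishes there. -/
theorem Heis.negAlg_eq_zero_of_commute (x : TensorAlgebra ℂ Y)
    (h0 : TensorAlgebra.algebraMapInv x = 0)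
    (h : ∀ f, Heis.pos 𝒴 f * Heis.negAlg 𝒴 x = Heis.negAlg 𝒴 x * Heis.pos 𝒴 f) :
    Heis.negAlg 𝒴 x = 0 := by
  rw [Heis.negAlg_eq_zero_iff]
  refine mem_radical_of_forall h0 fun ⟨f, g⟩ => ?_
  -- Commuting with `f` means `∑ g, D_{f,g}(x) g = 0`, and the triangular decomposition separates
  -- the summands.
  refine Heis.negAlg_eq_zero_of_sum 𝒴 (fun g => heisD 𝒴 (f, g) x) ?_ g
  have := h f
  rwa [Heis.pos_mul_negAlg, add_eq_left] at this

/-- An element of positive degree of `T(Y*)` that commutes with `Y` in `𝓗_Y` vanishes there. -/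
theorem Heis.posAlg_eq_zero_of_commute (x : TensorAlgebra ℂ (Module.Dual ℂ Y))
    (h0 : TensorAlgebra.algebraMapInv x = 0)
    (h : ∀ v, Heis.posAlg 𝒴 x * Heis.neg 𝒴 v = Heis.neg 𝒴 v * Heis.posAlg 𝒴 x) :
    Heis.posAlg 𝒴 x = 0 := by
  rw [Heis.posAlg_eq_zero_iff]
  refine mem_radical_of_forall h0 fun ⟨v, g⟩ => ?_
  refine Heis.posAlg_eq_zero_of_sum 𝒴 (fun g => heisE 𝒴 (v, g) x) ?_ g
  have := h v
  rwa [Heis.posAlg_mul_neg, add_eq_left] at this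

theorem Heis.span_neg_homogeneous :
    Submodule.span ℂ {v | ∃ g, Heis.neg 𝒴 v ∈ (heisGrading 𝒴).comp g} = ⊤ := by
  rw [eq_top_iff]
  intro v _
  induction v using 𝒴.induction with
  | hom g v hv => exact Submodule.subset_span ⟨g, Heis.neg_mem 𝒴 hv⟩
  | add v w hv hw => exact Submodule.add_mem _ (hv trivial) (hw trivial)
  | zero => exact Submodule.zero_mem _

/-- A basis of `𝓗_Y` adapted to the triangular decomposition and to the grading. -/
theorem Heis.exists_basis : ∃ (I J : Type u) (_ : Nonempty I) (_ : Nonempty J)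
    (bm : Module.Basis I ℂ (NegQuot 𝒴)) (bp : Module.Basis J ℂ (PosQuot 𝒴))
    (b : Module.Basis (Σ _ : G, I × J) ℂ (Heis 𝒴)),
    (∀ i, ∃ k, Heis.negQuot 𝒴 (bm i) ∈ (heisGrading 𝒴).comp k) ∧
    ∀ g i j, b ⟨g, i, j⟩ =
      Heis.negQuot 𝒴 (bm i) * Heis.grp 𝒴 g * Heis.posQuot 𝒴 (bp j) := by
  -- The first factor gets a basis of homogeneous elements, chosen from a homogeneous spanning set.
  -- Homogeneity ensures that the cocycle twist only rescales the resulting basis.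
  have hs : (⊤ : Submodule ℂ (NegQuot 𝒴)) ≤
      Submodule.span ℂ {a | ∃ k, Heis.negQuot 𝒴 a ∈ (heisGrading 𝒴).comp k} := by
    rintro a -
    obtain ⟨x, rfl⟩ := Submodule.Quotient.mk_surjective _ a
    have hx := span_homMono (heisGrading 𝒴) (Heis.neg 𝒴)
      (Heis.span_neg_homogeneous 𝒴) x
    refine (Submodule.span_le (p := (Submodule.span ℂ
      {a | ∃ k, Heis.negQuot 𝒴 a ∈ (heisGrading 𝒴).comp k}).comap
      (Submodule.mkQ (radical (heisD 𝒴))))).2 ?_ hx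
    rintro x ⟨g, hg⟩
    exact Submodule.subset_span ⟨g, hg.lift_mem⟩
  let bm := Module.Basis.ofSpan hs
  let bp := Module.Basis.ofVectorSpace ℂ (PosQuot 𝒴)
  have n1 : Nontrivial (NegQuot 𝒴) := by
    refine ⟨Submodule.Quotient.mk 1, 0, fun h => ?_⟩
    have := algebraMapInv_of_mem_radical ((Submodule.Quotient.mk_eq_zero _).1 h)
    simp at this
  have n2 : Nontrivial (PosQuot 𝒴) := by
    refine ⟨Submodule.Quotient.mk 1, 0, fun h => ?_⟩
    have := algebraMapInv_of_mem_radical ((Submodule.Quotient.mk_eq_zero _).1 h)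
    simp at this
  refine ⟨_, _, bm.index_nonempty, bp.index_nonempty, bm, bp,
    (Pi.basis fun _ : G => bm.tensorProduct bp).map (Heis.equivMod 𝒴), fun i => ?_, fun g i j => ?_⟩
  · exact Module.Basis.ofSpan_subset hs ⟨i, rfl⟩
  · rw [Module.Basis.map_apply, Pi.basis_apply, Module.Basis.tensorProduct_apply]
    exact Heis.ofMod_single 𝒴 g _ _

end Heisenberg

/-! ### Twists of extensions of scalars -/

theorem cocycleTwist_of_mul_of_mem {G R ℬ : Type*} [Group G] [DecidableEq G] [Fintype G]
    [CommRing R] [Ring ℬ] [Algebra R ℬ] (𝒳 : GradedAlg R G ℬ) (μ : Cocycle G Rˣ)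
    {g h : G} {a b : ℬ} (ha : a ∈ 𝒳.comp g) (hb : b ∈ 𝒳.comp h) :
    CocycleTwist.of 𝒳 μ a * CocycleTwist.of 𝒳 μ b =
      (μ g h : R) • CocycleTwist.of 𝒳 μ (a * b) :=
  𝒳.starMul_of_mem μ ha hb

/-- As `μ(1, g) = 1`, the twist does not affect multiplication by elements of degree `1`, in
particular by `Y*`. -/
theorem cocycleTwist_of_mul_left {G R ℬ : Type*} [Group G] [DecidableEq G] [Fintype G]
    [CommRing R] [Ring ℬ] [Algebra R ℬ] (𝒳 : GradedAlg R G ℬ) (μ : Cocycle G Rˣ) {a : ℬ} (ha : a ∈ 𝒳.comp 1)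
    (b : ℬ) : CocycleTwist.of 𝒳 μ a * CocycleTwist.of 𝒳 μ b = CocycleTwist.of 𝒳 μ (a * b) := by
  induction b using 𝒳.induction with
  | hom g b hb =>
    rw [cocycleTwist_of_mul_of_mem 𝒳 μ ha hb, μ.one_left, Units.val_one, one_smul]
  | add v w hv hw => rw [map_add, mul_add, hv, hw, mul_add, map_add]
  | zero => simp

theorem cocycleTwist_of_mul_right {G R ℬ : Type*} [Group G] [DecidableEq G] [Fintype G]
    [CommRing R] [Ring ℬ] [Algebra R ℬ] (𝒳 : GradedAlg R G ℬ) (μ : Cocycle G Rˣ) {b : ℬ} (hb : b ∈ 𝒳.comp 1)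
    (a : ℬ) : CocycleTwist.of 𝒳 μ a * CocycleTwist.of 𝒳 μ b = CocycleTwist.of 𝒳 μ (a * b) := by
  induction a using 𝒳.induction with
  | hom g a ha =>
    rw [cocycleTwist_of_mul_of_mem 𝒳 μ ha hb, μ.one_right, Units.val_one, one_smul]
  | add v w hv hw => rw [map_add, add_mul, hv, hw, add_mul, map_add]
  | zero => simp

section ExtTwist

variable {G A : Type*} [Group G] [DecidableEq G] [Fintype G] [Ring A] [Algebra ℂ A]
  (𝒜 : GradedAlg ℂ G A) (R : Type*) [CommRing R] [Algebra ℂ R] (μ : Cocycle G Rˣ)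

/-- The map `A → (R ⊗ A)_μ`. -/
def extOf (a : A) : CocycleTwist (𝒜.baseChange R) μ := CocycleTwist.of _ μ (1 ⊗ₜ[ℂ] a)

theorem extOf_add (a b : A) : extOf 𝒜 R μ (a + b) = extOf 𝒜 R μ a + extOf 𝒜 R μ b := by
  simp [extOf, TensorProduct.tmul_add]

theorem extOf_zero : extOf 𝒜 R μ 0 = 0 := by simp [extOf]

theorem extOf_smul (c : ℂ) (a : A) : extOf 𝒜 R μ (c • a) = algebraMap ℂ R c • extOf 𝒜 R μ a := by
  rw [extOf, extOf, ← map_smul, TensorProduct.tmul_smul, algebraMap_smul]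

theorem extOf_sum {κ : Type*} (s : Finset κ) (a : κ → A) :
    extOf 𝒜 R μ (∑ i ∈ s, a i) = ∑ i ∈ s, extOf 𝒜 R μ (a i) := by
  simp [extOf, TensorProduct.tmul_sum]

theorem extOf_one : extOf 𝒜 R μ 1 = 1 := rfl

theorem extOf_mul_of_mem {g h : G} {a b : A} (ha : a ∈ 𝒜.comp g) (hb : b ∈ 𝒜.comp h) :
    extOf 𝒜 R μ a * extOf 𝒜 R μ b = (μ g h : R) • extOf 𝒜 R μ (a * b) := by
  rw [extOf, extOf, cocycleTwist_of_mul_of_mem (𝒜.baseChange R) μ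
    (Submodule.tmul_mem_baseChange_of_mem (1 : R) ha)
    (Submodule.tmul_mem_baseChange_of_mem (1 : R) hb), Algebra.TensorProduct.tmul_mul_tmul,
    mul_one, extOf]

theorem extOf_mul_of (a : A) (ha : a ∈ 𝒜.comp 1) (z : R ⊗[ℂ] A) :
    extOf 𝒜 R μ a * CocycleTwist.of _ μ z = CocycleTwist.of _ μ ((1 ⊗ₜ a) * z) :=
  cocycleTwist_of_mul_left _ μ (Submodule.tmul_mem_baseChange_of_mem (1 : R) ha) z

theorem of_mul_extOf (a : A) (ha : a ∈ 𝒜.comp 1) (z : R ⊗[ℂ] A) :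
    CocycleTwist.of _ μ z * extOf 𝒜 R μ a = CocycleTwist.of _ μ (z * (1 ⊗ₜ a)) :=
  cocycleTwist_of_mul_right _ μ (Submodule.tmul_mem_baseChange_of_mem (1 : R) ha) z

theorem extOf_mul (a b : A) (ha : a ∈ 𝒜.comp 1) :
    extOf 𝒜 R μ a * extOf 𝒜 R μ b = extOf 𝒜 R μ (a * b) := by
  rw [extOf.eq_1 𝒜 R μ b, extOf_mul_of 𝒜 R μ a ha, extOf, Algebra.TensorProduct.tmul_mul_tmul,
    mul_one]

theorem mul_extOf (a b : A) (hb : b ∈ 𝒜.comp 1) :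
    extOf 𝒜 R μ a * extOf 𝒜 R μ b = extOf 𝒜 R μ (a * b) := by
  rw [extOf.eq_1 𝒜 R μ a, of_mul_extOf 𝒜 R μ b hb, extOf, Algebra.TensorProduct.tmul_mul_tmul,
    mul_one]

/-- The span of the image of a subspace of `A` contains the image of its linear span. -/
theorem extOf_mem_span {s : Set A} {a : A} (ha : a ∈ Submodule.span ℂ s) :
    extOf 𝒜 R μ a ∈ Submodule.span R (extOf 𝒜 R μ '' s) := by
  induction ha using Submodule.span_induction with
  | mem x hx => exact Submodule.subset_span ⟨x, hx, rfl⟩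
  | zero => rw [extOf_zero]; exact Submodule.zero_mem _
  | add x y _ _ hx hy => rw [extOf_add]; exact Submodule.add_mem _ hx hy
  | smul c x _ hx => rw [extOf_smul]; exact Submodule.smul_mem _ _ hx

section Lift

variable {V : Type*} [AddCommGroup V] [Module ℂ V] (n : V →ₗ[ℂ] A)
  (hn : Submodule.span ℂ {v | ∃ g, n v ∈ 𝒜.comp g} = ⊤)
  (N : TensorAlgebra R (R ⊗[ℂ] V) →ₐ[R] CocycleTwist (𝒜.baseChange R) μ)
  (hN : ∀ v, N (TensorAlgebra.ι R (1 ⊗ₜ v)) = extOf 𝒜 R μ (n v))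

include hn hN

theorem lift_ι_mem_span (w : R ⊗[ℂ] V) : N (TensorAlgebra.ι R w) ∈
    Submodule.span R {z | ∃ g v, n v ∈ 𝒜.comp g ∧ z = extOf 𝒜 R μ (n v)} := by
  induction w with
  | zero => simp
  | add x y hx hy => rw [map_add, map_add]; exact Submodule.add_mem _ hx hy
  | tmul r v =>
    rw [← mul_one r, ← smul_eq_mul, ← TensorProduct.smul_tmul', map_smul, map_smul, hN]
    refine Submodule.smul_mem _ _ ?_
    have hv : v ∈ Submodule.span ℂ {v | ∃ g, n v ∈ 𝒜.comp g} := by rw [hn]; trivial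
    induction hv using Submodule.span_induction with
    | mem v hv =>
      obtain ⟨g, hg⟩ := hv
      exact Submodule.subset_span ⟨g, v, hg, rfl⟩
    | zero => rw [map_zero, extOf_zero]; exact Submodule.zero_mem _
    | add x y _ _ hx hy => rw [map_add, extOf_add]; exact Submodule.add_mem _ hx hy
    | smul c x _ hx => rw [map_smul, extOf_smul]; exact Submodule.smul_mem _ _ hx

/-- `N` is not the extension of scalars of the untwisted map, but on homogeneous monomials the
products `⋆` and `·` differ by the scalar `μ(g, h)`, so the image lies in the span of untwisted
monomials. -/
theorem lift_mem_span_homMono (x : TensorAlgebra R (R ⊗[ℂ] V)) :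
    N x ∈ Submodule.span R {z | ∃ g y, HomMono 𝒜 n g y ∧
      z = extOf 𝒜 R μ (TensorAlgebra.lift ℂ n y)} := by
  induction x using tensorAlgebra_induction_left with
  | one => exact Submodule.subset_span ⟨1, 1, .one, by rw [map_one, map_one, extOf_one]⟩
  | add x y hx hy => rw [map_add]; exact Submodule.add_mem _ hx hy
  | smul r x hx => rw [map_smul]; exact Submodule.smul_mem _ _ hx
  | mul w x hx =>
    rw [map_mul]
    refine (Submodule.mul_le (P := Submodule.span R {z | ∃ g y, HomMono 𝒜 n g y ∧
      z = extOf 𝒜 R μ (TensorAlgebra.lift ℂ n y)})).1 ?_ _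
      (lift_ι_mem_span 𝒜 R μ n hn N hN w) _ hx
    rw [Submodule.span_mul_span, Submodule.span_le]
    rintro _ ⟨_, ⟨g, v, hv, rfl⟩, _, ⟨h, y, hy, rfl⟩, rfl⟩
    simp only
    rw [extOf_mul_of_mem 𝒜 R μ hv hy.lift_mem]
    refine Submodule.smul_mem _ _ (Submodule.subset_span ⟨_, _, .mul hv hy, ?_⟩)
    rw [map_mul, TensorAlgebra.lift_ι_apply]

/-- Replaces a lift without constant term over `R` by lifts without constant term over `ℂ`, which is
what the vanishing criteria in `𝓗_Y` require. -/
theorem lift_mem_span_of_algebraMapInv_eq_zero (x : TensorAlgebra R (R ⊗[ℂ] V))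
    (hx : TensorAlgebra.algebraMapInv x = 0) :
    N x ∈ Submodule.span R {z | ∃ y, TensorAlgebra.algebraMapInv y = 0 ∧
      z = extOf 𝒜 R μ (TensorAlgebra.lift ℂ n y)} := by
  -- Subtracting the constant term gives a statement about all `x`, to which the induction applies.
  suffices h : ∀ x, N x - TensorAlgebra.algebraMapInv x • 1 ∈ Submodule.span R
      {z | ∃ y, TensorAlgebra.algebraMapInv y = 0 ∧
        z = extOf 𝒜 R μ (TensorAlgebra.lift ℂ n y)} by
    simpa [hx] using h x
  clear hx x
  intro x
  induction x using tensorAlgebra_induction_left with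
  | one => simp
  | add x y hx hy =>
    rw [map_add, map_add, add_smul, add_sub_add_comm]
    exact Submodule.add_mem _ hx hy
  | smul r x hx =>
    rw [map_smul, map_smul, smul_assoc, ← smul_sub]
    exact Submodule.smul_mem _ _ hx
  | mul w x _ =>
    have e : TensorAlgebra.algebraMapInv (TensorAlgebra.ι R w * x) = 0 := by
      simp [TensorAlgebra.algebraMapInv]
    rw [e, zero_smul, sub_zero, map_mul]
    refine (Submodule.mul_le (P := Submodule.span R
      {z | ∃ y, TensorAlgebra.algebraMapInv y = 0 ∧
        z = extOf 𝒜 R μ (TensorAlgebra.lift ℂ n y)})).1 ?_ _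
      (lift_ι_mem_span 𝒜 R μ n hn N hN w) _ (lift_mem_span_homMono 𝒜 R μ n hn N hN x)
    rw [Submodule.span_mul_span, Submodule.span_le]
    rintro _ ⟨_, ⟨g, v, hv, rfl⟩, _, ⟨h, y, hy, rfl⟩, rfl⟩
    simp only
    rw [extOf_mul_of_mem 𝒜 R μ hv hy.lift_mem]
    refine Submodule.smul_mem _ _ (Submodule.subset_span ⟨TensorAlgebra.ι ℂ v * y, ?_, ?_⟩)
    · simp [TensorAlgebra.algebraMapInv]
    · rw [map_mul, TensorAlgebra.lift_ι_apply]

/-- The scalars `μ(g, h)` are units, so each untwisted homogeneous monomial can be recovered from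
the twisted one. -/
theorem extOf_lift_mem_range (x : TensorAlgebra ℂ V) :
    extOf 𝒜 R μ (TensorAlgebra.lift ℂ n x) ∈ N.range := by
  have hm : ∀ g x, HomMono 𝒜 n g x → extOf 𝒜 R μ (TensorAlgebra.lift ℂ n x) ∈ N.range := by
    intro g x hx
    induction hx with
    | one => rw [map_one, extOf_one]; exact one_mem _
    | @mul g h v x hv hx ih =>
      have e := extOf_mul_of_mem 𝒜 R μ hv hx.lift_mem
      have e2 : extOf 𝒜 R μ (TensorAlgebra.lift ℂ n (TensorAlgebra.ι ℂ v * x)) =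
          ((μ g h)⁻¹ : Rˣ).val • (extOf 𝒜 R μ (n v) * extOf 𝒜 R μ (TensorAlgebra.lift ℂ n x)) := by
        rw [e, smul_smul, Units.inv_mul, one_smul, map_mul, TensorAlgebra.lift_ι_apply]
      rw [e2]
      exact Subalgebra.smul_mem _ (mul_mem (AlgHom.mem_range _ |>.2 ⟨_, hN v⟩) ih) _
  induction span_homMono 𝒜 n hn x using Submodule.span_induction with
  | mem x hx =>
    obtain ⟨g, hg⟩ := hx
    exact hm g x hg
  | zero => rw [map_zero, extOf_zero]; exact zero_mem _
  | add x y _ _ hx hy => rw [map_add, extOf_add]; exact add_mem hx hy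
  | smul c x _ hx => rw [map_smul, extOf_smul]; exact Subalgebra.smul_mem _ hx _

theorem range_lift_eq_span :
    Subalgebra.toSubmodule N.range =
      Submodule.span R (Set.range fun x => extOf 𝒜 R μ (TensorAlgebra.lift ℂ n x)) := by
  apply le_antisymm
  · rintro _ ⟨x, rfl⟩
    refine Submodule.span_mono ?_ (lift_mem_span_homMono 𝒜 R μ n hn N hN x)
    rintro _ ⟨g, y, _, rfl⟩
    exact ⟨y, rfl⟩
  · rw [Submodule.span_le]
    rintro _ ⟨x, rfl⟩
    exact extOf_lift_mem_range 𝒜 R μ n hn N hN x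

end Lift

theorem span_extOf_basis {Q I : Type*} [AddCommGroup Q] [Module ℂ Q] (b : Module.Basis I ℂ Q)
    (q : Q →ₗ[ℂ] A) :
    Submodule.span R (Set.range fun i => extOf 𝒜 R μ (q (b i))) =
      Submodule.span R (Set.range fun x => extOf 𝒜 R μ (q x)) := by
  apply le_antisymm
  · refine Submodule.span_mono ?_
    rintro _ ⟨i, rfl⟩
    exact ⟨b i, rfl⟩
  · rw [Submodule.span_le]
    rintro _ ⟨x, rfl⟩
    have : q x ∈ Submodule.span ℂ (Set.range fun i => q (b i)) := by
      rw [show (Set.range fun i => q (b i)) = q '' Set.range b from (Set.range_comp q b),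
        ← Submodule.map_span, b.span_eq]
      exact ⟨x, trivial, rfl⟩
    have := extOf_mem_span 𝒜 R μ this
    rwa [← Set.range_comp] at this

end ExtTwist

/-! ### Slices -/

section Slice

variable {A : Type*} [Ring A] [Algebra ℂ A] {R : Type*} [CommRing R] [Algebra ℂ R]

/-- The map `l ⊗ id : R ⊗ A → A` for a functional `l` on `R`. -/
def slice (A : Type*) [Ring A] [Algebra ℂ A] (l : R →ₗ[ℂ] ℂ) : R ⊗[ℂ] A →ₗ[ℂ] A :=
  (TensorProduct.lid ℂ A).toLinearMap ∘ₗ l.rTensor A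

theorem slice_tmul (l : R →ₗ[ℂ] ℂ) (r : R) (a : A) : slice A l (r ⊗ₜ a) = l r • a := by
  simp [slice]

theorem slice_mul_left (l : R →ₗ[ℂ] ℂ) (a : A) (z : R ⊗[ℂ] A) :
    slice A l ((1 ⊗ₜ a) * z) = a * slice A l z := by
  induction z with
  | zero => simp
  | tmul r b => simp [slice_tmul]
  | add x y hx hy => rw [mul_add, map_add, hx, hy, map_add, mul_add]

theorem slice_mul_right (l : R →ₗ[ℂ] ℂ) (a : A) (z : R ⊗[ℂ] A) :
    slice A l (z * (1 ⊗ₜ a)) = slice A l z * a := by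
  induction z with
  | zero => simp
  | tmul r b => simp [slice_tmul]
  | add x y hx hy => rw [add_mul, map_add, hx, hy, map_add, add_mul]

/-- The coordinates of `z` with respect to a `ℂ`-basis of `R` are slices. -/
theorem eq_zero_of_slice {z : R ⊗[ℂ] A} (hz : ∀ l : R →ₗ[ℂ] ℂ, slice A l z = 0) : z = 0 := by
  classical
  let b := Module.Basis.ofVectorSpace ℂ R
  rw [← LinearEquiv.map_eq_zero_iff (TensorProduct.equivFinsuppOfBasisLeft b)]
  ext i
  rw [TensorProduct.equivFinsuppOfBasisLeft_apply]
  exact hz (b.coord i)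

theorem slice_mem (l : R →ₗ[ℂ] ℂ) (S : Submodule ℂ A) {z : R ⊗[ℂ] A}
    (hz : z ∈ S.baseChange R) : slice A l z ∈ S := by
  rw [Submodule.baseChange_eq_span] at hz
  -- All `l` are treated together, since a scalar `r ∈ R` in front of `z` is absorbed into the
  -- functional `s ↦ l (r s)`.
  refine Submodule.span_induction (p := fun z _ => ∀ l : R →ₗ[ℂ] ℂ, slice A l z ∈ S)
    ?_ ?_ ?_ ?_ hz l
  · rintro _ ⟨s, hs, rfl⟩ l
    have : slice A l (1 ⊗ₜ[ℂ] s) ∈ S := by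
      rw [slice_tmul]; exact Submodule.smul_mem _ _ hs
    exact this
  · intro l; rw [map_zero]; exact Submodule.zero_mem _
  · intro x y _ _ hx hy l; rw [map_add]; exact Submodule.add_mem _ (hx l) (hy l)
  · intro r x _ hx l
    have : slice A l (r • x) = slice A (l ∘ₗ LinearMap.mulLeft ℂ r) x := by
      clear hx
      rename_i hs
      clear hs
      induction x with
      | zero => simp
      | tmul s a => simp [TensorProduct.smul_tmul', slice_tmul]
      | add x y hx hy => rw [smul_add, map_add, hx, hy, map_add]
    rw [this]
    exact hx _

end Slice

/-! ### Bases adapted to a triangular decomposition -/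

theorem exists_basis_of_injective {R H I M : Type*} [CommRing R] [AddCommGroup H] [Module R H]
    {eN : I → H} [AddCommGroup M] [Module R M] (f : M →ₗ[R] H)
    (hf : Function.Injective f) (hli : LinearIndependent R eN)
    (hr : LinearMap.range f = Submodule.span R (Set.range eN)) :
    ∃ c : Module.Basis I R M, ∀ i, f (c i) = eN i := by
  let e : M ≃ₗ[R] Submodule.span R (Set.range eN) :=
    LinearEquiv.ofInjective f hf ≪≫ₗ LinearEquiv.ofEq _ _ hr
  refine ⟨(Module.Basis.span hli).map e.symm, fun i => ?_⟩
  have he : ∀ x, f x = (e x : H) := fun x => rfl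
  rw [he, Module.Basis.map_apply, LinearEquiv.apply_symm_apply, Module.Basis.span_apply]

section TripleBasis

variable {R H G I J : Type*} [CommRing R] [Ring H] [Algebra R H] {eN : I → H} {γ : G → H}
  {eP : J → H} (b : Module.Basis (Σ _ : G, I × J) R H)
  (hb : ∀ g i j, b ⟨g, i, j⟩ = eN i * γ g * eP j)

include hb

/-- Multiplying on the right by one fixed `eP j` turns the sum into a combination of basis vectors,
and different `g` involve different vectors. -/
theorem eq_zero_of_sum_mul_grp [Fintype G] [DecidableEq G] [Nonempty J] (y : G → H)
    (hy : ∀ g, y g ∈ Submodule.span R (Set.range eN)) (h : ∑ g, y g * γ g = 0) (g : G) :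
    y g = 0 := by
  obtain ⟨j⟩ := ‹Nonempty J›
  have key : ∀ (h : G) (c : I →₀ R) (i : I),
      b.coord ⟨g, i, j⟩ (Finsupp.linearCombination R eN c * γ h * eP j) =
        if h = g then c i else 0 := by
    intro h c i
    induction c using Finsupp.induction_linear with
    | zero => simp
    | add c d hc hd =>
      rw [map_add, add_mul, add_mul, map_add, hc, hd]
      split_ifs <;> simp
    | single k r =>
      classical
      rw [Finsupp.linearCombination_single, smul_mul_assoc, smul_mul_assoc, ← hb, map_smul,
        Module.Basis.coord_apply, Module.Basis.repr_self, Finsupp.single_apply]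
      by_cases hg : h = g
      · subst hg
        by_cases hk : k = i <;> simp [hk]
      · simp [hg]
  choose c hc using fun g => (Finsupp.mem_span_range_iff_exists_finsupp.1 (hy g))
  have hc' : ∀ g, y g = Finsupp.linearCombination R eN (c g) := fun g => by
    rw [Finsupp.linearCombination_apply]; exact (hc g).symm
  have : c g = 0 := by
    ext i
    have := congrArg (fun z => b.coord ⟨g, i, j⟩ (z * eP j)) h
    simpa [Finset.sum_mul, hc', key, -Module.Basis.coord_apply] using this
  rw [hc', this, map_zero]

theorem eq_zero_of_sum_grp_mul [Fintype G] [DecidableEq G] [Nonempty I] (y : G → H)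
    (hy : ∀ g, y g ∈ Submodule.span R (Set.range eP)) (h : ∑ g, γ g * y g = 0) (g : G) :
    y g = 0 := by
  obtain ⟨i⟩ := ‹Nonempty I›
  have key : ∀ (h : G) (c : J →₀ R) (j : J),
      b.coord ⟨g, i, j⟩ (eN i * (γ h * Finsupp.linearCombination R eP c)) =
        if h = g then c j else 0 := by
    intro h c j
    induction c using Finsupp.induction_linear with
    | zero => simp
    | add c d hc hd =>
      rw [map_add, mul_add, mul_add, map_add, hc, hd]
      split_ifs <;> simp
    | single k r =>
      classical
      rw [Finsupp.linearCombination_single, mul_smul_comm, mul_smul_comm, ← mul_assoc, ← hb,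
        map_smul, Module.Basis.coord_apply, Module.Basis.repr_self, Finsupp.single_apply]
      by_cases hg : h = g
      · subst hg
        by_cases hk : k = j <;> simp [hk]
      · simp [hg]
  choose c hc using fun g => (Finsupp.mem_span_range_iff_exists_finsupp.1 (hy g))
  have hc' : ∀ g, y g = Finsupp.linearCombination R eP (c g) := fun g => by
    rw [Finsupp.linearCombination_apply]; exact (hc g).symm
  have : c g = 0 := by
    ext j
    have := congrArg (fun z => b.coord ⟨g, i, j⟩ (eN i * z)) h
    simpa [Finset.mul_sum, hc', key, -Module.Basis.coord_apply] using this
  rw [hc', this, map_zero]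

/-- Right multiplication by `γ g * eP j` maps the family injectively into the basis `b`. -/
theorem linearIndependent_left [Nonempty G] [Nonempty J] : LinearIndependent R eN := by
  obtain ⟨g⟩ := ‹Nonempty G›
  obtain ⟨j⟩ := ‹Nonempty J›
  refine LinearIndependent.of_comp (LinearMap.mulRight R (γ g * eP j)) ?_
  have e : ⇑(LinearMap.mulRight R (γ g * eP j)) ∘ eN =
      b ∘ (fun i => (⟨g, i, j⟩ : Σ _ : G, I × J)) := by
    ext i; simp [hb, mul_assoc]
  rw [e]
  exact b.linearIndependent.comp _ fun i k h => by simpa using h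

theorem linearIndependent_right [Nonempty G] [Nonempty I] : LinearIndependent R eP := by
  obtain ⟨g⟩ := ‹Nonempty G›
  obtain ⟨i⟩ := ‹Nonempty I›
  refine LinearIndependent.of_comp (LinearMap.mulLeft R (eN i * γ g)) ?_
  have e : ⇑(LinearMap.mulLeft R (eN i * γ g)) ∘ eP =
      b ∘ (fun j => (⟨g, i, j⟩ : Σ _ : G, I × J)) := by
    ext j; simp [hb, mul_assoc]
  rw [e]
  exact b.linearIndependent.comp _ fun i k h => by simpa using h

/-- The tensor basis is mapped bijectively onto the basis `b`, up to reordering the indices. -/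
theorem triangular_bijective {M Z P : Type*} [AddCommGroup M] [Module R M] [AddCommGroup Z]
    [Module R Z] [AddCommGroup P] [Module R P] (fm : M →ₗ[R] H) (f0 : Z →ₗ[R] H) (fp : P →ₗ[R] H)
    (bm : Module.Basis I R M) (bz : Module.Basis G R Z) (bp : Module.Basis J R P)
    (hm : ∀ i, fm (bm i) = eN i) (h0 : ∀ g, f0 (bz g) = γ g) (hp : ∀ j, fp (bp j) = eP j) :
    Function.Bijective (LinearMap.mul' R H ∘ₗ
      TensorProduct.map (LinearMap.mul' R H ∘ₗ TensorProduct.map fm f0) fp) := by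
  let σ : (I × G) × J ≃ (Σ _ : G, I × J) :=
    { toFun := fun x => ⟨x.1.2, x.1.1, x.2⟩
      invFun := fun x => ((x.2.1, x.1), x.2.2)
      left_inv := fun _ => rfl
      right_inv := fun _ => rfl }
  let e := ((bm.tensorProduct bz).tensorProduct bp).equiv b σ
  have : LinearMap.mul' R H ∘ₗ
      TensorProduct.map (LinearMap.mul' R H ∘ₗ TensorProduct.map fm f0) fp = e.toLinearMap := by
    refine ((bm.tensorProduct bz).tensorProduct bp).ext fun x => ?_
    rw [LinearEquiv.coe_coe, Module.Basis.equiv_apply]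
    obtain ⟨⟨i, g⟩, j⟩ := x
    rw [Module.Basis.tensorProduct_apply, Module.Basis.tensorProduct_apply]
    simp [σ, hm, h0, hp, hb]
  rw [this]
  exact e.bijective

end TripleBasis

/-! ### Functionals and gradings on extensions of scalars -/

section BaseChange

variable {V : Type*} [AddCommGroup V] [Module ℂ V] (R : Type*) [CommRing R] [Algebra ℂ R]

theorem ext_one_tmul {R V P : Type*} [AddCommGroup V] [Module ℂ V] [CommRing R] [Algebra ℂ R]
    [AddCommGroup P] [Module R P] {f g : R ⊗[ℂ] V →ₗ[R] P} (h : ∀ v, f (1 ⊗ₜ v) = g (1 ⊗ₜ v)) :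
    f = g := by
  ext w
  induction w with
  | zero => simp
  | add x y hx hy => rw [map_add, map_add, hx, hy]
  | tmul r v =>
    rw [← mul_one r, ← smul_eq_mul, ← TensorProduct.smul_tmul', map_smul, map_smul, h]

/-- The extension of scalars of a functional. -/
def extFun (f : V →ₗ[ℂ] ℂ) : R ⊗[ℂ] V →ₗ[R] R :=
  (Algebra.linearMap ℂ R ∘ₗ f).liftBaseChange R

theorem extFun_tmul (f : V →ₗ[ℂ] ℂ) (r : R) (v : V) :
    extFun R f (r ⊗ₜ v) = r * algebraMap ℂ R (f v) := by
  simp [extFun]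

theorem basis_baseChange_coord {κ : Type*} (b : Module.Basis κ ℂ V) (k : κ) :
    (b.baseChange R).coord k = extFun R (b.coord k) := by
  classical
  refine (b.baseChange R).ext fun l => ?_
  rw [Module.Basis.coord_apply, Module.Basis.repr_self, Module.Basis.baseChange_apply, extFun_tmul,
    Module.Basis.coord_apply, Module.Basis.repr_self]
  by_cases h : l = k <;> simp [h]

variable {G : Type*} [DecidableEq G]

theorem baseChange_proj_tmul (𝒱 : GradedMod ℂ G V) (g : G) (v : V) :
    (𝒱.baseChange R).proj g (1 ⊗ₜ v) = 1 ⊗ₜ 𝒱.proj g v := by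
  induction v using 𝒱.induction with
  | zero => simp
  | add v w hv hw => rw [TensorProduct.tmul_add, map_add, hv, hw, map_add, TensorProduct.tmul_add]
  | hom h v hv =>
    have hm : (1 : R) ⊗ₜ[ℂ] v ∈ (𝒱.baseChange R).comp h :=
      Submodule.tmul_mem_baseChange_of_mem (1 : R) hv
    by_cases hg : h = g
    · subst hg
      rw [GradedMod.proj_of_mem _ hm, 𝒱.proj_of_mem hv]
    · rw [GradedMod.proj_of_mem_ne _ hg hm, 𝒱.proj_of_mem_ne hg hv, TensorProduct.tmul_zero]

end BaseChange

section Heisenberg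

universe u v

variable {G : Type v} {Y : Type u} [Group G] [DecidableEq G] [AddCommGroup Y] [Module ℂ Y]
  [Fintype G] (𝒴 : YDMod ℂ G Y) (R : Type*) [CommRing R] [Algebra ℂ R] (μ : Cocycle G Rˣ)

/-! ### The cross relations -/

theorem extYD_act_tmul (g : G) {k : G} {v : Y} (hv : v ∈ 𝒴.comp k) :
    (extYD 𝒴 R μ).act g (1 ⊗ₜ v) = (μ.chi g k : R) • (1 ⊗ₜ[ℂ] 𝒴.act g v) :=
  ((𝒴.baseChange R).twistAct_of_mem μ g (Submodule.tmul_mem_baseChange_of_mem (1 : R) hv)).trans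
    rfl

theorem extYD_proj_tmul (g : G) (v : Y) :
    (extYD 𝒴 R μ).proj g (1 ⊗ₜ v) = 1 ⊗ₜ[ℂ] 𝒴.proj g v :=
  baseChange_proj_tmul R 𝒴.toGradedMod g v

theorem dual_baseChange_act_tmul (g : G) (f : Module.Dual ℂ Y) :
    (𝒴.dual.baseChange R).act g (1 ⊗ₜ f) = 1 ⊗ₜ[ℂ] 𝒴.dual.act g f := rfl

/-- The scalar identity behind `g ⋆ v = (g ▷_χ v) ⋆ g`: the two sides carry the factors `μ(g, k)`
and `χ(g, k) μ(g k g⁻¹, g)`. -/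
theorem Cocycle.chi_mul_apply {G R : Type*} [Group G] [CommRing R] (μ : Cocycle G Rˣ) (g k : G) :
    (μ.chi g k : R) * (μ (g * k * g⁻¹) g : R) = μ g k := by
  rw [← Units.val_mul, Cocycle.chi, inv_mul_cancel_right]

/-- The functionals on `R ⊗ Y` given by the elements of `Y*`. -/
abbrev extDual (f : Module.Dual ℂ Y) : R ⊗[ℂ] Y →ₗ[R] R := extFun R f

/-- The functional on `R ⊗ Y*` given by an element of `Y`. -/
abbrev extEval (v : Y) : R ⊗[ℂ] Module.Dual ℂ Y →ₗ[R] R := extFun R (Module.Dual.eval ℂ Y v)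

/-- The functional on `R ⊗ Y*` given by the component of degree `g` of an element of `Y`. -/
abbrev extEvalComp (i : Y × G) : R ⊗[ℂ] Module.Dual ℂ Y →ₗ[R] R :=
  extEval R (𝒴.proj i.2 i.1)

section Relations

variable {B : Type*} [Ring B] [Algebra R B] (N : R ⊗[ℂ] Y →ₗ[R] B)
  (P : R ⊗[ℂ] Module.Dual ℂ Y →ₗ[R] B) (γ : G → B)

/-- The cross relations of the extension, for the images of `v`, `f` and `g` in an algebra. -/
structure CrossRelations : Prop where
  grp_neg : ∀ g v, γ g * N (1 ⊗ₜ v) = N ((extYD 𝒴 R μ).act g (1 ⊗ₜ v)) * γ g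
  grp_pos : ∀ g f, γ g * P (1 ⊗ₜ f) = P (1 ⊗ₜ 𝒴.dual.act g f) * γ g
  pos_neg : ∀ f v, P (1 ⊗ₜ f) * N (1 ⊗ₜ v) - N (1 ⊗ₜ v) * P (1 ⊗ₜ f) =
    ∑ h : G, algebraMap ℂ R (f (𝒴.proj h v)) • γ h

namespace CrossRelations

variable {𝒴 R μ N P γ} (h : CrossRelations 𝒴 R μ N P γ)

include h

theorem grp_mul_neg (g : G) (w : R ⊗[ℂ] Y) : γ g * N w = N ((extYD 𝒴 R μ).act g w) * γ g :=
  LinearMap.congr_fun (ext_one_tmul (f := LinearMap.mulLeft R (γ g) ∘ₗ N)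
    (g := LinearMap.mulRight R (γ g) ∘ₗ N ∘ₗ (extYD 𝒴 R μ).act g) (h.grp_neg g)) w

theorem grp_mul_pos (g : G) (w : R ⊗[ℂ] Module.Dual ℂ Y) :
    γ g * P w = P ((𝒴.dual.baseChange R).act g w) * γ g :=
  LinearMap.congr_fun (ext_one_tmul (f := LinearMap.mulLeft R (γ g) ∘ₗ P)
    (g := LinearMap.mulRight R (γ g) ∘ₗ P ∘ₗ (𝒴.dual.baseChange R).act g) (h.grp_pos g)) w

theorem pos_mul_neg (f : Module.Dual ℂ Y) (w : R ⊗[ℂ] Y) : P (1 ⊗ₜ f) * N w =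
    N w * P (1 ⊗ₜ f) + ∑ g, extDual R f ((extYD 𝒴 R μ).proj g w) • γ g := by
  have := LinearMap.congr_fun (ext_one_tmul (f := LinearMap.mulLeft R (P (1 ⊗ₜ f)) ∘ₗ N)
    (g := LinearMap.mulRight R (P (1 ⊗ₜ f)) ∘ₗ N +
      ∑ g, (extDual R f ∘ₗ (extYD 𝒴 R μ).proj g).smulRight (γ g)) fun v => ?_) w
  · simpa using this
  · simp [extYD_proj_tmul, extFun_tmul, ← h.pos_neg]

theorem pos_mul_neg' (v : Y) (w : R ⊗[ℂ] Module.Dual ℂ Y) : P w * N (1 ⊗ₜ v) =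
    N (1 ⊗ₜ v) * P w + ∑ g, extEvalComp 𝒴 R (v, g) w • γ g := by
  have := LinearMap.congr_fun (ext_one_tmul (f := LinearMap.mulRight R (N (1 ⊗ₜ v)) ∘ₗ P)
    (g := LinearMap.mulLeft R (N (1 ⊗ₜ v)) ∘ₗ P +
      ∑ g, (extEvalComp 𝒴 R (v, g)).smulRight (γ g)) fun f => ?_) w
  · simpa using this
  · simp [extFun_tmul, ← h.pos_neg]

end CrossRelations

namespace CrossRelations

variable {𝒴 R μ γ} {N : TensorAlgebra R (R ⊗[ℂ] Y) →ₐ[R] B}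
  {P : TensorAlgebra R (R ⊗[ℂ] Module.Dual ℂ Y) →ₐ[R] B}
  (h : CrossRelations 𝒴 R μ (N.toLinearMap ∘ₗ TensorAlgebra.ι R)
    (P.toLinearMap ∘ₗ TensorAlgebra.ι R) γ)

include h

theorem grp_mul_negAlg (g : G) (x : TensorAlgebra R (R ⊗[ℂ] Y)) :
    γ g * N x = N (tensorAct (extYD 𝒴 R μ).act g x) * γ g :=
  grp_mul_lift (extYD 𝒴 R μ) γ N h.grp_mul_neg g x

theorem grp_mul_posAlg (g : G) (x : TensorAlgebra R (R ⊗[ℂ] Module.Dual ℂ Y)) :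
    γ g * P x = P (tensorAct (𝒴.dual.baseChange R).act g x) * γ g :=
  grp_mul_lift (𝒴.dual.baseChange R) γ P h.grp_mul_pos g x

theorem pos_mul_negAlg (f : Module.Dual ℂ Y) (x : TensorAlgebra R (R ⊗[ℂ] Y)) :
    P (TensorAlgebra.ι R (1 ⊗ₜ f)) * N x = N x * P (TensorAlgebra.ι R (1 ⊗ₜ f)) +
      ∑ g, N (negD (extYD 𝒴 R μ) (extDual R) (f, g) x) * γ g :=
  commutator_negD (extYD 𝒴 R μ) γ (extDual R) N (fun f => P (TensorAlgebra.ι R (1 ⊗ₜ f)))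
    h.grp_mul_neg h.pos_mul_neg f x

theorem posAlg_mul_neg (v : Y) (x : TensorAlgebra R (R ⊗[ℂ] Module.Dual ℂ Y)) :
    P x * N (TensorAlgebra.ι R (1 ⊗ₜ v)) = N (TensorAlgebra.ι R (1 ⊗ₜ v)) * P x +
      ∑ g, γ g * P (posE (𝒴.dual.baseChange R) (extEvalComp 𝒴 R) (v, g) x) :=
  commutator_posE (𝒴.dual.baseChange R) γ (extEvalComp 𝒴 R) P
    (fun v => N (TensorAlgebra.ι R (1 ⊗ₜ v))) h.grp_mul_pos h.pos_mul_neg' v x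

end CrossRelations

end Relations

/-! ### The triangular decomposition of the extension -/

/-- The map `T(R ⊗ Y) → (𝓗_Y)_μ`. -/
def HeisExt.negAlg : TensorAlgebra R (R ⊗[ℂ] Y) →ₐ[R] HeisExt 𝒴 R μ :=
  TensorAlgebra.lift R ((CocycleTwist.of ((heisGrading 𝒴).baseChange R) μ).toLinearMap ∘ₗ
    (Heis.neg 𝒴).baseChange R)

/-- The map `T(R ⊗ Y*) → (𝓗_Y)_μ`. -/
def HeisExt.posAlg : TensorAlgebra R (R ⊗[ℂ] Module.Dual ℂ Y) →ₐ[R] HeisExt 𝒴 R μ :=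
  TensorAlgebra.lift R ((CocycleTwist.of ((heisGrading 𝒴).baseChange R) μ).toLinearMap ∘ₗ
    (Heis.pos 𝒴).baseChange R)

theorem HeisExt.negAlg_ι (v : Y) :
    HeisExt.negAlg 𝒴 R μ (TensorAlgebra.ι R (1 ⊗ₜ v)) = HeisExt.neg 𝒴 R μ v := by
  simp [HeisExt.negAlg, HeisExt.neg]

theorem HeisExt.posAlg_ι (f : Module.Dual ℂ Y) :
    HeisExt.posAlg 𝒴 R μ (TensorAlgebra.ι R (1 ⊗ₜ f)) = HeisExt.pos 𝒴 R μ f := by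
  simp [HeisExt.posAlg, HeisExt.pos]

/-- Each relation is compared with its counterpart in `𝓗_Y`. For `v` of degree `k` the two
`⋆`-products with `g` acquire different cocycle values, and `χ(g, k)` compensates for them. The
other two relations involve only products with some `f`, of degree `1`, so they are unchanged. -/
theorem HeisExt.crossRelations : CrossRelations 𝒴 R μ
    ((HeisExt.negAlg 𝒴 R μ).toLinearMap ∘ₗ TensorAlgebra.ι R)
    ((HeisExt.posAlg 𝒴 R μ).toLinearMap ∘ₗ TensorAlgebra.ι R) (HeisExt.grp 𝒴 R μ) where
  grp_neg g v := by
    induction v using 𝒴.induction with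
    | zero => simp
    | add v w hv hw => simp only [TensorProduct.tmul_add, map_add, mul_add, add_mul, hv, hw]
    | hom k v hv =>
      rw [extYD_act_tmul 𝒴 R μ g hv, map_smul]
      simp only [LinearMap.comp_apply, AlgHom.toLinearMap_apply, HeisExt.negAlg_ι]
      have e1 := extOf_mul_of_mem (heisGrading 𝒴) R μ (Heis.grp_mem 𝒴 g) (Heis.neg_mem 𝒴 hv)
      have e2 := extOf_mul_of_mem (heisGrading 𝒴) R μ
        (Heis.neg_mem 𝒴 (𝒴.act_mem g k v hv)) (Heis.grp_mem 𝒴 g)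
      refine e1.trans ?_
      rw [smul_mul_assoc, Heis.grp_mul_neg, ← Cocycle.chi_mul_apply, mul_smul, ← e2]
      rfl
  grp_pos g f := by
    simp only [LinearMap.comp_apply, AlgHom.toLinearMap_apply, HeisExt.posAlg_ι]
    refine (mul_extOf (heisGrading 𝒴) R μ _ _ (Heis.pos_mem 𝒴 f)).trans ?_
    rw [Heis.grp_mul_pos]
    exact (extOf_mul (heisGrading 𝒴) R μ _ _ (Heis.pos_mem 𝒴 _)).symm
  pos_neg f v := by
    simp only [LinearMap.comp_apply, AlgHom.toLinearMap_apply, HeisExt.posAlg_ι,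
      HeisExt.negAlg_ι]
    rw [sub_eq_iff_eq_add']
    refine (extOf_mul (heisGrading 𝒴) R μ _ _ (Heis.pos_mem 𝒴 f)).trans ?_
    rw [Heis.pos_mul_neg, extOf_add, extOf_sum, ← mul_extOf _ _ _ _ _ (Heis.pos_mem 𝒴 f)]
    simp only [extOf_smul]
    rfl

theorem Heis.posAlg_mem (x : TensorAlgebra ℂ (Module.Dual ℂ Y)) :
    Heis.posAlg 𝒴 x ∈ (heisGrading 𝒴).comp 1 := by
  induction x using tensorAlgebra_induction_left with
  | one => rw [map_one]; exact (heisGrading 𝒴).one_mem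
  | add x y hx hy => rw [map_add]; exact Submodule.add_mem _ hx hy
  | smul r x hx => rw [map_smul]; exact Submodule.smul_mem _ _ hx
  | mul f x hx =>
    rw [map_mul, Heis.posAlg, TensorAlgebra.lift_ι_apply]
    have := (heisGrading 𝒴).mul_mem _ _ _ _ (Heis.pos_mem 𝒴 f) hx
    rwa [mul_one] at this

theorem Heis.span_pos_homogeneous :
    Submodule.span ℂ {f | ∃ g, Heis.pos 𝒴 f ∈ (heisGrading 𝒴).comp g} = ⊤ :=
  eq_top_iff.2 fun f _ => Submodule.subset_span ⟨1, Heis.pos_mem 𝒴 f⟩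

/-- A basis of the extension adapted to the triangular decomposition. -/
theorem HeisExt.exists_basis : ∃ (I J : Type u) (_ : Nonempty I) (_ : Nonempty J)
    (eN : I → HeisExt 𝒴 R μ) (eP : J → HeisExt 𝒴 R μ)
    (b : Module.Basis (Σ _ : G, I × J) R (HeisExt 𝒴 R μ)),
    (∀ g i j, b ⟨g, i, j⟩ = eN i * HeisExt.grp 𝒴 R μ g * eP j) ∧
    Subalgebra.toSubmodule (HeisExt.negAlg 𝒴 R μ).range = Submodule.span R (Set.range eN) ∧
    Subalgebra.toSubmodule (HeisExt.posAlg 𝒴 R μ).range = Submodule.span R (Set.range eP) := by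
  obtain ⟨I, J, hI, hJ, bm, bp, b, hk, hb⟩ := Heis.exists_basis 𝒴
  choose k hk using hk
  refine ⟨I, J, hI, hJ, fun i => extOf (heisGrading 𝒴) R μ (Heis.negQuot 𝒴 (bm i)),
    fun j => extOf (heisGrading 𝒴) R μ (Heis.posQuot 𝒴 (bp j)),
    -- The `⋆`-product of the three factors is `μ(k, g)` times the ordinary one, where `k` is the
    -- degree of the first factor; so the extended basis is rescaled by these units.
    ((b.baseChange R).map (CocycleTwist.of ((heisGrading 𝒴).baseChange R) μ)).unitsSMul
      (fun x => μ (k x.2.1) x.1), fun g i j => ?_, ?_, ?_⟩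
  · rw [Module.Basis.unitsSMul_apply, Module.Basis.map_apply, Module.Basis.baseChange_apply, hb,
      Units.smul_def]
    have hp : Heis.posQuot 𝒴 (bp j) ∈ (heisGrading 𝒴).comp 1 := by
      obtain ⟨x, hx⟩ := Submodule.Quotient.mk_surjective _ (bp j)
      rw [← hx]
      exact Heis.posAlg_mem 𝒴 x
    have e1 := extOf_mul_of_mem (heisGrading 𝒴) R μ (hk i) (Heis.grp_mem 𝒴 g)
    have e2 := mul_extOf (heisGrading 𝒴) R μ
      (Heis.negQuot 𝒴 (bm i) * Heis.grp 𝒴 g) _ hp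
    change _ • extOf (heisGrading 𝒴) R μ _ = _
    rw [← e2, ← smul_mul_assoc, ← e1]
    rfl
  · rw [range_lift_eq_span (heisGrading 𝒴) R μ (Heis.neg 𝒴) (Heis.span_neg_homogeneous 𝒴) _
      (HeisExt.negAlg_ι 𝒴 R μ), span_extOf_basis]
    refine congrArg _ (Set.ext fun z => ⟨?_, ?_⟩)
    · rintro ⟨x, rfl⟩
      exact ⟨Submodule.Quotient.mk x, rfl⟩
    · rintro ⟨a, rfl⟩
      obtain ⟨x, rfl⟩ := Submodule.Quotient.mk_surjective _ a
      exact ⟨x, rfl⟩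
  · rw [range_lift_eq_span (heisGrading 𝒴) R μ (Heis.pos 𝒴) (Heis.span_pos_homogeneous 𝒴) _
      (HeisExt.posAlg_ι 𝒴 R μ), span_extOf_basis]
    refine congrArg _ (Set.ext fun z => ⟨?_, ?_⟩)
    · rintro ⟨x, rfl⟩
      exact ⟨Submodule.Quotient.mk x, rfl⟩
    · rintro ⟨a, rfl⟩
      obtain ⟨x, rfl⟩ := Submodule.Quotient.mk_surjective _ a
      exact ⟨x, rfl⟩

theorem Heis.nontrivial : Nontrivial (Heis 𝒴) := by
  refine ⟨1, 0, fun h => ?_⟩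
  have := algebraMapInv_of_mem_radical ((Heis.negAlg_eq_zero_iff 𝒴 1).1 ((map_one _).trans h))
  simp at this

theorem HeisExt.algebraMap_injective (r : R) (hr : algebraMap R (HeisExt 𝒴 R μ) r = 0) :
    r = 0 := by
  have := Heis.nontrivial 𝒴
  rw [Algebra.algebraMap_eq_smul_one] at hr
  have h2 : (r ⊗ₜ[ℂ] (1 : Heis 𝒴) : R ⊗[ℂ] Heis 𝒴) = 0 := by
    have h3 : (r • ((1 : R) ⊗ₜ[ℂ] (1 : Heis 𝒴))) = 0 := hr
    simpa [TensorProduct.smul_tmul'] using h3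
  refine Algebra.TensorProduct.includeLeft_injective (R := ℂ) (S := ℂ) (A := R) (B := Heis 𝒴)
    (FaithfulSMul.algebraMap_injective ℂ (Heis 𝒴)) ?_
  rw [map_zero]
  exact h2

theorem mem_baseChange_of_extOf {A : Type*} [Ring A] [Algebra ℂ A] (𝒜 : GradedAlg ℂ G A)
    {s : Set (CocycleTwist (𝒜.baseChange R) μ)} (S : Submodule ℂ A)
    (hs : ∀ z ∈ s, ∃ a ∈ S, z = extOf 𝒜 R μ a) {z : CocycleTwist (𝒜.baseChange R) μ}
    (hz : z ∈ Submodule.span R s) : (CocycleTwist.of _ μ).symm z ∈ S.baseChange R := by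
  induction hz using Submodule.span_induction with
  | mem z h =>
    obtain ⟨a, ha, rfl⟩ := hs z h
    rw [extOf, LinearEquiv.symm_apply_apply]
    exact Submodule.tmul_mem_baseChange_of_mem (1 : R) ha
  | zero => simp
  | add x y _ _ hx hy => rw [map_add]; exact Submodule.add_mem _ hx hy
  | smul r x _ hx => rw [map_smul]; exact Submodule.smul_mem _ _ hx

/-- The image of the augmentation ideal of `T(V)` under an algebra map. -/
def augImage {V A : Type*} [AddCommGroup V] [Module ℂ V] [Ring A] [Algebra ℂ A]
    (n : V →ₗ[ℂ] A) : Submodule ℂ A :=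
  (LinearMap.ker (TensorAlgebra.algebraMapInv (R := ℂ) (M := V)).toLinearMap).map
    (TensorAlgebra.lift ℂ n).toLinearMap

/-- The kernel is compared with the radical through `Lowering.ker_iff`. Stability uses the
triangular basis of the extension, detection uses the minimality of `𝓗_Y`. -/
theorem HeisExt.negAlg_eq_zero_iff (x : TensorAlgebra R (R ⊗[ℂ] Y)) :
    HeisExt.negAlg 𝒴 R μ x = 0 ↔ x ∈ radical (negD (extYD 𝒴 R μ) (extDual R)) := by
  obtain ⟨I, J, hI, hJ, eN, eP, b, hb, hN, -⟩ := HeisExt.exists_basis 𝒴 R μ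
  have hrel := HeisExt.crossRelations 𝒴 R μ
  refine (negD_lowering (extYD 𝒴 R μ) (extDual R)).ker_iff (HeisExt.negAlg 𝒴 R μ).toLinearMap
    ?_ ?_ ?_ x
  -- If `x` maps to `0`, its commutator formula with `f` says that `∑ g, D_{f,g}(x) ⋆ g` is `0`, and
  -- the triangular basis separates the summands.
  · rintro x hx ⟨f, g⟩
    have h := hrel.pos_mul_negAlg f x
    have hx : HeisExt.negAlg 𝒴 R μ x = 0 := hx
    rw [hx, mul_zero, zero_mul, zero_add] at h
    refine eq_zero_of_sum_mul_grp b hb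
      (fun g => HeisExt.negAlg 𝒴 R μ (negD (extYD 𝒴 R μ) (extDual R) (f, g) x)) (fun g => ?_)
      h.symm g
    rw [← hN]
    exact ⟨_, rfl⟩
  · intro x h0 hx
    have hx : ∀ i, HeisExt.negAlg 𝒴 R μ (negD (extYD 𝒴 R μ) (extDual R) i x) = 0 := hx
    have hc : ∀ f, HeisExt.pos 𝒴 R μ f * HeisExt.negAlg 𝒴 R μ x =
        HeisExt.negAlg 𝒴 R μ x * HeisExt.pos 𝒴 R μ f := by
      intro f
      have h := hrel.pos_mul_negAlg f x
      rw [HeisExt.posAlg_ι] at h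
      simpa [hx] using h
    obtain ⟨z, hz⟩ := (CocycleTwist.of ((heisGrading 𝒴).baseChange R) μ).surjective
      (HeisExt.negAlg 𝒴 R μ x)
    -- The slices of `z` must come from elements of `T(Y)` over `ℂ` without constant term.
    have hmem : z ∈ (augImage (Heis.neg 𝒴)).baseChange R := by
      have := mem_baseChange_of_extOf R μ (heisGrading 𝒴) (augImage (Heis.neg 𝒴)) ?_
        (lift_mem_span_of_algebraMapInv_eq_zero (heisGrading 𝒴) R μ (Heis.neg 𝒴)
          (Heis.span_neg_homogeneous 𝒴) _ (HeisExt.negAlg_ι 𝒴 R μ) x h0)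
      · rwa [← hz, LinearEquiv.symm_apply_apply] at this
      · rintro _ ⟨y, hy, rfl⟩
        exact ⟨_, ⟨y, hy, rfl⟩, rfl⟩
    change HeisExt.negAlg 𝒴 R μ x = 0
    rw [← hz, LinearEquiv.map_eq_zero_iff]
    -- As `f` has degree `1`, commuting with `f` for `⋆` is commuting with `1 ⊗ f` in `R ⊗ 𝓗_Y`.
    -- Slices then commute with `f` in `𝓗_Y` and vanish there.
    refine eq_zero_of_slice fun l => ?_
    obtain ⟨y, hy, hyz⟩ := slice_mem l _ hmem
    have hyz : Heis.negAlg 𝒴 y = slice (Heis 𝒴) l z := hyz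
    rw [← hyz]
    refine Heis.negAlg_eq_zero_of_commute 𝒴 y hy fun f => ?_
    have h1 := (extOf_mul_of (heisGrading 𝒴) R μ _ (Heis.pos_mem 𝒴 f) z).symm.trans
      ((congrArg (fun w => HeisExt.pos 𝒴 R μ f * w) hz).trans ((hc f).trans
        ((congrArg (fun w => w * HeisExt.pos 𝒴 R μ f) hz.symm).trans
          (of_mul_extOf (heisGrading 𝒴) R μ _ (Heis.pos_mem 𝒴 f) z))))
    have h2 := congrArg (slice (Heis 𝒴) l)
      ((CocycleTwist.of ((heisGrading 𝒴).baseChange R) μ).injective h1)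
    rwa [slice_mul_left, slice_mul_right, ← hyz] at h2
  · intro r hr
    refine HeisExt.algebraMap_injective 𝒴 R μ r ?_
    rw [← AlgHom.commutes (HeisExt.negAlg 𝒴 R μ)]
    exact hr

theorem HeisExt.posAlg_eq_zero_iff (x : TensorAlgebra R (R ⊗[ℂ] Module.Dual ℂ Y)) :
    HeisExt.posAlg 𝒴 R μ x = 0 ↔
      x ∈ radical (posE (𝒴.dual.baseChange R) (extEvalComp 𝒴 R)) := by
  obtain ⟨I, J, hI, hJ, eN, eP, b, hb, -, hP⟩ := HeisExt.exists_basis 𝒴 R μ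
  have hrel := HeisExt.crossRelations 𝒴 R μ
  refine (posE_lowering (𝒴.dual.baseChange R) (extEvalComp 𝒴 R)).ker_iff
    (HeisExt.posAlg 𝒴 R μ).toLinearMap ?_ ?_ ?_ x
  · rintro x hx ⟨v, g⟩
    have h := hrel.posAlg_mul_neg v x
    have hx : HeisExt.posAlg 𝒴 R μ x = 0 := hx
    rw [hx, mul_zero, zero_mul, zero_add] at h
    refine eq_zero_of_sum_grp_mul b hb (fun g => HeisExt.posAlg 𝒴 R μ
      (posE (𝒴.dual.baseChange R) (extEvalComp 𝒴 R) (v, g) x)) (fun g => ?_) h.symm g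
    rw [← hP]
    exact ⟨_, rfl⟩
  · intro x h0 hx
    have hx : ∀ i, HeisExt.posAlg 𝒴 R μ
      (posE (𝒴.dual.baseChange R) (extEvalComp 𝒴 R) i x) = 0 := hx
    obtain ⟨z, hz⟩ := (CocycleTwist.of ((heisGrading 𝒴).baseChange R) μ).surjective
      (HeisExt.posAlg 𝒴 R μ x)
    have hmem : z ∈ (augImage (Heis.pos 𝒴)).baseChange R := by
      have := mem_baseChange_of_extOf R μ (heisGrading 𝒴) (augImage (Heis.pos 𝒴)) ?_
        (lift_mem_span_of_algebraMapInv_eq_zero (heisGrading 𝒴) R μ (Heis.pos 𝒴)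
          (Heis.span_pos_homogeneous 𝒴) _ (HeisExt.posAlg_ι 𝒴 R μ) x h0)
      · rwa [← hz, LinearEquiv.symm_apply_apply] at this
      · rintro _ ⟨y, hy, rfl⟩
        exact ⟨_, ⟨y, hy, rfl⟩, rfl⟩
    -- Here the elements `v` to commute with need not have degree `1`, but `z` does; so its products
    -- with `v` are again the untwisted ones.
    have hz1 : z ∈ ((heisGrading 𝒴).baseChange R).comp 1 := by
      refine Submodule.baseChange_mono R ?_ hmem
      rintro _ ⟨y, -, rfl⟩
      exact Heis.posAlg_mem 𝒴 y
    have hc : ∀ v, HeisExt.posAlg 𝒴 R μ x * HeisExt.neg 𝒴 R μ v =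
        HeisExt.neg 𝒴 R μ v * HeisExt.posAlg 𝒴 R μ x := by
      intro v
      have h := hrel.posAlg_mul_neg v x
      rw [HeisExt.negAlg_ι] at h
      simpa [hx] using h
    change HeisExt.posAlg 𝒴 R μ x = 0
    rw [← hz, LinearEquiv.map_eq_zero_iff]
    refine eq_zero_of_slice fun l => ?_
    obtain ⟨y, hy, hyz⟩ := slice_mem l _ hmem
    have hyz : Heis.posAlg 𝒴 y = slice (Heis 𝒴) l z := hyz
    rw [← hyz]
    refine Heis.posAlg_eq_zero_of_commute 𝒴 y hy fun v => ?_
    have h1 := hc v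
    rw [← hz, HeisExt.neg, cocycleTwist_of_mul_left _ μ hz1,
      cocycleTwist_of_mul_right _ μ hz1] at h1
    have h2 := congrArg (slice (Heis 𝒴) l)
      ((CocycleTwist.of ((heisGrading 𝒴).baseChange R) μ).injective h1)
    rwa [slice_mul_left, slice_mul_right, ← hyz] at h2
  · intro r hr
    refine HeisExt.algebraMap_injective 𝒴 R μ r ?_
    rw [← AlgHom.commutes (HeisExt.posAlg 𝒴 R μ)]
    exact hr

end Heisenberg

/-! ### Nichols algebras and twisted group algebras -/

section Nichols

variable {R V : Type*} [CommRing R] [AddCommGroup V] [Module R V]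

/-- The projection `T(V) → 𝓑(V, Ψ)`. -/
def Nichols.mk (Ψ : V ⊗[R] V →ₗ[R] V ⊗[R] V) : TensorAlgebra R V →ₐ[R] Nichols Ψ :=
  RingQuot.mkAlgHom R (NicholsRel Ψ)

theorem Nichols.mk_surjective (Ψ : V ⊗[R] V →ₗ[R] V ⊗[R] V) :
    Function.Surjective (Nichols.mk Ψ) :=
  RingQuot.mkAlgHom_surjective R (NicholsRel Ψ)

end Nichols

section TwistedGroupAlgebra

variable {G R : Type*} [Group G] [DecidableEq G] [Fintype G] [CommRing R] (μ : Cocycle G Rˣ)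

/-- The basis `G` of the twisted group algebra. -/
def TwistedGroupAlgebra.basis : Module.Basis G R (TwistedGroupAlgebra R G μ) :=
  Module.Basis.ofRepr ((CocycleTwist.of (groupAlgGrading R G) μ).symm ≪≫ₗ
    MonoidAlgebra.coeffLinearEquiv R)

theorem TwistedGroupAlgebra.basis_apply (g : G) :
    TwistedGroupAlgebra.basis μ g = TwistedGroupAlgebra.of R μ g := rfl

theorem TwistedGroupAlgebra.of_mul_of (g h : G) :
    TwistedGroupAlgebra.of R μ g * TwistedGroupAlgebra.of R μ h =
      (μ g h : R) • TwistedGroupAlgebra.of R μ (g * h) := by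
  refine (cocycleTwist_of_mul_of_mem (groupAlgGrading R G) μ (g := g) (h := h)
    ⟨1, rfl⟩ ⟨1, rfl⟩).trans ?_
  change _ • CocycleTwist.of _ μ (MonoidAlgebra.single g 1 * MonoidAlgebra.single h 1) = _
  rw [MonoidAlgebra.single_mul_single, mul_one]
  rfl

theorem TwistedGroupAlgebra.one_eq : (1 : TwistedGroupAlgebra R G μ) =
    TwistedGroupAlgebra.of R μ 1 := rfl

/-- The algebra map out of the twisted group algebra defined by a projective representation. -/
def TwistedGroupAlgebra.lift {B : Type*} [Ring B] [Algebra R B] (γ : G → B) (h1 : γ 1 = 1)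
    (hm : ∀ g h, γ g * γ h = (μ g h : R) • γ (g * h)) : TwistedGroupAlgebra R G μ →ₐ[R] B :=
  AlgHom.ofLinearMap ((TwistedGroupAlgebra.basis μ).constr R γ)
    (by rw [TwistedGroupAlgebra.one_eq, ← TwistedGroupAlgebra.basis_apply,
      Module.Basis.constr_basis, h1])
    (fun x y => by
      have : (LinearMap.mul R (TwistedGroupAlgebra R G μ)).compr₂
            ((TwistedGroupAlgebra.basis μ).constr R γ) =
          (LinearMap.mul R B).compl₁₂ ((TwistedGroupAlgebra.basis μ).constr R γ)
            ((TwistedGroupAlgebra.basis μ).constr R γ) := by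
        refine (TwistedGroupAlgebra.basis μ).ext fun g => (TwistedGroupAlgebra.basis μ).ext
          fun h => ?_
        simp only [LinearMap.compr₂_apply, LinearMap.compl₁₂_apply, LinearMap.mul_apply',
          Module.Basis.constr_basis, hm]
        rw [TwistedGroupAlgebra.basis_apply, TwistedGroupAlgebra.basis_apply,
          TwistedGroupAlgebra.of_mul_of, map_smul, ← TwistedGroupAlgebra.basis_apply,
          Module.Basis.constr_basis]
      exact LinearMap.congr_fun (LinearMap.congr_fun this x) y)

theorem TwistedGroupAlgebra.lift_of {B : Type*} [Ring B] [Algebra R B] (γ : G → B) (h1 : γ 1 = 1)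
    (hm : ∀ g h, γ g * γ h = (μ g h : R) • γ (g * h)) (g : G) :
    TwistedGroupAlgebra.lift μ γ h1 hm (TwistedGroupAlgebra.of R μ g) = γ g :=
  Module.Basis.constr_basis _ R _ g

theorem TwistedGroupAlgebra.mem_span (x : TwistedGroupAlgebra R G μ) :
    x ∈ Submodule.span R (Set.range (TwistedGroupAlgebra.of R μ)) := by
  have h := (TwistedGroupAlgebra.basis (R := R) μ).span_eq
  have e : ⇑(TwistedGroupAlgebra.basis (R := R) μ) = TwistedGroupAlgebra.of R μ := rfl
  rw [e] at h
  rw [h]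
  trivial

end TwistedGroupAlgebra

/-- The product of two subalgebras that commute up to order is a subalgebra. -/
theorem exists_subalgebra_eq_mul {R H : Type*} [CommRing R] [Ring H] [Algebra R H]
    (S T : Subalgebra R H)
    (h : Subalgebra.toSubmodule T * Subalgebra.toSubmodule S ≤
      Subalgebra.toSubmodule S * Subalgebra.toSubmodule T) :
    ∃ U : Subalgebra R H,
      Subalgebra.toSubmodule U = Subalgebra.toSubmodule S * Subalgebra.toSubmodule T := by
  have h1 : (1 : H) ∈ Subalgebra.toSubmodule S * Subalgebra.toSubmodule T := by
    simpa using Submodule.mul_mem_mul ((Subalgebra.mem_toSubmodule S).2 (one_mem S))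
      ((Subalgebra.mem_toSubmodule T).2 (one_mem T))
  have h2 : (Subalgebra.toSubmodule S * Subalgebra.toSubmodule T) *
      (Subalgebra.toSubmodule S * Subalgebra.toSubmodule T) ≤
      Subalgebra.toSubmodule S * Subalgebra.toSubmodule T :=
    calc _ = Subalgebra.toSubmodule S * (Subalgebra.toSubmodule T * Subalgebra.toSubmodule S) *
          Subalgebra.toSubmodule T := by simp only [mul_assoc]
      _ ≤ Subalgebra.toSubmodule S * (Subalgebra.toSubmodule S * Subalgebra.toSubmodule T) *
          Subalgebra.toSubmodule T := by gcongr
      _ = (Subalgebra.toSubmodule S * Subalgebra.toSubmodule S) *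
          (Subalgebra.toSubmodule T * Subalgebra.toSubmodule T) := by simp only [mul_assoc]
      _ = _ := by rw [S.isIdempotentElem_toSubmodule.eq, T.isIdempotentElem_toSubmodule.eq]
  exact ⟨Submodule.toSubalgebra _ h1 fun x y hx hy => h2 (Submodule.mul_mem_mul hx hy),
    Submodule.toSubalgebra_toSubmodule _ _ _⟩

section Heisenberg

universe u v

variable {G : Type v} {Y : Type u} [Group G] [DecidableEq G] [AddCommGroup Y] [Module ℂ Y]
  [Fintype G] (𝒴 : YDMod ℂ G Y) (R : Type*) [CommRing R] [Algebra ℂ R] (μ : Cocycle G Rˣ)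

/-! ### The extension as an algebra in the category of Yetter-Drinfeld modules -/

theorem HeisExt.grp_mul_grp (g h : G) :
    HeisExt.grp 𝒴 R μ g * HeisExt.grp 𝒴 R μ h = (μ g h : R) • HeisExt.grp 𝒴 R μ (g * h) := by
  have := extOf_mul_of_mem (heisGrading 𝒴) R μ (Heis.grp_mem 𝒴 g) (Heis.grp_mem 𝒴 h)
  rw [← map_mul] at this
  exact this

theorem HeisExt.grp_one : HeisExt.grp 𝒴 R μ 1 = 1 := by
  rw [HeisExt.grp, map_one]; rfl

/-- `g` is invertible for `⋆`, because `g ⋆ g⁻¹` is the unit `μ(g, g⁻¹)`. -/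
theorem HeisExt.mul_grp_cancel {g : G} {a b : HeisExt 𝒴 R μ}
    (h : a * HeisExt.grp 𝒴 R μ g = b * HeisExt.grp 𝒴 R μ g) : a = b := by
  have h2 := congrArg (fun z => z * HeisExt.grp 𝒴 R μ g⁻¹) h
  simp only [mul_assoc, HeisExt.grp_mul_grp, mul_inv_cancel, HeisExt.grp_one, mul_smul_comm,
    mul_one] at h2
  have h3 := congrArg (fun z => ((μ g g⁻¹)⁻¹ : Rˣ).val • z) h2
  simpa [smul_smul] using h3

/-- The action `▷_χ` is conjugation by `g` for the product `⋆`; that it respects products and the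
unit follows by cancelling `g`. -/
theorem HeisExt.act_mul_grp (g : G) (a : HeisExt 𝒴 R μ) :
    (heisExtYD 𝒴 R μ).act g a * HeisExt.grp 𝒴 R μ g = HeisExt.grp 𝒴 R μ g * a := by
  induction a using (heisExtYD 𝒴 R μ).induction with
  | zero => simp
  | add v w hv hw => rw [map_add, add_mul, hv, hw, mul_add]
  | hom k a ha =>
    obtain ⟨z, rfl⟩ := (CocycleTwist.of ((heisGrading 𝒴).baseChange R) μ).surjective a
    have hz : z ∈ ((heisYD 𝒴).baseChange R).comp k := ha
    have hz' : z ∈ ((heisGrading 𝒴).baseChange R).comp k := ha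
    have hg : (1 : R) ⊗ₜ[ℂ] Heis.grp 𝒴 g ∈ ((heisGrading 𝒴).baseChange R).comp g :=
      Submodule.tmul_mem_baseChange_of_mem (1 : R) (Heis.grp_mem 𝒴 g)
    have e1 : (heisExtYD 𝒴 R μ).act g (CocycleTwist.of ((heisGrading 𝒴).baseChange R) μ z) =
        CocycleTwist.of ((heisGrading 𝒴).baseChange R) μ
          ((μ.chi g k : R) • ((heisYD 𝒴).baseChange R).act g z) :=
      ((heisYD 𝒴).baseChange R).twistAct_of_mem μ g hz
    have e2 : ((heisYD 𝒴).baseChange R).act g z * ((1 : R) ⊗ₜ[ℂ] Heis.grp 𝒴 g) =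
        ((1 : R) ⊗ₜ[ℂ] Heis.grp 𝒴 g) * z := by
      clear ha hz hz' e1
      change ((heisYD 𝒴).act g).baseChange R z * _ = _
      induction z with
      | zero => simp
      | add x y hx hy => rw [map_add, add_mul, hx, hy, mul_add]
      | tmul r a =>
        change (r ⊗ₜ[ℂ] (Heis.grp 𝒴 g * (a * Heis.grp 𝒴 g⁻¹))) * _ = _
        rw [Algebra.TensorProduct.tmul_mul_tmul, Algebra.TensorProduct.tmul_mul_tmul, mul_one,
          one_mul, mul_assoc, mul_assoc, ← map_mul, inv_mul_cancel, map_one, mul_one]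
    have hz2 : ((heisYD 𝒴).baseChange R).act g z ∈
        ((heisGrading 𝒴).baseChange R).comp (g * k * g⁻¹) :=
      ((heisYD 𝒴).baseChange R).act_mem g k z hz
    rw [e1, map_smul, smul_mul_assoc, HeisExt.grp, cocycleTwist_of_mul_of_mem _ μ hz2 hg,
      cocycleTwist_of_mul_of_mem _ μ hg hz', e2, smul_smul, Cocycle.chi_mul_apply]

theorem HeisExt.isYDAlgebra : IsYDAlgebra (heisExtYD 𝒴 R μ) where
  one_mem := ((heisGrading 𝒴).baseChange R).one_mem
  mul_mem _ _ _ _ ha hb := ((heisGrading 𝒴).baseChange R).starMul_mem μ ha hb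
  act_one g := HeisExt.mul_grp_cancel 𝒴 R μ (g := g) (by
    rw [HeisExt.act_mul_grp, mul_one, one_mul])
  act_mul g a b := HeisExt.mul_grp_cancel 𝒴 R μ (g := g) (by
    rw [HeisExt.act_mul_grp, mul_assoc ((heisExtYD 𝒴 R μ).act g a), HeisExt.act_mul_grp,
      ← mul_assoc, ← mul_assoc, HeisExt.act_mul_grp])

/-! ### Embeddings of Nichols algebras -/

theorem HeisExt.exists_neg_embedding [FiniteDimensional ℂ Y] :
    ∃ im : NicholsNeg 𝒴 R μ →ₐ[R] HeisExt 𝒴 R μ,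
      (∀ v, im (Nichols.ι _ v) = HeisExt.negAlg 𝒴 R μ (TensorAlgebra.ι R v)) ∧
      Function.Injective im ∧ im.range = (HeisExt.negAlg 𝒴 R μ).range := by
  let b := Module.finBasis ℂ Y
  refine exists_nichols_embedding _ _ _ _ (fun i w v => ?_) (b.baseChange R) (fun k => ?_) _
    (HeisExt.negAlg_eq_zero_iff 𝒴 R μ)
  · rw [negD_braiding]
    simp
  -- A coordinate functional is the sum of its restrictions to the homogeneous components, which are
  -- among the functionals that define the derivations.
  · have : (b.baseChange R).coord k =
        ∑ g, extDual R (b.coord k) ∘ₗ (extYD 𝒴 R μ).proj g := by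
      rw [basis_baseChange_coord]
      refine LinearMap.ext fun w => ?_
      conv_lhs => rw [← (extYD 𝒴 R μ).sum_proj w]
      simp
    rw [this]
    exact Submodule.sum_mem _ fun g _ => Submodule.subset_span ⟨(b.coord k, g), rfl⟩

theorem extEval_act (g : G) (v : Y) (w : R ⊗[ℂ] Module.Dual ℂ Y) :
    extEval R (𝒴.act g v) ((𝒴.dual.baseChange R).act g w) = extEval R v w :=
  LinearMap.congr_fun (ext_one_tmul
    (f := extEval R (𝒴.act g v) ∘ₗ (𝒴.dual.baseChange R).act g) (g := extEval R v) fun f => by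
      rw [LinearMap.comp_apply, dual_baseChange_act_tmul, extFun_tmul, extFun_tmul,
        Module.Dual.eval_apply, Module.Dual.eval_apply, dual_act_act]) w

/-- The commutators produce derivations that strip letters from the left, while the Nichols algebra
of `τ Ψ* τ` is governed by those that strip from the right. This passes from the former to the
latter. -/
theorem HeisExt.posAlg_eq_zero_iff_posD (x : TensorAlgebra R (R ⊗[ℂ] Module.Dual ℂ Y)) :
    HeisExt.posAlg 𝒴 R μ x = 0 ↔
      x ∈ radical (posD (𝒴.dual.baseChange R) (extEval R) fun g v => 𝒴.act g v) := by
  rw [HeisExt.posAlg_eq_zero_iff, radical_posE_eq (𝒴.dual.baseChange R) (extEval R)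
    (fun g v => 𝒴.act g v) (extEval_act 𝒴 R) (fun g h v => by rw [map_mul]; rfl)
    (extEvalComp 𝒴 R) ?_ (act_act_inv 𝒴) (fun v g => 𝒴.proj g v) (fun _ _ => rfl) fun v => ?_]
  -- As `(Y*)_h = (Y_{h⁻¹})*`, evaluation at a vector of `Y_g` vanishes on `(Y*)_h` unless `h =
  -- g⁻¹`.
  · rintro ⟨v, g⟩ h w hw hne
    change w ∈ (𝒴.dual.comp h).baseChange R at hw
    rw [Submodule.baseChange_eq_span] at hw
    induction hw using Submodule.span_induction with
    | mem w hw =>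
      obtain ⟨f, hf, rfl⟩ := hw
      have hf0 : f (𝒴.proj g v) = 0 :=
        hf g (fun e => hne (by rw [e, inv_inv])) _ (𝒴.proj_mem g v)
      simp [extFun_tmul, hf0]
    | zero => simp
    | add x y _ _ hx hy => rw [map_add, hx, hy, add_zero]
    | smul r x _ hx => rw [map_smul, hx, smul_zero]
  · refine ext_one_tmul fun f => ?_
    rw [LinearMap.sum_apply]
    simp only [extFun_tmul, Module.Dual.eval_apply, one_mul]
    rw [← map_sum, ← map_sum, 𝒴.sum_proj]

theorem HeisExt.exists_pos_embedding [FiniteDimensional ℂ Y] :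
    ∃ ip : NicholsPos 𝒴 R →ₐ[R] HeisExt 𝒴 R μ,
      (∀ v, ip (Nichols.ι _ v) = HeisExt.posAlg 𝒴 R μ (TensorAlgebra.ι R v)) ∧
      Function.Injective ip ∧ ip.range = (HeisExt.posAlg 𝒴 R μ).range := by
  let b := Module.finBasis ℂ Y
  refine exists_nichols_embedding _ _ _ _ (fun w u v => ?_) (b.dualBasis.baseChange R)
    (fun k => ?_) _ (HeisExt.posAlg_eq_zero_iff_posD 𝒴 R μ)
  · exact posD_braiding (𝒴.dual.baseChange R) (extEval R) (fun g v => 𝒴.act g v)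
      (extEval_act 𝒴 R) (act_act_inv 𝒴) w u v
  · refine Submodule.subset_span ⟨b k, ?_⟩
    rw [basis_baseChange_coord]
    -- The coordinates for the dual basis are the evaluations at the basis of `Y`, hence among the
    -- given functionals.
    have : b.dualBasis.coord k = Module.Dual.eval ℂ Y (b k) :=
      LinearMap.ext fun f => b.dualBasis_repr f k
    rw [this]

/-- The embedding of the twisted group algebra. -/
def HeisExt.grpAlg : TwistedGroupAlgebra R G μ →ₐ[R] HeisExt 𝒴 R μ :=
  TwistedGroupAlgebra.lift μ (HeisExt.grp 𝒴 R μ) (HeisExt.grp_one 𝒴 R μ)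
    (HeisExt.grp_mul_grp 𝒴 R μ)

theorem HeisExt.grpAlg_of (g : G) :
    HeisExt.grpAlg 𝒴 R μ (TwistedGroupAlgebra.of R μ g) = HeisExt.grp 𝒴 R μ g :=
  TwistedGroupAlgebra.lift_of _ _ _ _ g

theorem HeisExt.grpAlg_injective : Function.Injective (HeisExt.grpAlg 𝒴 R μ) := by
  obtain ⟨I, J, ⟨i⟩, ⟨j⟩, eN, eP, b, hb, -, -⟩ := HeisExt.exists_basis 𝒴 R μ
  -- Multiplication by a fixed `eN i` on the left and `eP j` on the right maps the group elements
  -- into the basis.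
  have hli : LinearIndependent R (HeisExt.grp 𝒴 R μ) := by
    refine LinearIndependent.of_comp
      (LinearMap.mulRight R (eP j) ∘ₗ LinearMap.mulLeft R (eN i)) ?_
    have e : ⇑(LinearMap.mulRight R (eP j) ∘ₗ LinearMap.mulLeft R (eN i)) ∘
        HeisExt.grp 𝒴 R μ = b ∘ (fun g => (⟨g, i, j⟩ : Σ _ : G, I × J)) := by
      ext g; simp [hb]
    rw [e]
    exact b.linearIndependent.comp _ fun g h e => congrArg Sigma.fst e
  have e : ∀ x, HeisExt.grpAlg 𝒴 R μ x = Finsupp.linearCombination R (HeisExt.grp 𝒴 R μ)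
      ((TwistedGroupAlgebra.basis μ).repr x) := fun x =>
    (Module.Basis.constr_apply _ R _ x).trans (Finsupp.linearCombination_apply R _).symm
  intro x y hxy
  rw [e, e] at hxy
  exact (TwistedGroupAlgebra.basis μ).repr.injective (hli hxy)

end Heisenberg

section Heisenberg

variable {G Y : Type*} [Group G] [DecidableEq G] [AddCommGroup Y] [Module ℂ Y] [Fintype G]
  (𝒴 : YDMod ℂ G Y) (R : Type*) [CommRing R] [Algebra ℂ R] (μ : Cocycle G Rˣ)

/-! ### The universal property -/

/-- The map `a ⊗ x ⊗ b ↦ a x b`. -/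
abbrev tripleMul {R B M Z P : Type*} [CommRing R] [Ring B] [Algebra R B] [AddCommGroup M]
    [Module R M] [AddCommGroup Z] [Module R Z] [AddCommGroup P] [Module R P] (fm : M →ₗ[R] B)
    (f0 : Z →ₗ[R] B) (fp : P →ₗ[R] B) : (M ⊗[R] Z) ⊗[R] P →ₗ[R] B :=
  LinearMap.mul' R B ∘ₗ TensorProduct.map (LinearMap.mul' R B ∘ₗ TensorProduct.map fm f0) fp

section Universal

variable {H B : Type*} [Ring H] [Algebra R H] [Ring B] [Algebra R B]
  {im : NicholsNeg 𝒴 R μ →ₐ[R] H} {i0 : TwistedGroupAlgebra R G μ →ₐ[R] H}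
  {ip : NicholsPos 𝒴 R →ₐ[R] H}
  {jm : NicholsNeg 𝒴 R μ →ₐ[R] B} {j0 : TwistedGroupAlgebra R G μ →ₐ[R] B}
  {jp : NicholsPos 𝒴 R →ₐ[R] B}

/-- The cross relations for algebra maps from the three factors of the extension. -/
abbrev AlgCrossRelations (im : NicholsNeg 𝒴 R μ →ₐ[R] H)
    (i0 : TwistedGroupAlgebra R G μ →ₐ[R] H) (ip : NicholsPos 𝒴 R →ₐ[R] H) : Prop :=
  CrossRelations 𝒴 R μ ((im.comp (Nichols.mk _)).toLinearMap ∘ₗ TensorAlgebra.ι R)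
    ((ip.comp (Nichols.mk _)).toLinearMap ∘ₗ TensorAlgebra.ι R)
    (fun g => i0 (TwistedGroupAlgebra.of R μ g))

variable {𝒴 R μ}

theorem AlgCrossRelations.intro
    (h1 : ∀ (g : G) (v : Y), i0 (TwistedGroupAlgebra.of R μ g) * im (Nichols.ι _ (1 ⊗ₜ[ℂ] v)) =
      im (Nichols.ι _ ((extYD 𝒴 R μ).act g (1 ⊗ₜ[ℂ] v))) * i0 (TwistedGroupAlgebra.of R μ g))
    (h2 : ∀ (g : G) (f : Module.Dual ℂ Y),
      i0 (TwistedGroupAlgebra.of R μ g) * ip (Nichols.ι _ (1 ⊗ₜ[ℂ] f)) =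
        ip (Nichols.ι _ (1 ⊗ₜ[ℂ] 𝒴.dual.act g f)) * i0 (TwistedGroupAlgebra.of R μ g))
    (h3 : ∀ (f : Module.Dual ℂ Y) (v : Y),
      ip (Nichols.ι _ (1 ⊗ₜ[ℂ] f)) * im (Nichols.ι _ (1 ⊗ₜ[ℂ] v)) -
          im (Nichols.ι _ (1 ⊗ₜ[ℂ] v)) * ip (Nichols.ι _ (1 ⊗ₜ[ℂ] f)) =
        ∑ h : G, algebraMap ℂ R (f (𝒴.proj h v)) • i0 (TwistedGroupAlgebra.of R μ h)) :
    AlgCrossRelations 𝒴 R μ im i0 ip :=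
  ⟨h1, h2, h3⟩

theorem mem_span_triple (hbij : Function.Surjective
    (tripleMul im.toLinearMap i0.toLinearMap ip.toLinearMap)) (z : H) :
    z ∈ Submodule.span R {z | ∃ x g c, z = im (Nichols.mk _ x) *
      i0 (TwistedGroupAlgebra.of R μ g) * ip c} := by
  obtain ⟨t, rfl⟩ := hbij z
  induction t with
  | zero => simp
  | add x y hx hy => rw [map_add]; exact Submodule.add_mem _ hx hy
  | tmul s c =>
    induction s with
    | zero => simp
    | add x y hx hy => rw [TensorProduct.add_tmul, map_add]; exact Submodule.add_mem _ hx hy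
    | tmul a z =>
      obtain ⟨x, rfl⟩ := Nichols.mk_surjective _ a
      induction TwistedGroupAlgebra.mem_span μ z using Submodule.span_induction with
      | mem z h =>
        obtain ⟨g, rfl⟩ := h
        exact Submodule.subset_span ⟨x, g, c, by simp⟩
      | zero => simp
      | add x y _ _ hx hy =>
        rw [TensorProduct.tmul_add, TensorProduct.add_tmul, map_add]
        exact Submodule.add_mem _ hx hy
      | smul r x _ hx =>
        rw [TensorProduct.tmul_smul, ← TensorProduct.smul_tmul', map_smul]
        exact Submodule.smul_mem _ _ hx

theorem eq_top_of_generators (hbij : Function.Surjective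
    (tripleMul im.toLinearMap i0.toLinearMap ip.toLinearMap)) (S : Subalgebra R H)
    (hm : ∀ a, im a ∈ S) (h0 : ∀ g, i0 (TwistedGroupAlgebra.of R μ g) ∈ S)
    (hp : ∀ f, ip (Nichols.ι _ (1 ⊗ₜ[ℂ] f)) ∈ S) (z : H) : z ∈ S := by
  have hp' : ∀ c, ip c ∈ S := by
    intro c
    obtain ⟨x, rfl⟩ := Nichols.mk_surjective _ c
    induction x using tensorAlgebra_induction_left with
    | one => rw [map_one, map_one]; exact one_mem S
    | add x y hx hy => rw [map_add, map_add]; exact add_mem hx hy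
    | smul r x hx => rw [map_smul, map_smul]; exact S.smul_mem hx r
    | mul w x hx =>
      rw [map_mul, map_mul]
      refine mul_mem ?_ hx
      induction w with
      | zero => simp
      | add x y hx hy => rw [map_add, map_add, map_add]; exact add_mem hx hy
      | tmul r f =>
        rw [← mul_one r, ← smul_eq_mul, ← TensorProduct.smul_tmul', map_smul, map_smul, map_smul]
        exact S.smul_mem (hp f) r
  induction mem_span_triple hbij z using Submodule.span_induction with
  | mem z h =>
    obtain ⟨x, g, c, rfl⟩ := h
    exact mul_mem (mul_mem (hm _) (h0 g)) (hp' c)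
  | zero => exact zero_mem S
  | add x y _ _ hx hy => exact add_mem hx hy
  | smul r x _ hx => exact S.smul_mem hx r

/-- The right-hand side is formed from data in the three factor algebras alone, so it has the same
shape in every algebra with the cross relations; this makes `φ` below compatible with multiplication
by `f`. -/
theorem AlgCrossRelations.pos_mul_triple (hi : AlgCrossRelations 𝒴 R μ im i0 ip)
    (f : Module.Dual ℂ Y) (x : TensorAlgebra R (R ⊗[ℂ] Y)) (g : G) (c : NicholsPos 𝒴 R) :
    ip (Nichols.ι _ (1 ⊗ₜ[ℂ] f)) *
        (im (Nichols.mk _ x) * i0 (TwistedGroupAlgebra.of R μ g) * ip c) =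
      im (Nichols.mk _ x) * i0 (TwistedGroupAlgebra.of R μ g) *
          ip (Nichols.ι _ (1 ⊗ₜ[ℂ] 𝒴.dual.act g⁻¹ f) * c) +
        ∑ k, im (Nichols.mk _ (negD (extYD 𝒴 R μ) (extDual R) (f, k) x)) *
          i0 (TwistedGroupAlgebra.of R μ k * TwistedGroupAlgebra.of R μ g) * ip c := by
  have e1 := hi.pos_mul_negAlg f x
  have e3 := hi.grp_pos g (𝒴.dual.act g⁻¹ f)
  rw [act_act_inv] at e3
  change ip (Nichols.ι _ (1 ⊗ₜ[ℂ] f)) * im (Nichols.mk _ x) =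
    im (Nichols.mk _ x) * ip (Nichols.ι _ (1 ⊗ₜ[ℂ] f)) +
      ∑ k, im (Nichols.mk _ (negD (extYD 𝒴 R μ) (extDual R) (f, k) x)) *
        i0 (TwistedGroupAlgebra.of R μ k) at e1
  change i0 (TwistedGroupAlgebra.of R μ g) * ip (Nichols.ι _ (1 ⊗ₜ[ℂ] 𝒴.dual.act g⁻¹ f)) =
    ip (Nichols.ι _ (1 ⊗ₜ[ℂ] f)) * i0 (TwistedGroupAlgebra.of R μ g) at e3
  rw [← mul_assoc, ← mul_assoc, e1, add_mul, add_mul, Finset.sum_mul, Finset.sum_mul,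
    mul_assoc (im _) (ip _), ← e3, map_mul]
  simp only [map_mul, mul_assoc]

/-- A linear map that is compatible with the triangular decompositions is multiplicative, if the
cross relations hold. -/
theorem map_mul_of_crossRelations (hbij : Function.Surjective
    (tripleMul im.toLinearMap i0.toLinearMap ip.toLinearMap))
    (hi : AlgCrossRelations 𝒴 R μ im i0 ip) (hj : AlgCrossRelations 𝒴 R μ jm j0 jp)
    (φ : H →ₗ[R] B) (hφ : ∀ a z c, φ (im a * i0 z * ip c) = jm a * j0 z * jp c) (y z : H) :
    φ (y * z) = φ y * φ z := by
  have hφ1 : φ 1 = 1 := by simpa using hφ 1 1 1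
  have hφm : ∀ a, φ (im a) = jm a := fun a => by simpa using hφ a 1 1
  have hφ0 : ∀ z, φ (i0 z) = j0 z := fun z => by simpa using hφ 1 z 1
  have hφp : ∀ c, φ (ip c) = jp c := fun c => by simpa using hφ 1 1 c
  -- Multiplicativity in the left factor, against all right factors, is closed under products. Thus
  -- it is enough to check generators on the left.
  let S : Subalgebra R H :=
    { carrier := {y | ∀ w, φ (y * w) = φ y * φ w}
      mul_mem' := fun {a b} ha hb w => by rw [mul_assoc, ha, hb, ha, mul_assoc]
      add_mem' := fun {a b} ha hb w => by rw [add_mul, map_add, map_add, ha, hb, add_mul]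
      algebraMap_mem' := fun r w => by
        rw [Algebra.algebraMap_eq_smul_one, smul_mul_assoc, one_mul, map_smul, map_smul, hφ1,
          smul_mul_assoc, one_mul] }
  have key : ∀ y, (∀ x g c, φ (y * (im (Nichols.mk _ x) * i0 (TwistedGroupAlgebra.of R μ g) *
      ip c)) = φ y * φ (im (Nichols.mk _ x) * i0 (TwistedGroupAlgebra.of R μ g) * ip c)) →
      y ∈ S := by
    intro y hy w
    induction mem_span_triple hbij w using Submodule.span_induction with
    | mem z h =>
      obtain ⟨x, g, c, rfl⟩ := h
      exact hy x g c
    | zero => simp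
    | add x y _ _ hx hy => rw [mul_add, map_add, hx, hy, map_add, mul_add]
    | smul r x _ hx => rw [mul_smul_comm, map_smul, hx, map_smul, mul_smul_comm]
  refine eq_top_of_generators hbij S (fun a => ?_) (fun k => ?_) (fun f => ?_) y z
  -- For each kind of generator, its product with a triple is again a combination of triples,
  -- computed by the same formula in `H` and in `B`.
  · refine key _ fun x g c => ?_
    rw [← mul_assoc, ← mul_assoc, ← map_mul, hφ, hφ, hφm, map_mul]
    simp only [mul_assoc]
  · refine key _ fun x g c => ?_
    have e1 := hi.grp_mul_negAlg k x
    have e2 := hj.grp_mul_negAlg k x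
    simp only [AlgHom.comp_apply] at e1 e2
    rw [← mul_assoc, ← mul_assoc, e1, mul_assoc (im _), ← map_mul, hφ, hφ, hφ0, ← mul_assoc,
      ← mul_assoc, e2, map_mul]
    simp only [mul_assoc]
  · refine key _ fun x g c => ?_
    have e1 := hi.pos_mul_triple f x g c
    have e2 := hj.pos_mul_triple f x g c
    rw [e1, map_add, map_sum, hφ, hφp, hφ, e2]
    simp only [hφ]

/-- The universal property of a triangular decomposition with the cross relations. -/
theorem existsUnique_algHom_of_crossRelations (hbij : Function.Bijective
    (tripleMul im.toLinearMap i0.toLinearMap ip.toLinearMap))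
    (hi : AlgCrossRelations 𝒴 R μ im i0 ip) (hj : AlgCrossRelations 𝒴 R μ jm j0 jp) :
    ∃! φ : H →ₐ[R] B, φ.comp im = jm ∧ φ.comp i0 = j0 ∧ φ.comp ip = jp := by
  let e := LinearEquiv.ofBijective _ hbij
  let φ : H →ₗ[R] B :=
    tripleMul jm.toLinearMap j0.toLinearMap jp.toLinearMap ∘ₗ e.symm.toLinearMap
  have hφ : ∀ a z c, φ (im a * i0 z * ip c) = jm a * j0 z * jp c := by
    intro a z c
    have h1 : im a * i0 z * ip c = e ((a ⊗ₜ z) ⊗ₜ c) := rfl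
    have h2 : e.symm (im a * i0 z * ip c) = (a ⊗ₜ z) ⊗ₜ c := by
      rw [h1, LinearEquiv.symm_apply_apply]
    exact (congrArg (tripleMul jm.toLinearMap j0.toLinearMap jp.toLinearMap) h2).trans rfl
  refine ⟨AlgHom.ofLinearMap φ (by simpa using hφ 1 1 1)
    (map_mul_of_crossRelations hbij.surjective hi hj φ hφ), ⟨?_, ?_, ?_⟩, ?_⟩
  · exact AlgHom.ext fun a => by simpa using hφ a 1 1
  · exact AlgHom.ext fun z => by simpa using hφ 1 z 1
  · exact AlgHom.ext fun c => by simpa using hφ 1 1 c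
  · rintro ψ ⟨rfl, rfl, rfl⟩
    refine AlgHom.ext fun z => ?_
    rw [AlgHom.ofLinearMap_apply]
    induction mem_span_triple hbij.surjective z using Submodule.span_induction with
    | mem z h =>
      obtain ⟨x, g, c, rfl⟩ := h
      rw [hφ, map_mul, map_mul]
      rfl
    | zero => simp
    | add x y _ _ hx hy => rw [map_add, map_add, hx, hy]
    | smul r x _ hx => rw [map_smul, map_smul, hx]

end Universal

end Heisenberg

/-! ### The subalgebras `A₋₁ A₀` and `A₀ A₁` -/

section Heisenberg

variable {G Y : Type*} [Group G] [DecidableEq G] [AddCommGroup Y] [Module ℂ Y]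
  [Fintype G] (𝒴 : YDMod ℂ G Y) (R : Type*) [CommRing R] [Algebra ℂ R] (μ : Cocycle G Rˣ)

theorem HeisExt.grpAlg_range : Subalgebra.toSubmodule (HeisExt.grpAlg 𝒴 R μ).range =
    Submodule.span R (Set.range (HeisExt.grp 𝒴 R μ)) := by
  apply le_antisymm
  · rintro _ ⟨x, rfl⟩
    change HeisExt.grpAlg 𝒴 R μ x ∈ _
    induction TwistedGroupAlgebra.mem_span μ x using Submodule.span_induction with
    | mem x h =>
      obtain ⟨g, rfl⟩ := h
      exact Submodule.subset_span ⟨g, (HeisExt.grpAlg_of 𝒴 R μ g).symm⟩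
    | zero => rw [map_zero]; exact Submodule.zero_mem _
    | add x y _ _ hx hy => rw [map_add]; exact Submodule.add_mem _ hx hy
    | smul r x _ hx => rw [map_smul]; exact Submodule.smul_mem _ _ hx
  · rw [Submodule.span_le]
    rintro _ ⟨g, rfl⟩
    exact ⟨_, HeisExt.grpAlg_of 𝒴 R μ g⟩

/-- By `g ⋆ x = (g ▷_χ x) ⋆ g`, the product of the two subalgebras in the opposite order is
contained in the given one. -/
theorem HeisExt.exists_subalgebra_neg_grp : ∃ S : Subalgebra R (HeisExt 𝒴 R μ),
    Subalgebra.toSubmodule S = Subalgebra.toSubmodule (HeisExt.negAlg 𝒴 R μ).range *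
      Subalgebra.toSubmodule (HeisExt.grpAlg 𝒴 R μ).range := by
  refine exists_subalgebra_eq_mul _ _ ?_
  rw [HeisExt.grpAlg_range, ← Submodule.span_eq (Subalgebra.toSubmodule
    (HeisExt.negAlg 𝒴 R μ).range), Submodule.span_mul_span, Submodule.span_le]
  rintro _ ⟨_, ⟨g, rfl⟩, _, ⟨x, rfl⟩, rfl⟩
  have h := (HeisExt.crossRelations 𝒴 R μ).grp_mul_negAlg g x
  change HeisExt.grp 𝒴 R μ g * HeisExt.negAlg 𝒴 R μ x ∈ _
  rw [h]
  exact Submodule.mul_mem_mul (Submodule.subset_span ⟨_, rfl⟩) (Submodule.subset_span ⟨g, rfl⟩)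

theorem HeisExt.exists_subalgebra_grp_pos : ∃ S : Subalgebra R (HeisExt 𝒴 R μ),
    Subalgebra.toSubmodule S = Subalgebra.toSubmodule (HeisExt.grpAlg 𝒴 R μ).range *
      Subalgebra.toSubmodule (HeisExt.posAlg 𝒴 R μ).range := by
  refine exists_subalgebra_eq_mul _ _ ?_
  rw [HeisExt.grpAlg_range, ← Submodule.span_eq (Subalgebra.toSubmodule
    (HeisExt.posAlg 𝒴 R μ).range), Submodule.span_mul_span, Submodule.span_le]
  rintro _ ⟨_, ⟨x, rfl⟩, _, ⟨g, rfl⟩, rfl⟩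
  -- Used for `g⁻¹ ▷ x`, the relation moves `g` from the right of `x` to the left.
  have h := (HeisExt.crossRelations 𝒴 R μ).grp_mul_posAlg g
    (tensorAct (𝒴.dual.baseChange R).act g⁻¹ x)
  rw [← tensorAct_mul, mul_inv_cancel, tensorAct_one] at h
  change HeisExt.posAlg 𝒴 R μ x * HeisExt.grp 𝒴 R μ g ∈ _
  rw [← h]
  exact Submodule.mul_mem_mul (Submodule.subset_span ⟨g, rfl⟩) (Submodule.subset_span ⟨_, rfl⟩)

end Heisenberg

/-! ### Bijectivity of the multiplication map -/

section Final

universe u v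

variable {G : Type v} {Y : Type u} [Group G] [DecidableEq G] [AddCommGroup Y] [Module ℂ Y]
  [Fintype G] (𝒴 : YDMod ℂ G Y) (R : Type*) [CommRing R] [Algebra ℂ R] (μ : Cocycle G Rˣ)

/-- The outer families of the triangular basis are independent and span the images of the two
Nichols algebras, so they pull back to bases of these. Together with the basis `G` of `RG_μ` they
map onto the basis of the extension. -/
theorem HeisExt.tripleMul_bijective (im : NicholsNeg 𝒴 R μ →ₐ[R] HeisExt 𝒴 R μ)
    (ip : NicholsPos 𝒴 R →ₐ[R] HeisExt 𝒴 R μ) (hm : Function.Injective im)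
    (hmr : im.range = (HeisExt.negAlg 𝒴 R μ).range) (hp : Function.Injective ip)
    (hpr : ip.range = (HeisExt.posAlg 𝒴 R μ).range) :
    Function.Bijective (tripleMul im.toLinearMap (HeisExt.grpAlg 𝒴 R μ).toLinearMap
      ip.toLinearMap) := by
  obtain ⟨I, J, hI, hJ, eN, eP, b, hb, hN, hP⟩ := HeisExt.exists_basis 𝒴 R μ
  obtain ⟨bm, hbm⟩ := exists_basis_of_injective im.toLinearMap hm (linearIndependent_left b hb)
    (by rw [← hN, ← hmr]; rfl)
  obtain ⟨bp, hbp⟩ := exists_basis_of_injective ip.toLinearMap hp (linearIndependent_right b hb)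
    (by rw [← hP, ← hpr]; rfl)
  exact triangular_bijective b hb im.toLinearMap (HeisExt.grpAlg 𝒴 R μ).toLinearMap
    ip.toLinearMap bm (TwistedGroupAlgebra.basis μ) bp hbm (HeisExt.grpAlg_of 𝒴 R μ) hbp

end Final

end

end BraidedDoubles

/-! ### The cocycle extension theorem -/

theorem mainTheorem4 {G : Type*} [Group G] [DecidableEq G] [Fintype G]
    {Y : Type*} [AddCommGroup Y] [Module ℂ Y] [FiniteDimensional ℂ Y] (𝒴 : YDMod ℂ G Y)
    (R : Type*) [CommRing R] [Algebra ℂ R] (μ : Cocycle G Rˣ) :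
    -- the extension is an algebra in the category of Yetter-Drinfeld modules
    IsYDAlgebra (heisExtYD 𝒴 R μ) ∧
    -- the subalgebras `A₋₁`, `A₀` and `A₁`
    ∃ (im : NicholsNeg 𝒴 R μ →ₐ[R] HeisExt 𝒴 R μ)
      (i0 : TwistedGroupAlgebra R G μ →ₐ[R] HeisExt 𝒴 R μ)
      (ip : NicholsPos 𝒴 R →ₐ[R] HeisExt 𝒴 R μ),
      (∀ v : Y, im (Nichols.ι _ (1 ⊗ₜ[ℂ] v)) = HeisExt.neg 𝒴 R μ v) ∧
      (∀ g : G, i0 (TwistedGroupAlgebra.of R μ g) = HeisExt.grp 𝒴 R μ g) ∧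
      (∀ f : Module.Dual ℂ Y, ip (Nichols.ι _ (1 ⊗ₜ[ℂ] f)) = HeisExt.pos 𝒴 R μ f) ∧
      Function.Injective im ∧ Function.Injective i0 ∧ Function.Injective ip ∧
      -- the triangular decomposition
      Function.Bijective
        (LinearMap.mul' R (HeisExt 𝒴 R μ) ∘ₗ
          TensorProduct.map
            (LinearMap.mul' R (HeisExt 𝒴 R μ) ∘ₗ
              TensorProduct.map im.toLinearMap i0.toLinearMap)
            ip.toLinearMap :
          ((NicholsNeg 𝒴 R μ ⊗[R] TwistedGroupAlgebra R G μ) ⊗[R] NicholsPos 𝒴 R) →ₗ[R]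
            HeisExt 𝒴 R μ) ∧
      -- `A₋₁ A₀` and `A₀ A₁` are subalgebras
      (∃ S : Subalgebra R (HeisExt 𝒴 R μ),
        Subalgebra.toSubmodule S =
          Subalgebra.toSubmodule im.range * Subalgebra.toSubmodule i0.range) ∧
      (∃ S : Subalgebra R (HeisExt 𝒴 R μ),
        Subalgebra.toSubmodule S =
          Subalgebra.toSubmodule i0.range * Subalgebra.toSubmodule ip.range) ∧
      -- the cross relations
      (∀ (g : G) (v : Y), HeisExt.grp 𝒴 R μ g * HeisExt.neg 𝒴 R μ v =
        im (Nichols.ι _ ((extYD 𝒴 R μ).act g (1 ⊗ₜ[ℂ] v))) * HeisExt.grp 𝒴 R μ g) ∧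
      (∀ (g : G) (f : Module.Dual ℂ Y), HeisExt.grp 𝒴 R μ g * HeisExt.pos 𝒴 R μ f =
        HeisExt.pos 𝒴 R μ (𝒴.dual.act g f) * HeisExt.grp 𝒴 R μ g) ∧
      (∀ (f : Module.Dual ℂ Y) (v : Y),
        HeisExt.pos 𝒴 R μ f * HeisExt.neg 𝒴 R μ v - HeisExt.neg 𝒴 R μ v * HeisExt.pos 𝒴 R μ f =
          ∑ h : G, algebraMap ℂ R (f (𝒴.proj h v)) • HeisExt.grp 𝒴 R μ h) ∧
      -- the product is completely described: `A₋₁`, `A₀`, `A₁` and the cross relations present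
      -- the extension
      (∀ (B : Type*) [Ring B] [Algebra R B]
        (jm : NicholsNeg 𝒴 R μ →ₐ[R] B) (j0 : TwistedGroupAlgebra R G μ →ₐ[R] B)
        (jp : NicholsPos 𝒴 R →ₐ[R] B),
        (∀ (g : G) (v : Y),
          j0 (TwistedGroupAlgebra.of R μ g) * jm (Nichols.ι _ (1 ⊗ₜ[ℂ] v)) =
            jm (Nichols.ι _ ((extYD 𝒴 R μ).act g (1 ⊗ₜ[ℂ] v))) *
              j0 (TwistedGroupAlgebra.of R μ g)) →
        (∀ (g : G) (f : Module.Dual ℂ Y),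
          j0 (TwistedGroupAlgebra.of R μ g) * jp (Nichols.ι _ (1 ⊗ₜ[ℂ] f)) =
            jp (Nichols.ι _ (1 ⊗ₜ[ℂ] 𝒴.dual.act g f)) * j0 (TwistedGroupAlgebra.of R μ g)) →
        (∀ (f : Module.Dual ℂ Y) (v : Y),
          jp (Nichols.ι _ (1 ⊗ₜ[ℂ] f)) * jm (Nichols.ι _ (1 ⊗ₜ[ℂ] v)) -
              jm (Nichols.ι _ (1 ⊗ₜ[ℂ] v)) * jp (Nichols.ι _ (1 ⊗ₜ[ℂ] f)) =
            ∑ h : G, algebraMap ℂ R (f (𝒴.proj h v)) • j0 (TwistedGroupAlgebra.of R μ h)) →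
        ∃! φ : HeisExt 𝒴 R μ →ₐ[R] B,
          φ.comp im = jm ∧ φ.comp i0 = j0 ∧ φ.comp ip = jp) := by
  refine ⟨HeisExt.isYDAlgebra 𝒴 R μ, ?_⟩
  obtain ⟨im, him, hmi, hmr⟩ := HeisExt.exists_neg_embedding 𝒴 R μ
  obtain ⟨ip, hip, hpi, hpr⟩ := HeisExt.exists_pos_embedding 𝒴 R μ
  have hbij := HeisExt.tripleMul_bijective 𝒴 R μ im ip hmi hmr hpi hpr
  have hrel := HeisExt.crossRelations 𝒴 R μ
  have hneg : ∀ v : Y, im (Nichols.ι _ (1 ⊗ₜ[ℂ] v)) = HeisExt.neg 𝒴 R μ v := fun v =>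
    (him _).trans (HeisExt.negAlg_ι 𝒴 R μ v)
  have hpos : ∀ f : Module.Dual ℂ Y, ip (Nichols.ι _ (1 ⊗ₜ[ℂ] f)) = HeisExt.pos 𝒴 R μ f :=
    fun f => (hip _).trans (HeisExt.posAlg_ι 𝒴 R μ f)
  have h1 : ∀ (g : G) (v : Y), HeisExt.grp 𝒴 R μ g * HeisExt.neg 𝒴 R μ v =
      im (Nichols.ι _ ((extYD 𝒴 R μ).act g (1 ⊗ₜ[ℂ] v))) * HeisExt.grp 𝒴 R μ g := by
    intro g v
    rw [him, ← HeisExt.negAlg_ι]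
    exact hrel.grp_neg g v
  have h2 : ∀ (g : G) (f : Module.Dual ℂ Y), HeisExt.grp 𝒴 R μ g * HeisExt.pos 𝒴 R μ f =
      HeisExt.pos 𝒴 R μ (𝒴.dual.act g f) * HeisExt.grp 𝒴 R μ g := by
    intro g f
    rw [← HeisExt.posAlg_ι, ← HeisExt.posAlg_ι]
    exact hrel.grp_pos g f
  have h3 : ∀ (f : Module.Dual ℂ Y) (v : Y),
      HeisExt.pos 𝒴 R μ f * HeisExt.neg 𝒴 R μ v - HeisExt.neg 𝒴 R μ v * HeisExt.pos 𝒴 R μ f =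
        ∑ h : G, algebraMap ℂ R (f (𝒴.proj h v)) • HeisExt.grp 𝒴 R μ h := by
    intro f v
    rw [← HeisExt.posAlg_ι, ← HeisExt.negAlg_ι]
    exact hrel.pos_neg f v
  refine ⟨im, HeisExt.grpAlg 𝒴 R μ, ip, hneg, HeisExt.grpAlg_of 𝒴 R μ, hpos, hmi,
    HeisExt.grpAlg_injective 𝒴 R μ, hpi, hbij, ?_, ?_, h1, h2, h3, ?_⟩
  · rw [hmr]
    exact HeisExt.exists_subalgebra_neg_grp 𝒴 R μ
  · rw [hpr]
    exact HeisExt.exists_subalgebra_grp_pos 𝒴 R μ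
  · intro B _ _ jm j0 jp k1 k2 k3
    refine existsUnique_algHom_of_crossRelations hbij (.intro (fun g v => ?_) (fun g f => ?_)
      fun f v => ?_) (.intro k1 k2 k3)
    · exact (congrArg₂ (· * ·) (HeisExt.grpAlg_of 𝒴 R μ g) (hneg v)).trans ((h1 g v).trans
        (congrArg (_ * ·) (HeisExt.grpAlg_of 𝒴 R μ g).symm))
    · exact (congrArg₂ (· * ·) (HeisExt.grpAlg_of 𝒴 R μ g) (hpos f)).trans ((h2 g f).trans
        (congrArg₂ (· * ·) (hpos _).symm (HeisExt.grpAlg_of 𝒴 R μ g).symm))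
    · exact (congrArg₂ (· - ·) (congrArg₂ (· * ·) (hpos f) (hneg v))
        (congrArg₂ (· * ·) (hneg v) (hpos f))).trans ((h3 f v).trans
          (Finset.sum_congr rfl fun h _ => congrArg _ (HeisExt.grpAlg_of 𝒴 R μ h).symm))
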